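/- Let $d\ge 1$, $x_0\in(0,1)^d$, and observe $Y_i=f_0(X_i)+\xi_i$ at design points $X_i\in[0,1]^d$, where $\xi_i$ are i.i.d. with $\mathbb E\xi_1=0$ and $0<\sigma^2=\mathbb E\xi_1^2<\infty$. Write $u\le v$ for the coordinatewise order, and $[u,v]$ for the corresponding rectangle. **Regression function.** $f_0:[0,1]^d\to\mathbb R$ is coordinatewise nondecreasing and $\alpha$-smooth at $x_0$ with intrinsic dimension $0\le s\le d$: $\alpha_1,\dots,\alpha_s\ge 1$ are integers and $\alpha_{s+1}=\dots=\alpha_d=\infty$ (with $1/\infty=0$). With $J_0$ the set of multi-indices $j\in\mathbb Z_{\ge0}^d$ with $\sum_{k\le s}j_k/\alpha_k\le 1$ and $j_k=0$ for $k>s$, the derivatives $\partial^j f_0(x_0)$, $j\in J_0$, exist; for $1\le k\le s$, $\partial_k^{m}f_0(x_0)=0$ for $1\le m\le\alpha_k-1$ and $\partial_k^{\alpha_k}f_0(x_0)\ne0$; and for every $L_0>0$, $$\lim_{\omega\downarrow0}\ \omega^{-1}\sup_{\substack{x\in[0,1]^d\\ |(x-x_0)_k|\le L_0\,\omega^{1/\alpha_k},\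 1\le k\le d}}\Big|f_0(x)-\sum_{j\in J_0}\frac{\partial^jf_0(x_0)}{j!}(x-x_0)^j\Big|=0 .$$ **Design.** One of the following holds. (i) *Fixed lattice design.* There are $\beta_1,\dots,\beta_d>0$ with $\sum_k\beta_k=1$ such that for every $n\ge1$ the design points are nonrandom and are the $\prod_k n_k$ distinct points of a product $\prod_{k=1}^d\{x_{1,k},\dots,x_{n_k,k}\}\subset[0,1]^d$, where $n_k=\lfloor n^{\beta_k}\rfloor$ and $x_{j+1,k}-x_{j,k}=1/n_k$ (the lattice may depend on $n$), and $x_0$ is one of them. The coordinates are ordered so that $\alpha_1\beta_1\le\dots\le\alpha_s\beta_s$, and the maximizer over $\ell\in\{1,\dots,d\}$ of $$\frac{\sum_{k=\ell}^d\beta_k}{2+\sum_{k=\ell}^s\alpha_k^{-1}}$$ is unique. (ii) *Random design.* There are $n$ design points $X_1,\dots,X_n$, i.i.d. uniform on $[0,1]^d$ and independent of the errors. **Estimators.** For a rectangle $[u,v]$ containing a design point let $\bar Y|_{[u,v]}$ be the average of the $Y_i$ with $X_i\in[u,v]$. Define $$\hat f_n^-(x_0)=\max_{u\le x_0}\ \min_{\substack{v\ge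 x_0\\ [u,v]\cap\{X_i\}\ne\emptyset}}\bar Y|_{[u,v]},\qquad \hat f_n^+(x_0)=\min_{v\ge x_0}\ \max_{\substack{u\le x_0\\ [u,v]\cap\{X_i\}\ne\emptyset}}\bar Y|_{[u,v]},$$ where the outer maximum (minimum) runs over those $u$ (those $v$) for which the inner one is over a nonempty set, and let $\hat f_n(x_0)=\tfrac12\big(\hat f_n^-(x_0)+\hat f_n^+(x_0)\big)$. For every $n\ge 1$ let $\hat u(x_0)\le x_0$ and $\hat v(x_0)\ge x_0$ almost surely be any points attaining the outer maximum in $\hat f_n^-(x_0)$ and the outer minimum in $\hat f_n^+(x_0)$, respectively. Put $$\sigma^2_{\hat u,\hat v}=\frac{1}{n_{\hat u,\hat v}(x_0)}\sum_{X_i\in[\hat u(x_0),\hat v(x_0)]}\big(Y_i-\hat f_n(x_0)\big)^2,$$ where $n_{\hat u,\hat v}(x_0)$ is the number of design points in $[\hat u(x_0),\hat v(x_0)]$, and $0/0=0$. **Conclusion.** For every such choice of $(\hat u(x_0),\hat v(x_0))$, $\sigma^2_{\hat u,\hat v}\to\sigma^2$ in probability as $n\to\infty$ (in outer probability if the choice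 is not measurable). -/

import Mathlib

open MeasureTheory ProbabilityTheory Filter Topology

noncomputable section

namespace BlockIsotonic

/-! ### Local smoothness of the regression function -/

/-- The real number `1/a` for an exponent `a`, with `1/∞ = 0` (note `(⊤ : ℕ∞).toNat = 0`). -/
def recip (a : ℕ∞) : ℝ := ((a.toNat : ℝ))⁻¹

/-- Iterated partial derivative: the derivative in the coordinates of the list, the last entry of
the list being applied first. -/
def iterPartial {d : ℕ} (f : (Fin d → ℝ) → ℝ) : List (Fin d) → (Fin d → ℝ) → ℝ
  | [], x => f x
  | k :: l, x => deriv (fun t : ℝ => iterPartial f l (Function.update x k t)) (x k)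

/-- The iterated partial derivative of `f` along the list exists at `x`: near `x`, on the line in
the outermost direction, the inner derivative exists, and there it is differentiable at `x`. -/
def IterPartialExists {d : ℕ} (f : (Fin d → ℝ) → ℝ) : List (Fin d) → (Fin d → ℝ) → Prop
  | [], _ => True
  | k :: l, x =>
      (∀ᶠ t in 𝓝 (x k), IterPartialExists f l (Function.update x k t)) ∧
        DifferentiableAt ℝ (fun t : ℝ => iterPartial f l (Function.update x k t)) (x k)

/-- The list `1, …, 1, 2, …, 2, …, d, …, d` in which `k` occurs `j k` times. -/
def multiIndexList {d : ℕ} (j : Fin d → ℕ) : List (Fin d) :=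
  (List.finRange d).flatMap fun k => List.replicate (j k) k

/-- The mixed partial derivative `∂^j f = ∂₁^{j₁} ⋯ ∂_d^{j_d} f`. -/
def mixedPartial {d : ℕ} (f : (Fin d → ℝ) → ℝ) (j : Fin d → ℕ) (x : Fin d → ℝ) : ℝ :=
  iterPartial f (multiIndexList j) x

open Classical in
/-- The set `J₀(α)` of multi-indices `j` with `∑_k j_k / α_k ≤ 1` and `j_k = 0` wherever
`α_k = ∞` (then the range below is `{0}`). -/
def taylorIndices {d : ℕ} (α : Fin d → ℕ∞) : Finset (Fin d → ℕ) :=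
  (Fintype.piFinset fun k => Finset.range ((α k).toNat + 1)).filter
    fun j => ∑ k, (j k : ℝ) * recip (α k) ≤ 1

/-- The anisotropic Taylor polynomial `∑_{j ∈ J₀(α)} ∂^j f(x₀) / j! · (x - x₀)^j`. -/
def taylorPoly {d : ℕ} (f : (Fin d → ℝ) → ℝ) (α : Fin d → ℕ∞) (x₀ x : Fin d → ℝ) : ℝ :=
  ∑ j ∈ taylorIndices α,
    mixedPartial f j x₀ / (∏ k, ((j k).factorial : ℝ)) * ∏ k, (x k - x₀ k) ^ j k

/-- `f` is coordinate-wise nondecreasing on `[0,1]^d` and `α`-smooth at `x₀` with intrinsic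
dimension `s`. -/
structure IsMonotoneSmooth {d : ℕ} (f : (Fin d → ℝ) → ℝ) (x₀ : Fin d → ℝ) (α : Fin d → ℕ∞)
    (s : ℕ) : Prop where
  monotoneOn : MonotoneOn f (Set.Icc 0 1)
  s_le : s ≤ d
  finite_exponent : ∀ k : Fin d, (k : ℕ) < s → 1 ≤ α k ∧ α k ≠ ⊤
  infinite_exponent : ∀ k : Fin d, s ≤ (k : ℕ) → α k = ⊤
  partial_exists : ∀ j ∈ taylorIndices α, IterPartialExists f (multiIndexList j) x₀
  partial_eq_zero : ∀ k : Fin d, (k : ℕ) < s → ∀ m : ℕ, 1 ≤ m → (m : ℕ∞) < α k →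
    mixedPartial f (Pi.single k m) x₀ = 0
  partial_ne_zero : ∀ k : Fin d, (k : ℕ) < s →
    mixedPartial f (Pi.single k (α k).toNat) x₀ ≠ 0
  taylor : ∀ L : ℝ, 0 < L → ∀ ε : ℝ, 0 < ε → ∀ᶠ w : ℝ in 𝓝[>] 0,
    ∀ x ∈ Set.Icc (0 : Fin d → ℝ) 1, (∀ k, |x k - x₀ k| ≤ L * w ^ recip (α k)) →
      |f x - taylorPoly f α x₀ x| ≤ ε * w

/-! ### Designs

The number of design points at stage `n` is `N n`, and `X n i`, `i < N n`, are the points. -/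

/-- The number `n_k = ⌊n^{β_k}⌋` of lattice points along an axis. -/
def axisCount (b : ℝ) (n : ℕ) : ℕ := ⌊(n : ℝ) ^ b⌋₊

/-- `β`-fixed lattice design containing `x₀`: at every stage `n ≥ 1` the points `x n i`,
`i < N n`, enumerate without repetition a product over `k` of `n_k = ⌊n^{β_k}⌋` points of `[0,1]`
with spacing `1 / n_k`, and `x₀` is one of them. -/
def IsLatticeDesign {d : ℕ} (β : Fin d → ℝ) (x₀ : Fin d → ℝ) (N : ℕ → ℕ)
    (x : ℕ → ℕ → Fin d → ℝ) : Prop :=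
  (∀ k, 0 < β k) ∧ ∑ k, β k = 1 ∧
    ∀ n : ℕ, 1 ≤ n → ∃ g : Fin d → ℕ → ℝ,
      (∀ k, ∀ j < axisCount (β k) n, g k j ∈ Set.Icc (0 : ℝ) 1) ∧
      (∀ k, ∀ j, j + 1 < axisCount (β k) n →
        g k (j + 1) - g k j = 1 / (axisCount (β k) n : ℝ)) ∧
      (∀ k, ∃ j < axisCount (β k) n, x₀ k = g k j) ∧
      N n = ∏ k, axisCount (β k) n ∧
      Set.BijOn (x n) (Set.Iio (N n)) {z | ∀ k, ∃ j < axisCount (β k) n, z k = g k j}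

/-- The quantity `(∑_{k ≥ ℓ} β_k) / (2 + ∑_{ℓ ≤ k ≤ s} 1/α_k)`; the terms with `α_k = ∞`
vanish. -/
def rateExponent {d : ℕ} (α : Fin d → ℕ∞) (β : Fin d → ℝ) (l : Fin d) : ℝ :=
  (∑ k ∈ Finset.Ici l, β k) / (2 + ∑ k ∈ Finset.Ici l, recip (α k))

/-- The fixed design: a lattice design, with the coordinates ordered so that
`α_1 β_1 ≤ … ≤ α_s β_s` (the later products are infinite), and such that `ℓ ↦ rateExponent α β ℓ`
has a unique maximiser. -/
def IsFixedDesign {Ω : Type*} {d : ℕ} (x₀ : Fin d → ℝ) (α : Fin d → ℕ∞) (s : ℕ) (N : ℕ → ℕ)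
    (X : ℕ → ℕ → Ω → Fin d → ℝ) : Prop :=
  ∃ (β : Fin d → ℝ) (x : ℕ → ℕ → Fin d → ℝ),
    (∀ n i ω, X n i ω = x n i) ∧ IsLatticeDesign β x₀ N x ∧
    (∀ k l : Fin d, k ≤ l → (l : ℕ) < s →
      ((α k).toNat : ℝ) * β k ≤ ((α l).toNat : ℝ) * β l) ∧
    ∃! l : Fin d, ∀ m : Fin d, rateExponent α β m ≤ rateExponent α β l

/-- The random design: i.i.d. uniform points of `[0,1]^d`, independent of the errors. -/
def IsUniformDesign {Ω : Type*} [MeasurableSpace Ω] {d : ℕ} (P : Measure Ω) (ξ : ℕ → Ω → ℝ)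
    (N : ℕ → ℕ) (X : ℕ → ℕ → Ω → Fin d → ℝ) : Prop :=
  (∀ n, N n = n) ∧ ∃ Z : ℕ → Ω → Fin d → ℝ,
    (∀ n i, X n i = Z i) ∧ (∀ i, Measurable (Z i)) ∧ iIndepFun Z P ∧
    (∀ i, P.map (Z i) = volume.restrict (Set.Icc (0 : Fin d → ℝ) 1)) ∧
    IndepFun (fun ω i => Z i ω) (fun ω i => ξ i ω) P

/-! ### Block estimators computed from a sample `(x i, y i)`, `i < N` -/

section Estimators

variable {d : ℕ} (x₀ : Fin d → ℝ) (N : ℕ) (x : ℕ → Fin d → ℝ) (y : ℕ → ℝ)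

open Classical in
/-- Indices of the design points in the block `[u, v]`. -/
def block (u v : Fin d → ℝ) : Finset ℕ :=
  (Finset.range N).filter fun i => u ≤ x i ∧ x i ≤ v

/-- The average of the observations over the block `[u, v]`. -/
def blockMean (u v : Fin d → ℝ) : ℝ :=
  (∑ i ∈ block N x u v, y i) / ((block N x u v).card : ℝ)

/-- `min_{v ≥ x₀, [u,v] ∩ {x_i} ≠ ∅}` of the block averages; finitely many values occur. -/
def lowerMin (u : Fin d → ℝ) : ℝ :=
  sInf {a | ∃ v, x₀ ≤ v ∧ (block N x u v).Nonempty ∧ a = blockMean N x y u v}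

/-- `max_{u ≤ x₀, [u,v] ∩ {x_i} ≠ ∅}` of the block averages; finitely many values occur. -/
def upperMax (v : Fin d → ℝ) : ℝ :=
  sSup {a | ∃ u, u ≤ x₀ ∧ (block N x u v).Nonempty ∧ a = blockMean N x y u v}

/-- The `u ≤ x₀` for which the inner minimum of the max-min formula runs over a nonempty set. -/
def LowerAdmissible (u : Fin d → ℝ) : Prop :=
  u ≤ x₀ ∧ ∃ v, x₀ ≤ v ∧ (block N x u v).Nonempty

/-- The `v ≥ x₀` for which the inner maximum of the min-max formula runs over a nonempty set. -/
def UpperAdmissible (v : Fin d → ℝ) : Prop :=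
  x₀ ≤ v ∧ ∃ u, u ≤ x₀ ∧ (block N x u v).Nonempty

/-- The block max-min estimator at `x₀`. -/
def maxMinEst : ℝ := sSup {a | ∃ u, LowerAdmissible x₀ N x u ∧ a = lowerMin x₀ N x y u}

/-- The block min-max estimator at `x₀`. -/
def minMaxEst : ℝ := sInf {a | ∃ v, UpperAdmissible x₀ N x v ∧ a = upperMax x₀ N x y v}

/-- The block average estimator at `x₀`. -/
def blockAvgEst : ℝ := (maxMinEst x₀ N x y + minMaxEst x₀ N x y) / 2

/-- `(u, v)` attains the outer maximum of the max-min formula and the outer minimum of the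
min-max formula. -/
def IsFeasiblePair (u v : Fin d → ℝ) : Prop :=
  (LowerAdmissible x₀ N x u ∧ lowerMin x₀ N x y u = maxMinEst x₀ N x y) ∧
    (UpperAdmissible x₀ N x v ∧ upperMax x₀ N x y v = minMaxEst x₀ N x y)

/-- The local variance estimator: the average over the design points in `[u, v]` of the squared
deviations of the observations from the block average estimator at `x₀`. -/
def localVarEst (u v : Fin d → ℝ) : ℝ :=
  (∑ i ∈ block N x u v, (y i - blockAvgEst x₀ N x y) ^ 2) / ((block N x u v).card : ℝ)

end Estimators

end BlockIsotonic

end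

set_option linter.unusedSectionVars false

namespace BlockIsotonic

/-! ### A multiparameter maximal inequality -/

/-- Independent centred square integrable errors with variances at most `v`. -/
structure CentredErrors {Ω : Type*} [MeasurableSpace Ω] (P : Measure Ω) (e : ℕ → Ω → ℝ) (v : ℝ) :
    Prop where
  meas : ∀ i, Measurable (e i)
  indep : iIndepFun e P
  memLp : ∀ i, MemLp (e i) 2 P
  mean : ∀ i, ∫ ω, e i ω ∂P = 0
  var : ∀ i, ∫ ω, e i ω ^ 2 ∂P ≤ v

/-- The σ-algebra generated by the errors with index in `I`. -/
abbrev errorSigma {Ω : Type*} (e : ℕ → Ω → ℝ) (I : Finset ℕ) : MeasurableSpace Ω :=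
  ⨆ i ∈ (I : Set ℕ), MeasurableSpace.comap (e i) inferInstance

lemma errorSigma_mono {Ω : Type*} {e : ℕ → Ω → ℝ} {I J : Finset ℕ} (h : I ⊆ J) : errorSigma e I ≤ errorSigma e J :=
  biSup_mono fun _ hi => h hi

lemma measurable_errorSigma {Ω : Type*} {e : ℕ → Ω → ℝ} {I : Finset ℕ} {i : ℕ} (hi : i ∈ I) : Measurable[errorSigma e I] (e i) :=
  Measurable.of_comap_le
    (le_biSup (fun i => MeasurableSpace.comap (e i) inferInstance) (show i ∈ (I : Set ℕ) from hi))

lemma measurable_sum_errorSigma {Ω : Type*} {e : ℕ → Ω → ℝ} {I A : Finset ℕ} (h : A ⊆ I) :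
    Measurable[errorSigma e I] (fun ω => ∑ i ∈ A, e i ω) :=
  Finset.measurable_fun_sum A fun _ hi => measurable_errorSigma (h hi)

lemma measurable_sup'_fun {Ω ι : Type*} {m : MeasurableSpace Ω} {𝒜 : Finset ι} (h𝒜 : 𝒜.Nonempty)
    {f : ι → Ω → ℝ} (hf : ∀ A ∈ 𝒜, Measurable (f A)) :
    Measurable fun ω => 𝒜.sup' h𝒜 fun A => f A ω := by
  have := Finset.measurable_sup' h𝒜 hf
  convert this using 1
  ext ω
  simp [Finset.sup'_apply]

section Maximal

variable {Ω : Type*} [MeasurableSpace Ω] {P : Measure Ω} {e : ℕ → Ω → ℝ}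

lemma errorSigma_le (he : ∀ i, Measurable (e i)) (I : Finset ℕ) :
    errorSigma e I ≤ ‹MeasurableSpace Ω› :=
  iSup₂_le fun i _ => (he i).comap_le

/-- The maximum of absolute values increases at least by a predictable multiple of the increment. -/
lemma exists_sign_le_sup' {ι : Type*} {m : MeasurableSpace Ω} (𝒜 : Finset ι) (h𝒜 : 𝒜.Nonempty)
    (g : ι → Ω → ℝ) (hg : ∀ A ∈ 𝒜, Measurable[m] (g A)) (b : ι → ℝ) (hb : ∀ A, |b A| ≤ 1) :
    ∃ ψ : Ω → ℝ, Measurable[m] ψ ∧ (∀ ω, |ψ ω| ≤ 1) ∧ ∀ ω x,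
      𝒜.sup' h𝒜 (fun A => |g A ω|) + ψ ω * x ≤ 𝒜.sup' h𝒜 (fun A => |g A ω + b A * x|) := by
  have single : ∀ A, Measurable[m] (g A) → ∃ ψ : Ω → ℝ, Measurable[m] ψ ∧ (∀ ω, |ψ ω| ≤ 1) ∧
      ∀ ω x, |g A ω| + ψ ω * x ≤ |g A ω + b A * x| := by
    intro A hA
    refine ⟨fun ω => if 0 ≤ g A ω then b A else - b A,
      Measurable.ite (measurableSet_le measurable_const hA) measurable_const measurable_const,
      fun ω => ?_, fun ω x => ?_⟩
    · dsimp only; split_ifs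
      · exact hb A
      · rw [abs_neg]; exact hb A
    · dsimp only; split_ifs with h
      · rw [abs_of_nonneg h]; exact le_abs_self _
      · rw [abs_of_neg (not_le.1 h)]
        calc _ = -(g A ω + b A * x) := by ring
          _ ≤ _ := neg_le_abs _
  induction h𝒜 using Finset.Nonempty.cons_induction with
  | singleton A => simpa using single A (hg A (by simp))
  | cons B s hB hs ih =>
    obtain ⟨ψ, hψ, hψ1, hψ2⟩ := ih fun A hA => hg A (Finset.mem_cons_of_mem hA)
    have hgB := hg B (Finset.mem_cons_self B s)
    obtain ⟨φ, hφ, hφ1, hφ2⟩ := single B hgB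
    have hsup : Measurable[m] (fun ω => (s.sup' hs fun A => |g A ω| : ℝ)) :=
      measurable_sup'_fun hs fun A hA => (hg A (Finset.mem_cons_of_mem hA)).abs
    refine ⟨fun ω => if (s.sup' hs fun A => |g A ω|) ≤ |g B ω| then φ ω else ψ ω,
      Measurable.ite (measurableSet_le hsup hgB.abs) hφ hψ, fun ω => ?_, fun ω x => ?_⟩
    · dsimp only; split_ifs
      · exact hφ1 ω
      · exact hψ1 ω
    · rw [Finset.sup'_cons hs, Finset.sup'_cons hs]
      dsimp only; split_ifs with h
      · rw [sup_eq_left.2 h]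
        exact (hφ2 ω x).trans le_sup_left
      · rw [sup_eq_right.2 (not_le.1 h).le]
        exact (hψ2 ω x).trans le_sup_right

variable [IsProbabilityMeasure P] {v : ℝ}

lemma CentredErrors.memLp_sum (H : CentredErrors P e v) (A : Finset ℕ) :
    MemLp (fun ω => ∑ i ∈ A, e i ω) 2 P :=
  memLp_finsetSum A fun i _ => H.memLp i

lemma CentredErrors.integral_sum_sq_le (H : CentredErrors P e v) (A : Finset ℕ) :
    ∫ ω, (∑ i ∈ A, e i ω) ^ 2 ∂P ≤ v * A.card := by
  have h1 := IndepFun.variance_sum (μ := P) (X := e) (s := A) (fun i _ => H.memLp i)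
    (fun i _ j _ hij => H.indep.indepFun hij)
  have h0 : ∫ ω, (∑ i ∈ A, e i) ω ∂P = 0 := by
    simp only [Finset.sum_apply]
    rw [integral_finsetSum _ fun i _ => (H.memLp i).integrable (by norm_num)]
    exact Finset.sum_eq_zero fun i _ => H.mean i
  rw [variance_of_integral_eq_zero (Finset.aemeasurable_sum _ fun i _ => (H.meas i).aemeasurable) h0] at h1
  simp only [Finset.sum_apply] at h1
  rw [h1, mul_comm, ← nsmul_eq_mul, ← Finset.sum_const]
  refine Finset.sum_le_sum fun i _ => ?_
  rw [variance_of_integral_eq_zero (H.meas i).aemeasurable (H.mean i)]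
  exact H.var i

lemma memLp_sup' {ι : Type*} (𝒜 : Finset ι) (h𝒜 : 𝒜.Nonempty) {f : ι → Ω → ℝ}
    (hf : ∀ A ∈ 𝒜, MemLp (f A) 2 P) : MemLp (fun ω => 𝒜.sup' h𝒜 fun A => f A ω) 2 P := by
  induction h𝒜 using Finset.Nonempty.cons_induction with
  | singleton A => simpa using hf A (by simp)
  | cons B s hB hs ih =>
    have := (hf B (Finset.mem_cons_self B s)).sup (ih fun A hA => hf A (Finset.mem_cons_of_mem hA))
    convert this using 1
    ext ω
    simp [Finset.sup'_cons hs]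

/-- Doob's `L²` inequality for the maximum of the absolute values of finitely many martingales. -/
lemma CentredErrors.exists_doob_bound (H : CentredErrors P e v) (𝒜 : Finset (Finset ℕ))
    (h𝒜 : 𝒜.Nonempty) (key : ℕ → ℝ) (I : Finset ℕ) :
    ∃ M : Ω → ℝ, Measurable[errorSigma e I] M ∧ (∀ ω, 0 ≤ M ω) ∧ MemLp M 2 P ∧
      (∀ A ∈ 𝒜, ∀ t ω, |∑ i ∈ I.filter (fun i => i ∈ A ∧ key i ≤ t), e i ω| ≤ M ω) ∧
      ∫ ω, M ω ^ 2 ∂P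
        ≤ ∫ ω, 2 * (𝒜.sup' h𝒜 fun A => |∑ i ∈ I.filter (· ∈ A), e i ω|) * M ω ∂P := by
  classical
  induction I using Finset.induction_on_max_value key with
  | empty => exact ⟨fun _ => 0, measurable_const, fun _ => le_rfl, MemLp.zero', by simp, by simp⟩
  | insert a I ha hmax ih =>
    obtain ⟨M, hM, hM0, hML, hMb, hMi⟩ := ih
    set X : Ω → ℝ := fun ω => 𝒜.sup' h𝒜 fun A => |∑ i ∈ I.filter (· ∈ A), e i ω| with hX
    set X' : Ω → ℝ := fun ω => 𝒜.sup' h𝒜 fun A => |∑ i ∈ (insert a I).filter (· ∈ A), e i ω|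
      with hX'
    have hXL : MemLp X 2 P := memLp_sup' 𝒜 h𝒜 fun A _ => (H.memLp_sum _).abs
    have hXL' : MemLp X' 2 P := memLp_sup' 𝒜 h𝒜 fun A _ => (H.memLp_sum _).abs
    have hXm' : Measurable[errorSigma e (insert a I)] X' :=
      measurable_sup'_fun (m := errorSigma e (insert a I)) h𝒜 fun A _ =>
        measurable_abs.comp (measurable_sum_errorSigma (Finset.filter_subset _ _))
    obtain ⟨ψ, hψ, hψ1, hψ2⟩ := exists_sign_le_sup' (m := errorSigma e I) 𝒜 h𝒜
      (fun A ω => ∑ i ∈ I.filter (· ∈ A), e i ω)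
      (fun A _ => measurable_sum_errorSigma (Finset.filter_subset _ _))
      (fun A => if a ∈ A then 1 else 0) (fun A => by split_ifs <;> simp)
    have hstep : ∀ ω, X ω + ψ ω * e a ω ≤ X' ω := by
      intro ω
      refine (hψ2 ω (e a ω)).trans (le_of_eq ?_)
      refine Finset.sup'_congr h𝒜 rfl fun A _ => ?_
      rw [Finset.filter_insert]
      split_ifs with h
      · rw [Finset.sum_insert (by simp [ha])]; congr 1; ring
      · simp
    have hle := errorSigma_le H.meas I
    have hind : IndepFun (fun ω => M ω * ψ ω) (e a) P := by
      rw [IndepFun_iff_Indep]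
      have h1 := indep_iSup_of_disjoint (fun i => (H.meas i).comap_le) H.indep.iIndep
        (S := (I : Set ℕ)) (T := {a}) (by simpa using ha)
      refine indep_of_indep_of_le_left (indep_of_indep_of_le_right h1 ?_) ?_
      · simp
      · exact (hM.mul hψ).comap_le
    have hzero : ∫ ω, M ω * ψ ω * e a ω ∂P = 0 := by
      rw [hind.integral_fun_mul_eq_mul_integral
        ((hM.mono hle le_rfl).mul (hψ.mono hle le_rfl)).aestronglyMeasurable
        (H.meas a).aestronglyMeasurable, H.mean a, mul_zero]
    have hψb : MemLp (fun ω => ψ ω * e a ω) 2 P := by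
      refine (H.memLp a).mono ((hψ.mono hle le_rfl).mul (H.meas a)).aestronglyMeasurable
        (Eventually.of_forall fun ω => ?_)
      rw [norm_mul]
      exact mul_le_of_le_one_left (norm_nonneg _) (hψ1 ω)
    have hML' : MemLp (fun ω => max (M ω) (X' ω)) 2 P := hML.sup hXL'
    refine ⟨fun ω => max (M ω) (X' ω), (hM.mono (errorSigma_mono (Finset.subset_insert a I))
      le_rfl).max hXm', fun ω => (hM0 ω).trans (le_max_left _ _), hML', ?_, ?_⟩
    · intro A hA t ω
      by_cases hat : key a ≤ t
      · refine le_trans (le_of_eq ?_) ((Finset.le_sup'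
          (fun A => |∑ i ∈ (insert a I).filter (· ∈ A), e i ω|) hA).trans (le_max_right _ _))
        congr 2
        refine Finset.filter_congr fun i hi => ?_
        rcases Finset.mem_insert.1 hi with rfl | hi
        · simp [hat]
        · simp [(hmax i hi).trans hat]
      · rw [Finset.filter_insert, if_neg (by simp [hat])]
        exact (hMb A hA t ω).trans (le_max_left _ _)
    · have hi1 : Integrable (fun ω => M ω ^ 2) P := hML.integrable_sq
      have hi2 : Integrable (fun ω => 2 * X ω * M ω) P := by
        simpa [mul_assoc] using (hXL.integrable_mul hML).const_mul 2
      have hi3 : Integrable (fun ω => 2 * X' ω * M ω) P := by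
        simpa [mul_assoc] using (hXL'.integrable_mul hML).const_mul 2
      have hi4 : Integrable (fun ω => 2 * X' ω * max (M ω) (X' ω)) P := by
        simpa [mul_assoc] using (hXL'.integrable_mul hML').const_mul 2
      have hi5 : Integrable (fun ω => M ω * ψ ω * e a ω) P := by
        simp only [mul_assoc]
        exact hML.integrable_mul hψb
      have hmono : ∫ ω, 2 * X ω * M ω ∂P + 2 * ∫ ω, M ω * ψ ω * e a ω ∂P
          ≤ ∫ ω, 2 * X' ω * M ω ∂P := by
        rw [← integral_const_mul, ← integral_add hi2 (hi5.const_mul 2)]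
        refine integral_mono (hi2.add (hi5.const_mul 2)) hi3 fun ω => ?_
        have := mul_le_mul_of_nonneg_left (hstep ω) (hM0 ω)
        linarith
      have hpath : ∫ ω, (max (M ω) (X' ω)) ^ 2 ∂P - ∫ ω, 2 * X' ω * max (M ω) (X' ω) ∂P
          ≤ ∫ ω, M ω ^ 2 ∂P - ∫ ω, 2 * X' ω * M ω ∂P := by
        rw [← integral_sub hML'.integrable_sq hi4, ← integral_sub hi1 hi3]
        refine integral_mono (hML'.integrable_sq.sub hi4) (hi1.sub hi3) fun ω => ?_
        simp only
        rcases max_choice (M ω) (X' ω) with h | h <;> rw [h]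
        nlinarith [sq_nonneg (M ω - X' ω)]
      rw [hzero] at hmono
      linarith

/-- The multiparameter `L²` maximal inequality. -/
lemma CentredErrors.exists_maximal_bound (H : CentredErrors P e v) {κ : Type*} (s : Finset κ)
    (key : ℕ → κ → ℝ) (I : Finset ℕ) :
    ∃ M : Ω → ℝ, MemLp M 2 P ∧
      (∀ (t : κ → ℝ) ω, |∑ i ∈ I.filter (fun i => ∀ k ∈ s, key i k ≤ t k), e i ω| ≤ M ω) ∧
      ∫ ω, M ω ^ 2 ∂P ≤ 4 ^ s.card * (v * I.card) := by
  classical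
  induction s using Finset.induction_on with
  | empty =>
    refine ⟨fun ω => |∑ i ∈ I, e i ω|, (H.memLp_sum I).abs, fun t ω => by simp, ?_⟩
    simpa using H.integral_sum_sq_le I
  | insert k s hk ih =>
    obtain ⟨M₀, hM₀, hM₀b, hM₀i⟩ := ih
    set 𝒜 : Finset (Finset ℕ) := I.powerset.filter
      fun A => ∃ t : κ → ℝ, A = I.filter (fun i => ∀ k ∈ s, key i k ≤ t k) with h𝒜def
    have h𝒜 : 𝒜.Nonempty :=
      ⟨I.filter (fun i => ∀ k ∈ s, key i k ≤ (0 : κ → ℝ) k), by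
        simp only [h𝒜def, Finset.mem_filter, Finset.mem_powerset]
        exact ⟨Finset.filter_subset _ _, 0, rfl⟩⟩
    obtain ⟨M, hM, hM0, hML, hMb, hMi⟩ := H.exists_doob_bound 𝒜 h𝒜 (fun i => key i k) I
    refine ⟨M, hML, fun t ω => ?_, ?_⟩
    · refine le_trans (le_of_eq ?_) (hMb (I.filter (fun i => ∀ k ∈ s, key i k ≤ t k)) ?_ (t k) ω)
      · congr 2
        ext i
        simp only [Finset.mem_filter, Finset.forall_mem_insert]
        tauto
      · simp only [h𝒜def, Finset.mem_filter, Finset.mem_powerset]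
        exact ⟨Finset.filter_subset _ _, t, rfl⟩
    · set X : Ω → ℝ := fun ω => 𝒜.sup' h𝒜 fun A => |∑ i ∈ I.filter (· ∈ A), e i ω| with hX
      have hXL : MemLp X 2 P := memLp_sup' 𝒜 h𝒜 fun A _ => (H.memLp_sum _).abs
      have hXM : ∀ ω, X ω ≤ M₀ ω := by
        intro ω
        refine Finset.sup'_le h𝒜 _ fun A hA => ?_
        obtain ⟨hAI, t, ht⟩ := Finset.mem_filter.1 hA
        have : I.filter (· ∈ A) = A := by
          rw [Finset.filter_mem_eq_inter, Finset.inter_eq_right]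
          exact Finset.mem_powerset.1 hAI
        rw [this, ht]
        exact hM₀b t ω
      have hX0 : ∀ ω, 0 ≤ X ω := fun ω => by
        obtain ⟨A, hA⟩ := h𝒜
        exact (abs_nonneg _).trans
          (Finset.le_sup' (fun A => |∑ i ∈ I.filter (· ∈ A), e i ω|) hA)
      have h1 : ∫ ω, 2 * X ω * M ω ∂P ≤ 2 * ∫ ω, M₀ ω ^ 2 ∂P + (1 / 2) * ∫ ω, M ω ^ 2 ∂P := by
        rw [← integral_const_mul, ← integral_const_mul,
          ← integral_add (hM₀.integrable_sq.const_mul 2) (hML.integrable_sq.const_mul _)]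
        refine integral_mono (by simpa [mul_assoc] using (hXL.integrable_mul hML).const_mul 2)
          ((hM₀.integrable_sq.const_mul 2).add (hML.integrable_sq.const_mul _)) fun ω => ?_
        have h2 : X ω ^ 2 ≤ M₀ ω ^ 2 := pow_le_pow_left₀ (hX0 ω) (hXM ω) 2
        nlinarith [sq_nonneg (2 * X ω - M ω)]
      rw [Finset.card_insert_of_notMem hk, pow_succ]
      linarith

open Classical in
/-- Some lower set of keys carries an error sum exceeding `lam` in absolute value. -/
def MaxDev {κ : Type*} (I : Finset ℕ) (key : ℕ → κ → ℝ) (x : ℕ → ℝ) (lam : ℝ) : Prop :=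
  ∃ t : κ → ℝ, lam < |∑ i ∈ I with key i ≤ t, x i|

lemma CentredErrors.prob_maxDev_le (H : CentredErrors P e v) {κ : Type*} [Fintype κ]
    (I : Finset ℕ) (key : ℕ → κ → ℝ) {lam : ℝ} (hlam : 0 < lam) :
    P.real {ω | MaxDev I key (fun i => e i ω) lam}
      ≤ 4 ^ Fintype.card κ * (v * I.card) / lam ^ 2 := by
  obtain ⟨M, hML, hMb, hMi⟩ := H.exists_maximal_bound Finset.univ key I
  have h1 := mul_meas_ge_le_integral_of_nonneg (μ := P) (f := fun ω => M ω ^ 2)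
    (Eventually.of_forall fun ω => sq_nonneg _) hML.integrable_sq (lam ^ 2)
  rw [le_div_iff₀ (by positivity), mul_comm]
  refine le_trans (mul_le_mul_of_nonneg_left (measureReal_mono ?_) (by positivity))
    (h1.trans hMi)
  rintro ω ⟨t, ht⟩
  classical
  have h2 : |∑ i ∈ I with key i ≤ t, e i ω| ≤ M ω := by
    refine le_trans (le_of_eq ?_) (hMb t ω)
    congr 2
    ext i
    simp [Pi.le_def]
  exact pow_le_pow_left₀ hlam.le (ht.le.trans h2) 2

end Maximal

/-! ### Local expansion of a coordinatewise monotone function -/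

/-- A function on a box around the origin, monotone there, with an anisotropic expansion of
polynomial type at the origin. -/
structure LocalExpansion {d : ℕ} (φ : (Fin d → ℝ) → ℝ) (lo hi : Fin d → ℝ) (α : Fin d → ℕ∞)
    (a : (Fin d → ℕ) → ℝ) : Prop where
  mono : MonotoneOn φ (Set.Icc lo hi)
  lo_neg : ∀ k, lo k < 0
  hi_pos : ∀ k, 0 < hi k
  one_le : ∀ k, α k ≠ ⊤ → 1 ≤ α k
  pure_eq_zero : ∀ k, α k ≠ ⊤ → ∀ m : ℕ, 1 ≤ m → (m : ℕ∞) < α k → a (Pi.single k m) = 0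
  pure_ne_zero : ∀ k, α k ≠ ⊤ → a (Pi.single k (α k).toNat) ≠ 0
  coeff_zero : a 0 = φ 0
  expansion : ∀ L : ℝ, 0 < L → ∀ ε : ℝ, 0 < ε → ∀ᶠ w : ℝ in 𝓝[>] 0,
    ∀ z ∈ Set.Icc lo hi, (∀ k, |z k| ≤ L * w ^ recip (α k)) →
      |φ z - ∑ j ∈ taylorIndices α, a j * ∏ k, z k ^ j k| ≤ ε * w

/-- The weight `∑_k j_k / α_k` of a multi-index. -/
noncomputable def weight {d : ℕ} (α : Fin d → ℕ∞) (j : Fin d → ℕ) : ℝ := ∑ k, (j k : ℝ) * recip (α k)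

section Expansion

variable {d : ℕ} {φ : (Fin d → ℝ) → ℝ} {lo hi : Fin d → ℝ} {α : Fin d → ℕ∞}
  {a : (Fin d → ℕ) → ℝ}

lemma recip_nonneg (b : ℕ∞) : 0 ≤ recip b := by unfold recip; positivity

lemma toNat_pos_of_one_le {b : ℕ∞} (h : b ≠ ⊤) (h1 : 1 ≤ b) : 0 < b.toNat := by
  lift b to ℕ using h
  have : (1 : ℕ∞) ≤ b := h1
  simpa [Nat.succ_le_iff] using (show 1 ≤ b by exact_mod_cast this)

lemma recip_pos {b : ℕ∞} (h : b ≠ ⊤) (h1 : 1 ≤ b) : 0 < recip b :=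
  inv_pos.2 (by exact_mod_cast toNat_pos_of_one_le h h1)

lemma recip_top : recip ⊤ = 0 := by simp [recip]

lemma weight_le_one {j : Fin d → ℕ} (hj : j ∈ taylorIndices α) : weight α j ≤ 1 :=
  (Finset.mem_filter.1 hj).2

lemma eq_zero_of_mem_taylorIndices {j : Fin d → ℕ} (hj : j ∈ taylorIndices α) {k : Fin d}
    (hk : α k = ⊤) : j k = 0 := by
  have h := Fintype.mem_piFinset.1 (Finset.mem_filter.1 hj).1 k
  simpa [hk] using h

lemma prod_rpow_mul_pow {w : ℝ} (hw : 0 < w) (j : Fin d → ℕ) (y : Fin d → ℝ) :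
    ∏ k, (w ^ recip (α k) * y k) ^ j k = w ^ weight α j * ∏ k, y k ^ j k := by
  simp_rw [mul_pow]
  rw [Finset.prod_mul_distrib, weight, Real.rpow_sum_of_pos hw]
  congr 1
  refine Finset.prod_congr rfl fun k _ => ?_
  rw [← Real.rpow_natCast, ← Real.rpow_mul hw.le, mul_comm]

lemma tendsto_rpow_recip {r : ℝ} (hr : 0 < r) : Tendsto (fun w : ℝ => w ^ r) (𝓝[>] 0) (𝓝 0) := by
  have h : Tendsto (fun w : ℝ => w ^ r) (𝓝 0) (𝓝 ((0 : ℝ) ^ r)) :=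
    (Real.continuousAt_rpow_const 0 r (Or.inr hr.le)).tendsto
  rw [Real.zero_rpow hr.ne'] at h
  exact h.mono_left nhdsWithin_le_nhds

/-- Reflection of the expansion at the origin. -/
lemma LocalExpansion.neg (H : LocalExpansion φ lo hi α a) :
    LocalExpansion (fun z => -φ (-z)) (-hi) (-lo) α (fun j => -((∏ k, (-1) ^ j k) * a j)) where
  mono := fun x hx y hy hxy => neg_le_neg (H.mono
    ⟨le_neg_of_le_neg hy.2, neg_le.1 hy.1⟩ ⟨le_neg_of_le_neg hx.2, neg_le.1 hx.1⟩ (neg_le_neg hxy))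
  lo_neg := fun k => by simpa using H.hi_pos k
  hi_pos := fun k => by simpa using H.lo_neg k
  one_le := H.one_le
  pure_eq_zero := fun k hk m h1 h2 => by simp [H.pure_eq_zero k hk m h1 h2]
  pure_ne_zero := fun k hk => neg_ne_zero.2 (mul_ne_zero
    (Finset.prod_ne_zero_iff.2 fun l _ => pow_ne_zero _ (by norm_num)) (H.pure_ne_zero k hk))
  coeff_zero := by simp [H.coeff_zero]
  expansion := fun L hL ε hε => by
    filter_upwards [H.expansion L hL ε hε] with w hw z hz hzw
    have h := hw (-z) ⟨le_neg_of_le_neg hz.2, neg_le.1 hz.1⟩ (by simpa using hzw)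
    rw [← abs_neg] at h
    refine le_trans (le_of_eq ?_) h
    congr 1
    rw [neg_sub, sub_eq_add_neg, ← Finset.sum_neg_distrib, sub_eq_add_neg, add_comm]
    congr 1
    refine Finset.sum_congr rfl fun j _ => ?_
    have : ∏ k, (-z) k ^ j k = (∏ k, (-1) ^ j k) * ∏ k, z k ^ j k := by
      rw [← Finset.prod_mul_distrib]
      refine Finset.prod_congr rfl fun k _ => ?_
      rw [← mul_pow]; simp
    rw [this]; ring

/-- A bounded combination of powers `w ^ e` with coefficients constant in `w`, `O(w)` as `w ↓ 0`:
the coefficients of the lowest exponent below one add up to zero. -/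
lemma sum_lowest_eq_zero {ι : Type*} (J : Finset ι) (e c : ι → ℝ) {γ C : ℝ} (hγ : γ < 1)
    (he : ∀ j ∈ J, γ ≤ e j) (h : ∀ᶠ w : ℝ in 𝓝[>] 0, |∑ j ∈ J, c j * w ^ e j| ≤ C * w) :
    ∑ j ∈ J with e j = γ, c j = 0 := by
  classical
  have h1 : Tendsto (fun w : ℝ => ∑ j ∈ J, c j * w ^ (e j - γ)) (𝓝[>] 0)
      (𝓝 (∑ j ∈ J, if e j = γ then c j else 0)) := by
    refine tendsto_finsetSum _ fun j hj => ?_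
    split_ifs with hjγ
    · simp [hjγ]
    · have : 0 < e j - γ := sub_pos.2 (lt_of_le_of_ne (he j hj) (Ne.symm hjγ))
      simpa using (tendsto_rpow_recip this).const_mul (c j)
  have h2 : Tendsto (fun w : ℝ => C * w ^ (1 - γ)) (𝓝[>] 0) (𝓝 0) := by
    simpa using (tendsto_rpow_recip (sub_pos.2 hγ)).const_mul C
  have h3 : ∀ᶠ w : ℝ in 𝓝[>] 0, |∑ j ∈ J, c j * w ^ (e j - γ)| ≤ C * w ^ (1 - γ) := by
    filter_upwards [h, self_mem_nhdsWithin] with w hw (hw0 : 0 < w)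
    have hpos : 0 < w ^ γ := Real.rpow_pos_of_pos hw0 γ
    rw [← mul_le_mul_iff_left₀ hpos]
    have e1 : C * w ^ (1 - γ) * w ^ γ = C * w := by
      rw [mul_assoc, ← Real.rpow_add hw0]; simp
    have e2 : |∑ j ∈ J, c j * w ^ (e j - γ)| * w ^ γ = |∑ j ∈ J, c j * w ^ e j| := by
      have : ∀ u : ℝ, |u| * w ^ γ = |u * w ^ γ| := fun u => by rw [abs_mul, abs_of_pos hpos]
      rw [this, Finset.sum_mul]
      congr 1
      refine Finset.sum_congr rfl fun j _ => ?_
      rw [mul_assoc, ← Real.rpow_add hw0]; simp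
    rw [e1, e2]; exact hw
  have h4 : |∑ j ∈ J, if e j = γ then c j else 0| ≤ 0 := le_of_tendsto_of_tendsto h1.abs h2 h3
  rw [Finset.sum_filter]
  exact abs_nonpos_iff.1 h4

/-- Coefficients of a polynomial that vanishes on an open cube. -/
lemma coeff_eq_zero_of_sum_eq_zero (J : Finset (Fin d → ℕ)) (c : (Fin d → ℕ) → ℝ)
    (h : ∀ t : Fin d → ℝ, (∀ k, t k ∈ Set.Ioo (0 : ℝ) 1) → ∑ j ∈ J, c j * ∏ k, t k ^ j k = 0) :
    ∀ j ∈ J, c j = 0 := by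
  classical
  intro j hj
  set p : MvPolynomial (Fin d) ℝ :=
    ∑ j ∈ J, MvPolynomial.monomial (Finsupp.equivFunOnFinite.symm j) (c j) with hp
  have hp0 : p = 0 := by
    refine MvPolynomial.funext_set (fun _ => Set.Ioo (0 : ℝ) 1)
      (fun _ => Set.Ioo_infinite one_pos) fun t ht => ?_
    rw [hp, map_sum, map_zero, ← h t fun k => ht k (Set.mem_univ k)]
    refine Finset.sum_congr rfl fun i _ => ?_
    rw [MvPolynomial.eval_monomial, Finsupp.prod_fintype _ _ (by simp)]
    simp
  have h1 : p.coeff (Finsupp.equivFunOnFinite.symm j) = c j := by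
    rw [hp, MvPolynomial.coeff_sum, Finset.sum_eq_single j]
    · simp
    · intro i _ hij
      rw [MvPolynomial.coeff_monomial, if_neg (by simpa using hij)]
    · exact fun h => absurd hj h
  rw [← h1, hp0, MvPolynomial.coeff_zero]

/-- The anisotropic dilation `(w^{1/α_k} y_k)_k`. -/
noncomputable def dilate (α : Fin d → ℕ∞) (w : ℝ) (y : Fin d → ℝ) : Fin d → ℝ :=
  fun k => w ^ recip (α k) * y k

lemma LocalExpansion.eventually_dilate_mem (H : LocalExpansion φ lo hi α a) {y : Fin d → ℝ}
    (hy : ∀ k, α k = ⊤ → y k ∈ Set.Icc (lo k) (hi k)) :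
    ∀ᶠ w : ℝ in 𝓝[>] 0, dilate α w y ∈ Set.Icc lo hi := by
  have : ∀ k, ∀ᶠ w : ℝ in 𝓝[>] 0, dilate α w y k ∈ Set.Icc (lo k) (hi k) := by
    intro k
    by_cases hk : α k = ⊤
    · simpa [dilate, hk, recip_top] using hy k hk
    · have h := (tendsto_rpow_recip (recip_pos hk (H.one_le k hk))).mul_const (y k)
      rw [zero_mul] at h
      exact h (Icc_mem_nhds (H.lo_neg k) (H.hi_pos k))
  filter_upwards [eventually_all.2 this] with w hw
  exact ⟨fun k => (hw k).1, fun k => (hw k).2⟩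

lemma LocalExpansion.eventually_dilate (H : LocalExpansion φ lo hi α a) {y : Fin d → ℝ}
    (hy : ∀ k, α k = ⊤ → y k ∈ Set.Icc (lo k) (hi k)) :
    ∀ᶠ w : ℝ in 𝓝[>] 0, |φ (dilate α w y) -
      ∑ j ∈ taylorIndices α, a j * (w ^ weight α j * ∏ k, y k ^ j k)| ≤ w := by
  have hL : 0 < 1 + ∑ k, |y k| := by positivity
  filter_upwards [H.eventually_dilate_mem hy, H.expansion _ hL 1 one_pos, self_mem_nhdsWithin]
    with w hw1 hw2 (hw : 0 < w)
  have h := hw2 _ hw1 fun k => by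
    have hp : 0 < w ^ recip (α k) := Real.rpow_pos_of_pos hw _
    rw [dilate, abs_mul, abs_of_pos hp, mul_comm]
    refine mul_le_mul_of_nonneg_right ?_ hp.le
    linarith [Finset.single_le_sum (f := fun k => |y k|) (fun k _ => abs_nonneg _)
      (Finset.mem_univ k)]
  rw [one_mul] at h
  simp_rw [dilate, prod_rpow_mul_pow hw] at h
  exact h

lemma abs_sum_mul_rpow_weight_le {y : Fin d → ℝ} (hy : ∀ k, |y k| ≤ 1) {w : ℝ} (hw : 0 < w)
    {J : Finset (Fin d → ℕ)} (hJ : J ⊆ taylorIndices α)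
    (h : ∀ j ∈ J, ∏ k, y k ^ j k = 0 ∨ a j = 0 ∨ weight α j = 1) :
    |∑ j ∈ J, a j * (w ^ weight α j * ∏ k, y k ^ j k)|
      ≤ (∑ j ∈ taylorIndices α, |a j|) * w := by
  refine (Finset.abs_sum_le_sum_abs _ _).trans ?_
  rw [Finset.sum_mul]
  refine (Finset.sum_le_sum fun j hj => ?_).trans
    (Finset.sum_le_sum_of_subset_of_nonneg hJ fun j _ _ => by positivity)
  rcases h j hj with h0 | h0 | h0
  · rw [h0]; simp; positivity
  · simp [h0]
  · rw [h0, Real.rpow_one, abs_mul, abs_mul, abs_of_pos hw, Finset.abs_prod]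
    refine mul_le_mul_of_nonneg_left (mul_le_of_le_one_right hw.le ?_) (abs_nonneg _)
    refine Finset.prod_le_one (fun _ _ => abs_nonneg _) fun k _ => ?_
    rw [abs_pow]
    exact pow_le_one₀ (abs_nonneg _) (hy k)

lemma zero_mem_taylorIndices : (0 : Fin d → ℕ) ∈ taylorIndices α := by
  simp [taylorIndices, Fintype.mem_piFinset]

lemma single_mem_taylorIndices {k : Fin d} (h : α k ≠ ⊤) (h1 : 1 ≤ α k) :
    Pi.single k (α k).toNat ∈ taylorIndices α := by
  have h0 := toNat_pos_of_one_le h h1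
  simp only [taylorIndices, Finset.mem_filter, Fintype.mem_piFinset, Finset.mem_range]
  refine ⟨fun l => ?_, ?_⟩
  · by_cases hl : l = k
    · subst hl; simp
    · simp [hl]
  · rw [Finset.sum_eq_single k]
    · rw [Pi.single_eq_same, recip, mul_inv_cancel₀ (by exact_mod_cast h0.ne')]
    · intro l _ hl; simp [hl]
    · simp

lemma prod_pow_eq_zero_of_support {y : Fin d → ℝ} {j : Fin d → ℕ} {k : Fin d} (hj : j k ≠ 0)
    (hy : y k = 0) : ∏ k, y k ^ j k = 0 :=
  Finset.prod_eq_zero (Finset.mem_univ k) (by rw [hy, zero_pow hj])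

/-- If the low-weight coefficients with small support vanish, then `φ` deviates from its value at
the origin by `O(w)` on dilations of vectors with small support. -/
lemma LocalExpansion.eventually_abs_sub_le (H : LocalExpansion φ lo hi α a) {m : ℕ}
    (ih : ∀ j ∈ taylorIndices α, j ≠ 0 → (Finset.univ.filter (j · ≠ 0)).card < m →
      weight α j < 1 → a j = 0)
    {y : Fin d → ℝ} (hy1 : ∀ k, |y k| ≤ 1) (hy : ∀ k, α k = ⊤ → y k = 0)
    (hym : (Finset.univ.filter (y · ≠ 0)).card < m) :
    ∀ᶠ w : ℝ in 𝓝[>] 0, |φ (dilate α w y) - φ 0| ≤ (1 + ∑ j ∈ taylorIndices α, |a j|) * w := by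
  filter_upwards [H.eventually_dilate (y := y) fun k hk => by
      rw [hy k hk]; exact ⟨(H.lo_neg k).le, (H.hi_pos k).le⟩, self_mem_nhdsWithin]
    with w hw1 (hw : 0 < w)
  have h := abs_sum_mul_rpow_weight_le (a := a) hy1 hw
    (Finset.erase_subset (0 : Fin d → ℕ) (taylorIndices α)) fun j hj => by
      obtain ⟨hj0, hj⟩ := Finset.mem_erase.1 hj
      by_cases hs : ∃ k, j k ≠ 0 ∧ y k = 0
      · obtain ⟨k, hk1, hk2⟩ := hs
        exact Or.inl (prod_pow_eq_zero_of_support hk1 hk2)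
      · push Not at hs
        rcases (weight_le_one hj).lt_or_eq with hlt | heq
        · refine Or.inr (Or.inl (ih j hj hj0 (lt_of_le_of_lt (Finset.card_le_card ?_) hym) hlt))
          intro k hk
          simp only [Finset.mem_filter, Finset.mem_univ, true_and] at hk ⊢
          exact hs k hk
        · exact Or.inr (Or.inr heq)
  rw [← Finset.add_sum_erase _ _ zero_mem_taylorIndices, H.coeff_zero] at hw1
  simp only [weight, Pi.zero_apply, Nat.cast_zero, zero_mul, Finset.sum_const_zero, Real.rpow_zero,
    pow_zero, Finset.prod_const_one, mul_one] at hw1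
  rw [abs_le] at hw1 h ⊢
  simp only [weight] at h
  constructor <;> linarith [hw1.1, hw1.2, h.1, h.2]

/-- Coordinatewise monotonicity forces the coefficients of weight below one to vanish. -/
lemma LocalExpansion.coeff_eq_zero (H : LocalExpansion φ lo hi α a) (m : ℕ) :
    ∀ j ∈ taylorIndices α, j ≠ 0 → (Finset.univ.filter (j · ≠ 0)).card = m →
      weight α j < 1 → a j = 0 := by
  classical
  induction m using Nat.strong_induction_on with
  | _ m ih =>
  have ih' : ∀ j ∈ taylorIndices α, j ≠ 0 → (Finset.univ.filter (j · ≠ 0)).card < m →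
      weight α j < 1 → a j = 0 := fun j hj h0 hm hw => ih _ hm j hj h0 rfl hw
  intro i hmem hi0 him hiw
  set S := Finset.univ.filter (i · ≠ 0) with hS
  have hiS : ∀ k, k ∈ S ↔ i k ≠ 0 := fun k => by simp [hS]
  have hStop : ∀ k ∈ S, α k ≠ ⊤ := fun k hk htop =>
    (hiS k).1 hk (eq_zero_of_mem_taylorIndices hmem htop)
  have hSne : S.Nonempty := by
    rw [Finset.nonempty_iff_ne_empty]
    intro h
    refine hi0 (funext fun k => ?_)
    by_contra hk
    have := (hiS k).2 hk
    simp [h] at this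
  obtain ⟨p, hp⟩ := hSne
  by_cases hone : ∀ q ∈ S, q = p
  · have hip : i = Pi.single p (i p) := by
      funext k
      by_cases hk : k = p
      · subst hk; simp
      · rw [Pi.single_eq_of_ne hk]
        by_contra hne
        exact hk (hone k ((hiS k).2 hne))
    have hpt := hStop p hp
    have h1 : 0 < (α p).toNat := toNat_pos_of_one_le hpt (H.one_le p hpt)
    have hlt : i p < (α p).toNat := by
      have hw : weight α i = (i p : ℝ) * recip (α p) := by
        rw [weight, Finset.sum_eq_single p]
        · intro k _ hk
          rw [hip, Pi.single_eq_of_ne hk]; simp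
        · simp
      rw [hw, recip, ← div_eq_mul_inv, div_lt_one (by exact_mod_cast h1)] at hiw
      exact_mod_cast hiw
    rw [hip]
    refine H.pure_eq_zero p hpt _ (Nat.one_le_iff_ne_zero.2 ((hiS p).1 hp)) ?_
    rw [← ENat.natCast_toNat hpt]
    exact_mod_cast hlt
  push Not at hone
  obtain ⟨q, hq, hqp⟩ := hone
  set J := (taylorIndices α).filter
    (fun j => Finset.univ.filter (j · ≠ 0) = S ∧ weight α j < 1 ∧ a j ≠ 0) with hJ
  by_contra hai
  have hiJ : i ∈ J := by simp only [hJ, Finset.mem_filter]; exact ⟨hmem, rfl, hiw, hai⟩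
  obtain ⟨j₀, hj₀, hmin⟩ := Finset.exists_min_image J (weight α) ⟨i, hiJ⟩
  set sg : (Fin d → ℕ) → ℝ := fun j => (-1) ^ j q with hsg
  have key := coeff_eq_zero_of_sum_eq_zero (J.filter (fun j => weight α j = weight α j₀))
    (fun j => a j * sg j) fun t ht => by
      set y : Fin d → ℝ := fun k => if k ∈ S then (if k = q then - t k else t k) else 0 with hy
      have hy1 : ∀ k, |y k| ≤ 1 := fun k => by
        have := ht k
        simp only [hy]
        split_ifs
        · rw [abs_neg, abs_of_pos this.1]; exact this.2.le
        · rw [abs_of_pos this.1]; exact this.2.le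
        · simp
      have hytop : ∀ k, α k = ⊤ → y k = 0 := fun k hk => by
        simp only [hy]
        rw [if_neg fun hkS => hStop k hkS hk]
      have hyS : ∀ k, y k ≠ 0 → k ∈ S := fun k hk => by
        by_contra hkS; exact hk (by simp [hy, hkS])
      have hcube : ∀ y' : Fin d → ℝ, (∀ k, α k = ⊤ → y' k = 0) →
          ∀ k, α k = ⊤ → y' k ∈ Set.Icc (lo k) (hi k) := fun y' h k hk => by
          rw [h k hk]; exact ⟨(H.lo_neg k).le, (H.hi_pos k).le⟩
      have hupd : ∀ r ∈ S, ∀ᶠ w : ℝ in 𝓝[>] 0, |φ (dilate α w (Function.update y r 0)) - φ 0|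
          ≤ (1 + ∑ j ∈ taylorIndices α, |a j|) * w := by
        intro r hr
        refine H.eventually_abs_sub_le ih' (fun k => ?_) (fun k hk => ?_) ?_
        · by_cases hk : k = r
          · subst hk; simp
          · rw [Function.update_of_ne hk]; exact hy1 k
        · by_cases hkr : k = r
          · subst hkr; simp
          · rw [Function.update_of_ne hkr]; exact hytop k hk
        · rw [← him]
          refine Finset.card_lt_card (Finset.ssubset_iff_of_subset ?_ |>.2 ⟨r, hr, by simp⟩)
          intro k hk
          simp only [Finset.mem_filter, Finset.mem_univ, true_and] at hk
          by_cases hkr : k = r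
          · subst hkr; exact hr
          · rw [Function.update_of_ne hkr] at hk; exact hyS k hk
      have hprod : ∀ j, Finset.univ.filter (j · ≠ 0) = S →
          ∏ k, y k ^ j k = sg j * ∏ k, t k ^ j k := by
        intro j hj
        have : sg j = ∏ k, (if k = q then (-1 : ℝ) else 1) ^ j k := by
          rw [Finset.prod_eq_single q]
          · simp [hsg]
          · intro k _ hk; simp [hk]
          · simp
        rw [this, ← Finset.prod_mul_distrib]
        refine Finset.prod_congr rfl fun k _ => ?_
        by_cases hk : j k = 0
        · simp [hk]
        · have hkS : k ∈ S := by rw [← hj]; simpa using hk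
          rw [← mul_pow]
          simp only [hy, if_pos hkS]
          split_ifs <;> simp
      have hbig : ∀ᶠ w : ℝ in 𝓝[>] 0, |∑ j ∈ J, (a j * sg j * ∏ k, t k ^ j k) * w ^ weight α j|
          ≤ (2 + 2 * ∑ j ∈ taylorIndices α, |a j|) * w := by
        have hup : ∀ r, ∀ k, α k = ⊤ → Function.update y r 0 k = 0 := fun r k hk => by
          by_cases hkr : k = r
          · subst hkr; simp
          · rw [Function.update_of_ne hkr]; exact hytop k hk
        filter_upwards [hupd p hp, hupd q hq, self_mem_nhdsWithin,
          H.eventually_dilate (hcube y hytop), H.eventually_dilate_mem (hcube y hytop),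
          H.eventually_dilate_mem (hcube _ (hup p)), H.eventually_dilate_mem (hcube _ (hup q))]
          with w hwp hwq (hw : 0 < w) hw1 hm hmp hmq
        have hle1 : φ (dilate α w (Function.update y p 0)) ≤ φ (dilate α w y) := by
          refine H.mono hmp hm fun k => mul_le_mul_of_nonneg_left ?_ (Real.rpow_nonneg hw.le _)
          by_cases hkp : k = p
          · subst hkp
            simp only [Function.update_self, hy, if_pos hp, if_neg (Ne.symm hqp)]
            exact (ht k).1.le
          · rw [Function.update_of_ne hkp]
        have hle2 : φ (dilate α w y) ≤ φ (dilate α w (Function.update y q 0)) := by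
          refine H.mono hm hmq fun k => mul_le_mul_of_nonneg_left ?_ (Real.rpow_nonneg hw.le _)
          by_cases hkq : k = q
          · subst hkq
            simp only [Function.update_self, hy, if_pos hq, if_true]
            exact neg_nonpos.2 (ht k).1.le
          · rw [Function.update_of_ne hkq]
        have h := abs_sum_mul_rpow_weight_le (a := a) (α := α) hy1 hw
          (J := ((taylorIndices α).erase 0) \ J)
          (Finset.sdiff_subset.trans (Finset.erase_subset _ _)) fun j hj => by
            obtain ⟨hj1, hjJ⟩ := Finset.mem_sdiff.1 hj
            obtain ⟨hj0, hj⟩ := Finset.mem_erase.1 hj1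
            by_cases hs : ∃ k, j k ≠ 0 ∧ y k = 0
            · obtain ⟨k, hk1, hk2⟩ := hs
              exact Or.inl (prod_pow_eq_zero_of_support hk1 hk2)
            · push Not at hs
              have hsub : Finset.univ.filter (j · ≠ 0) ⊆ S := fun k hk =>
                hyS k (hs k (by simpa using hk))
              rcases (weight_le_one hj).lt_or_eq with hlt | heq
              · right; left
                by_contra hne
                rcases hsub.eq_or_ssubset with he | hss
                · exact hjJ (by simp only [hJ, Finset.mem_filter]; exact ⟨hj, he, hlt, hne⟩)
                · exact hne (ih' j hj hj0 (by rw [← him]; exact Finset.card_lt_card hss) hlt)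
              · exact Or.inr (Or.inr heq)
        have hJsub : J ⊆ (taylorIndices α).erase 0 := fun j hj => by
          obtain ⟨hj, hjS, -⟩ := Finset.mem_filter.1 hj
          refine Finset.mem_erase.2 ⟨?_, hj⟩
          rintro rfl
          rw [← hjS] at hp; simp at hp
        rw [← Finset.add_sum_erase _ _ zero_mem_taylorIndices, H.coeff_zero,
          ← Finset.sum_sdiff hJsub] at hw1
        have e1 : ∑ j ∈ J, a j * (w ^ weight α j * ∏ k, y k ^ j k)
            = ∑ j ∈ J, (a j * sg j * ∏ k, t k ^ j k) * w ^ weight α j := by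
          refine Finset.sum_congr rfl fun j hj => ?_
          rw [hprod j (Finset.mem_filter.1 hj).2.1]; ring
        have e0 : w ^ weight α (0 : Fin d → ℕ) * ∏ k, y k ^ (0 : Fin d → ℕ) k = 1 := by
          simp [weight]
        rw [e1, e0, mul_one] at hw1
        rw [abs_le] at hw1 h hwp hwq ⊢
        constructor <;> linarith [hw1.1, hw1.2, h.1, h.2, hwp.1, hwp.2, hwq.1, hwq.2]
      have := sum_lowest_eq_zero J (weight α) (fun j => a j * sg j * ∏ k, t k ^ j k)
        (Finset.mem_filter.1 hj₀).2.2.1 hmin hbig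
      exact this
  have h1 := key j₀ (by simp [hj₀])
  rcases mul_eq_zero.1 h1 with h | h
  · exact (Finset.mem_filter.1 hj₀).2.2.2 h
  · exact absurd h (pow_ne_zero _ (by norm_num))

end Expansion

section Growth

variable {d : ℕ} {φ : (Fin d → ℝ) → ℝ} {lo hi : Fin d → ℝ} {α : Fin d → ℕ∞}
  {a : (Fin d → ℕ) → ℝ}

lemma LocalExpansion.coeff_eq_zero_or (H : LocalExpansion φ lo hi α a) {j : Fin d → ℕ}
    (hj : j ∈ taylorIndices α) (h0 : j ≠ 0) : a j = 0 ∨ weight α j = 1 := by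
  rcases (weight_le_one hj).lt_or_eq with h | h
  · exact Or.inl (H.coeff_eq_zero _ j hj h0 rfl h)
  · exact Or.inr h

/-- `φ` varies by at most `O(w)` on the anisotropic box of radius `w`. -/
lemma LocalExpansion.exists_local_bound (H : LocalExpansion φ lo hi α a) :
    ∃ K : ℝ, 0 ≤ K ∧ ∀ᶠ w : ℝ in 𝓝[>] 0, ∀ z ∈ Set.Icc lo hi,
      (∀ k, |z k| ≤ w ^ recip (α k)) → |φ z - φ 0| ≤ K * w := by
  refine ⟨1 + ∑ j ∈ taylorIndices α, |a j|, by positivity, ?_⟩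
  filter_upwards [H.expansion 1 one_pos 1 one_pos, self_mem_nhdsWithin] with w hw1 (hw : 0 < w)
    z hz hzw
  have hp : ∀ k, 0 < w ^ recip (α k) := fun k => Real.rpow_pos_of_pos hw _
  have h1 := hw1 z hz (by simpa using hzw)
  set y : Fin d → ℝ := fun k => z k / w ^ recip (α k) with hy
  have hzy : ∀ k, z k = w ^ recip (α k) * y k := fun k => by
    rw [hy]; field_simp [(hp k).ne']
  simp_rw [hzy, prod_rpow_mul_pow hw] at h1
  have hy1 : ∀ k, |y k| ≤ 1 := fun k => by
    rw [hy, abs_div, abs_of_pos (hp k), div_le_one (hp k)]; exact hzw k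
  have h := abs_sum_mul_rpow_weight_le (a := a) (α := α) hy1 hw
    (Finset.erase_subset (0 : Fin d → ℕ) (taylorIndices α)) fun j hj => by
      obtain ⟨hj0, hj⟩ := Finset.mem_erase.1 hj
      exact Or.inr (H.coeff_eq_zero_or hj hj0)
  have e0 : w ^ weight α (0 : Fin d → ℕ) * ∏ k, y k ^ (0 : Fin d → ℕ) k = 1 := by simp [weight]
  rw [← Finset.add_sum_erase _ _ zero_mem_taylorIndices, H.coeff_zero, e0] at h1
  rw [abs_le] at h1 h ⊢
  constructor <;> linarith [h1.1, h1.2, h.1, h.2]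

lemma LocalExpansion.eventually_dilate_estimate (H : LocalExpansion φ lo hi α a) {k : Fin d}
    (hk : α k ≠ ⊤) {θ : ℝ} (hθ : 1 ≤ θ) {y : Fin d → ℝ} (hyk : y k = θ)
    (hy1 : ∀ l, l ≠ k → α l ≠ ⊤ → |y l| ≤ 1)
    (hytop : ∀ l, α l = ⊤ → y l ∈ Set.Icc (lo l) (hi l)) :
    ∀ᶠ w : ℝ in 𝓝[>] 0, |φ (dilate α w y) - φ 0
      - a (Pi.single k (α k).toNat) * θ ^ (α k).toNat * w|
      ≤ (1 + (∑ j ∈ taylorIndices α, |a j|) * θ ^ ((α k).toNat - 1)) * w := by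
  set b := (α k).toNat with hb
  have hb0 : 0 < b := toNat_pos_of_one_le hk (H.one_le k hk)
  have hs := single_mem_taylorIndices hk (H.one_le k hk)
  rw [← hb] at hs
  have hs0 : Pi.single k b ≠ (0 : Fin d → ℕ) := by simpa using hb0.ne'
  filter_upwards [H.eventually_dilate hytop, self_mem_nhdsWithin] with w hw1 (hw : 0 < w)
  have e0 : w ^ weight α (0 : Fin d → ℕ) * ∏ k, y k ^ (0 : Fin d → ℕ) k = 1 := by simp [weight]
  have e1 : w ^ weight α (Pi.single k b) * ∏ l, y l ^ (Pi.single k b : Fin d → ℕ) l = w * θ ^ b := by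
    have : weight α (Pi.single k b) = 1 := by
      rw [weight, Finset.sum_eq_single k]
      · rw [Pi.single_eq_same, recip, ← hb, mul_inv_cancel₀ (by exact_mod_cast hb0.ne')]
      · intro l _ hl; simp [hl]
      · simp
    rw [this, Real.rpow_one, Finset.prod_eq_single k]
    · rw [Pi.single_eq_same, hyk]
    · intro l _ hl; simp [hl]
    · simp
  rw [← Finset.add_sum_erase _ _ zero_mem_taylorIndices, H.coeff_zero, e0,
    ← Finset.add_sum_erase _ _ (Finset.mem_erase.2 ⟨hs0, hs⟩), e1] at hw1
  have h : |∑ j ∈ ((taylorIndices α).erase 0).erase (Pi.single k b),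
      a j * (w ^ weight α j * ∏ k, y k ^ j k)|
      ≤ (∑ j ∈ taylorIndices α, |a j|) * θ ^ (b - 1) * w := by
    refine (Finset.abs_sum_le_sum_abs _ _).trans ?_
    rw [Finset.sum_mul, Finset.sum_mul]
    refine (Finset.sum_le_sum fun j hj => ?_).trans
      (Finset.sum_le_sum_of_subset_of_nonneg ((Finset.erase_subset _ _).trans
        (Finset.erase_subset _ _)) fun j _ _ => by positivity)
    obtain ⟨hjs, hj⟩ := Finset.mem_erase.1 hj
    obtain ⟨hj0, hj⟩ := Finset.mem_erase.1 hj
    rcases H.coeff_eq_zero_or hj hj0 with h0 | h0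
    · simp [h0]
    · have hjk : j k ≤ b - 1 := by
        by_contra hlt
        have hbj : b ≤ j k := by omega
        refine hjs (funext fun l => ?_)
        have hle := Fintype.mem_piFinset.1 (Finset.mem_filter.1 hj).1 k
        rw [Finset.mem_range, ← hb] at hle
        by_cases hl : l = k
        · subst hl; simp; omega
        · rw [Pi.single_eq_of_ne hl]
          by_cases hlt : α l = ⊤
          · exact eq_zero_of_mem_taylorIndices hj hlt
          · by_contra hjl
            have h2 : (j k : ℝ) * recip (α k) + (j l : ℝ) * recip (α l) ≤ weight α j := by
              rw [weight, ← Finset.sum_pair (Ne.symm hl)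
                (f := fun k => (j k : ℝ) * recip (α k))]
              exact Finset.sum_le_sum_of_subset_of_nonneg (Finset.subset_univ _)
                fun i _ _ => mul_nonneg (Nat.cast_nonneg _) (recip_nonneg _)
            have h3 : 1 ≤ (j k : ℝ) * recip (α k) := by
              rw [recip, ← hb, ← div_eq_mul_inv, one_le_div (by exact_mod_cast hb0)]
              exact_mod_cast hbj
            have h4 : 0 < (j l : ℝ) * recip (α l) :=
              mul_pos (by exact_mod_cast Nat.pos_of_ne_zero hjl) (recip_pos hlt (H.one_le l hlt))
            linarith
      rw [h0, Real.rpow_one, abs_mul, abs_mul, abs_of_pos hw, Finset.abs_prod, mul_assoc,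
        mul_comm w]
      refine mul_le_mul_of_nonneg_left (mul_le_mul_of_nonneg_right ?_ hw.le) (abs_nonneg _)
      rw [← Finset.mul_prod_erase _ _ (Finset.mem_univ k), hyk, abs_pow, abs_of_pos (by linarith)]
      refine le_trans (mul_le_of_le_one_right (by positivity)
        (Finset.prod_le_one (fun _ _ => abs_nonneg _) fun l hl => ?_)) (pow_le_pow_right₀ hθ hjk)
      by_cases hlt : α l = ⊤
      · simp [eq_zero_of_mem_taylorIndices hj hlt]
      · rw [abs_pow]
        exact pow_le_one₀ (abs_nonneg _) (hy1 l (Finset.ne_of_mem_erase hl) hlt)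
  rw [abs_le] at hw1 h ⊢
  constructor <;> linarith [hw1.1, hw1.2, h.1, h.2]

lemma LocalExpansion.pure_pos (H : LocalExpansion φ lo hi α a) {k : Fin d} (hk : α k ≠ ⊤) :
    0 < a (Pi.single k (α k).toNat) := by
  refine lt_of_le_of_ne ?_ (H.pure_ne_zero k hk).symm
  by_contra hneg
  push Not at hneg
  set c := a (Pi.single k (α k).toNat) with hc
  set b := (α k).toNat with hb
  have hb0 : 0 < b := toNat_pos_of_one_le hk (H.one_le k hk)
  set A := ∑ j ∈ taylorIndices α, |a j| with hA
  have hA0 : 0 ≤ A := by positivity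
  set θ := (A + 2) / (-c) + 1 with hθ
  have hθ1 : 1 ≤ θ := by
    have : 0 ≤ (A + 2) / (-c) := by have := neg_pos.2 hneg; positivity
    linarith
  have hy : ∀ l, α l = ⊤ → (Pi.single k θ : Fin d → ℝ) l ∈ Set.Icc (lo l) (hi l) := by
    intro l hl
    have : l ≠ k := by rintro rfl; exact hk hl
    rw [Pi.single_eq_of_ne this]
    exact ⟨(H.lo_neg l).le, (H.hi_pos l).le⟩
  obtain ⟨w, h1, h2, hw⟩ := ((H.eventually_dilate_estimate hk hθ1 (y := Pi.single k θ) (by simp)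
    (fun l hl _ => by simp [hl]) hy).and ((H.eventually_dilate_mem hy).and
    self_mem_nhdsWithin)).exists
  have hw : 0 < w := hw
  have h3 : φ 0 ≤ φ (dilate α w (Pi.single k θ)) := by
    refine H.mono ⟨fun l => (H.lo_neg l).le, fun l => (H.hi_pos l).le⟩ h2 fun l => ?_
    refine mul_nonneg (Real.rpow_nonneg hw.le _) ?_
    by_cases hl : l = k
    · subst hl; simp; linarith
    · simp [hl]
  have h4 := (abs_le.1 h1).2
  rw [← hb, ← hc] at h4
  have h5 : 0 ≤ (c * θ ^ b + 1 + A * θ ^ (b - 1)) * w := by nlinarith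
  have h6 : 0 ≤ c * θ ^ b + 1 + A * θ ^ (b - 1) := nonneg_of_mul_nonneg_left h5 hw
  have h7 : θ ^ b = θ ^ (b - 1) * θ := by rw [← pow_succ]; congr 1; omega
  have h8 : c * θ = -(A + 2) + c := by rw [hθ]; field_simp [hneg.ne]
  have h9 : 1 ≤ θ ^ (b - 1) := one_le_pow₀ hθ1
  rw [h7] at h6
  nlinarith

/-- Growth of `φ` in each direction with finite exponent. -/
lemma LocalExpansion.exists_growth (H : LocalExpansion φ lo hi α a) (K : ℝ) :
    ∃ θ : ℝ, 1 ≤ θ ∧ ∀ᶠ w : ℝ in 𝓝[>] 0, ∀ k, α k ≠ ⊤ → ∀ z ∈ Set.Icc lo hi,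
      (∀ l, α l ≠ ⊤ → -w ^ recip (α l) ≤ z l) → θ * w ^ recip (α k) ≤ z k →
      φ 0 + K * w ≤ φ z := by
  classical
  have key : ∀ k, ∃ θ : ℝ, 1 ≤ θ ∧ ∀ᶠ w : ℝ in 𝓝[>] 0, α k ≠ ⊤ → ∀ z ∈ Set.Icc lo hi,
      (∀ l, α l ≠ ⊤ → -w ^ recip (α l) ≤ z l) → θ * w ^ recip (α k) ≤ z k →
      φ 0 + K * w ≤ φ z := by
    intro k
    by_cases hk : α k = ⊤
    · exact ⟨1, le_rfl, by simp [hk]⟩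
    set c := a (Pi.single k (α k).toNat) with hc
    have hc0 : 0 < c := H.pure_pos hk
    set b := (α k).toNat with hb
    have hb0 : 0 < b := toNat_pos_of_one_le hk (H.one_le k hk)
    set A := ∑ j ∈ taylorIndices α, |a j| with hA
    have hA0 : 0 ≤ A := by positivity
    set θ := (A + 1 + |K|) / c + 1 with hθ
    have hθ1 : 1 ≤ θ := by
      have : 0 ≤ (A + 1 + |K|) / c := by positivity
      linarith
    refine ⟨θ, hθ1, ?_⟩
    set y : Fin d → ℝ := fun l => if l = k then θ else if α l = ⊤ then lo l else -1 with hy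
    have hyk : y k = θ := by simp [hy]
    have hytop : ∀ l, α l = ⊤ → y l ∈ Set.Icc (lo l) (hi l) := by
      intro l hl
      have : l ≠ k := by rintro rfl; exact hk hl
      simp only [hy, if_neg this, if_pos hl]
      exact ⟨le_rfl, ((H.lo_neg l).trans (H.hi_pos l)).le⟩
    filter_upwards [H.eventually_dilate_estimate hk hθ1 hyk
      (fun l hl hl' => by simp [hy, hl, hl']) hytop, H.eventually_dilate_mem hytop,
      self_mem_nhdsWithin] with w h1 h2 (hw : 0 < w) _ z hz hzl hzk
    have h3 : φ (dilate α w y) ≤ φ z := by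
      refine H.mono h2 hz fun l => ?_
      by_cases hl : l = k
      · subst hl; rw [dilate, hyk, mul_comm]; exact hzk
      · by_cases hl' : α l = ⊤
        · simp [dilate, hy, hl, hl', recip_top]; exact hz.1 l
        · simpa [dilate, hy, hl, hl'] using hzl l hl'
    have h4 := (abs_le.1 h1).1
    rw [← hb, ← hc] at h4
    have h7 : θ ^ b = θ ^ (b - 1) * θ := by rw [← pow_succ]; congr 1; omega
    have h8 : c * θ = A + 1 + |K| + c := by rw [hθ]; field_simp
    have h9 : 1 ≤ θ ^ (b - 1) := one_le_pow₀ hθ1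
    have h10 : K ≤ c * θ ^ b - (1 + A * θ ^ (b - 1)) := by
      rw [h7, show c * (θ ^ (b - 1) * θ) = θ ^ (b - 1) * (c * θ) by ring, h8]
      nlinarith [abs_nonneg K, le_abs_self K]
    nlinarith
  choose θ hθ1 hθ using key
  refine ⟨1 + ∑ k, θ k, ?_, ?_⟩
  · have : 0 ≤ ∑ k, θ k := Finset.sum_nonneg fun k _ => by linarith [hθ1 k]
    linarith
  · filter_upwards [eventually_all.2 hθ, self_mem_nhdsWithin] with w hw (hw0 : 0 < w)
      k hk z hz hzl hzk
    refine hw k hk z hz hzl (le_trans (mul_le_mul_of_nonneg_right ?_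
      (Real.rpow_nonneg hw0.le _)) hzk)
    linarith [Finset.single_le_sum (f := θ) (fun k _ => by linarith [hθ1 k]) (Finset.mem_univ k)]

lemma IsMonotoneSmooth.localExpansion {f : (Fin d → ℝ) → ℝ} {x₀ : Fin d → ℝ} {s : ℕ}
    (hx₀ : ∀ k, x₀ k ∈ Set.Ioo (0 : ℝ) 1) (hf : IsMonotoneSmooth f x₀ α s) :
    LocalExpansion (fun z => f (x₀ + z)) (-x₀) (1 - x₀) α
      (fun j => mixedPartial f j x₀ / ∏ k, ((j k).factorial : ℝ)) where
  mono := fun x hx y hy hxy => hf.monotoneOn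
    ⟨by simpa using add_le_add_right hx.1 x₀, by simpa using add_le_add_right hx.2 x₀⟩
    ⟨by simpa using add_le_add_right hy.1 x₀, by simpa using add_le_add_right hy.2 x₀⟩
    (add_le_add_right hxy x₀)
  lo_neg := fun k => by simpa using (hx₀ k).1
  hi_pos := fun k => by simpa using (hx₀ k).2
  one_le := fun k hk => by
    by_cases h : (k : ℕ) < s
    · exact (hf.finite_exponent k h).1
    · exact absurd (hf.infinite_exponent k (not_lt.1 h)) hk
  pure_eq_zero := fun k hk m h1 h2 => by
    have h : (k : ℕ) < s := by
      by_contra h; exact hk (hf.infinite_exponent k (not_lt.1 h))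
    rw [hf.partial_eq_zero k h m h1 h2, zero_div]
  pure_ne_zero := fun k hk => by
    have h : (k : ℕ) < s := by
      by_contra h; exact hk (hf.infinite_exponent k (not_lt.1 h))
    refine div_ne_zero (hf.partial_ne_zero k h) (Finset.prod_ne_zero_iff.2 fun l _ => ?_)
    exact_mod_cast Nat.factorial_ne_zero _
  coeff_zero := by
    have : multiIndexList (0 : Fin d → ℕ) = [] := by simp [multiIndexList]
    simp [mixedPartial, this, iterPartial]
  expansion := fun L hL ε hε => by
    filter_upwards [hf.taylor L hL ε hε] with w hw z hz hzw
    have := hw (x₀ + z) ⟨by simpa using add_le_add_right hz.1 x₀,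
      by simpa using add_le_add_right hz.2 x₀⟩ (by simpa using hzw)
    simpa [taylorPoly] using this

end Growth

/-! ### Deterministic analysis of the block estimators in centred coordinates -/

section Deterministic

variable {d : ℕ}

/-- The corner of the elementary block: the scale `g` in the directions of `D`, zero elsewhere. -/
def corner (D : Finset (Fin d)) (g : Fin d → ℝ) : Fin d → ℝ := fun k => if k ∈ D then g k else 0

/-- Relative side lengths of `[u, v]`, counting one extra unit in the directions outside `D`. -/
noncomputable def relLen (D : Finset (Fin d)) (g u v : Fin d → ℝ) (k : Fin d) : ℝ :=
  (if k ∈ D then 0 else 1) + (v k - u k) / g k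

/-- The design points lie in the box `[lo, hi]` around the origin, and blocks `[u, v]` around the
origin with sides at least `τ g` in the directions of `D` contain `w⁻² ∏ relLen` points, up to the
factor `Λ`. -/
structure Regular (N : ℕ) (z : ℕ → Fin d → ℝ) (lo hi g : Fin d → ℝ) (D : Finset (Fin d))
    (w Λ τ : ℝ) : Prop where
  mem : ∀ i < N, z i ∈ Set.Icc lo hi
  upper : ∀ u v : Fin d → ℝ, u ≤ 0 → 0 ≤ v → (∀ k ∈ D, τ * g k ≤ v k - u k) →
    w ^ 2 * (block N z u v).card ≤ Λ * ∏ k, relLen D g u v k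
  lower : ∀ u v : Fin d → ℝ, lo ≤ u → u ≤ 0 → 0 ≤ v → v ≤ hi →
    (∀ k ∈ D, τ * g k ≤ v k - u k) →
    ∏ k, relLen D g u v k ≤ Λ * (w ^ 2 * (block N z u v).card)

/-- Sizes of the scales relative to the box. -/
structure Frame (lo hi g : Fin d → ℝ) (D : Finset (Fin d)) (w : ℝ) : Prop where
  w_pos : 0 < w
  g_pos : ∀ k, 0 < g k
  lo_le : lo ≤ -corner D g
  le_hi : corner D g ≤ hi

/-- Bounds on the signal at the scales `g` and `w`. -/
structure SignalBounds (F : (Fin d → ℝ) → ℝ) (lo hi g : Fin d → ℝ) (D : Finset (Fin d))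
    (w K : ℝ) : Prop where
  mono : MonotoneOn F (Set.Icc lo hi)
  upper : F (corner D g) ≤ F 0 + K * w
  lower : F 0 - K * w ≤ F (-corner D g)

/-- The signal drops by `K w` at relative distance `θ` in any direction. -/
def SignalDrop (F : (Fin d → ℝ) → ℝ) (lo hi g : Fin d → ℝ) (D : Finset (Fin d))
    (w K θ : ℝ) : Prop :=
  ∀ k, ∀ z ∈ Set.Icc lo hi, z ≤ corner D g → z k < -(θ * g k) → F z ≤ F 0 - K * w

/-- The defining properties of an outer maximiser `u` of the max-min formula with value `m`. -/
structure LowerOpt (N : ℕ) (z : ℕ → Fin d → ℝ) (y : ℕ → ℝ) (u : Fin d → ℝ) (m : ℝ) : Prop where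
  nonpos : u ≤ 0
  le_mean : ∀ v : Fin d → ℝ, 0 ≤ v → (block N z u v).Nonempty →
    m * (block N z u v).card ≤ ∑ i ∈ block N z u v, y i
  mean_le : ∀ u' v' : Fin d → ℝ, u' ≤ 0 → 0 ≤ v' → (block N z u' v').Nonempty →
    ∃ v : Fin d → ℝ, 0 ≤ v ∧ (block N z u' v).Nonempty ∧
      ∑ i ∈ block N z u' v, y i ≤ m * (block N z u' v).card

/-- The errors average to at most `K w` over blocks with lower corner `-corner D g`. -/
def NoiseBound (N : ℕ) (z : ℕ → Fin d → ℝ) (e : ℕ → ℝ) (hi g : Fin d → ℝ) (D : Finset (Fin d))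
    (w K : ℝ) : Prop :=
  ∀ v : Fin d → ℝ, 0 ≤ v → v ≤ hi →
    |∑ i ∈ block N z (-corner D g) v, e i| ≤ K * w * (block N z (-corner D g) v).card

variable {N : ℕ} {z : ℕ → Fin d → ℝ} {lo hi g : Fin d → ℝ} {D : Finset (Fin d)} {w Λ τ : ℝ}

lemma mem_block {N : ℕ} {z : ℕ → Fin d → ℝ} {u v : Fin d → ℝ} {i : ℕ} :
    i ∈ block N z u v ↔ i < N ∧ u ≤ z i ∧ z i ≤ v := by
  simp [block]

lemma block_mono {u u' v v' : Fin d → ℝ} (hu : u' ≤ u) (hv : v ≤ v') :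
    block N z u v ⊆ block N z u' v' := fun i hi => by
  rw [mem_block] at hi ⊢
  exact ⟨hi.1, hu.trans hi.2.1, hi.2.2.trans hv⟩

lemma block_neg (u v : Fin d → ℝ) : block N (fun i => -z i) (-v) (-u) = block N z u v := by
  ext i; rw [mem_block, mem_block, neg_le_neg_iff, neg_le_neg_iff]; tauto

lemma block_neg' (u v : Fin d → ℝ) : block N (fun i => -z i) u v = block N z (-v) (-u) := by
  rw [← block_neg (-v) (-u), neg_neg, neg_neg]

lemma corner_nonneg (hg : ∀ k, 0 < g k) : 0 ≤ corner D g := fun k => by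
  simp only [corner]; split_ifs
  · exact (hg k).le
  · exact le_rfl

lemma Frame.neg (H : Frame lo hi g D w) : Frame (-hi) (-lo) g D w :=
  ⟨H.w_pos, H.g_pos, neg_le_neg H.le_hi, by simpa using neg_le_neg H.lo_le⟩

lemma relLen_neg (u v : Fin d → ℝ) : relLen D g (-v) (-u) = relLen D g u v := by
  ext k; simp only [relLen, Pi.neg_apply]; congr 2; ring

lemma Regular.neg (H : Regular N z lo hi g D w Λ τ) :
    Regular N (fun i => -z i) (-hi) (-lo) g D w Λ τ where
  mem := fun i h => ⟨neg_le_neg (H.mem i h).2, neg_le_neg (H.mem i h).1⟩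
  upper := fun u v hu hv h => by
    have := H.upper (-v) (-u) (by simpa using hv) (by simpa using hu)
      (fun k hk => by simpa [neg_add_eq_sub, sub_eq_add_neg, add_comm] using h k hk)
    rwa [relLen_neg, ← block_neg'] at this
  lower := fun u v h1 h2 h3 h4 h => by
    have := H.lower (-v) (-u) (by simpa using neg_le_neg h4) (by simpa using h3)
      (by simpa using h2) (by simpa using neg_le_neg h1)
      (fun k hk => by simpa [neg_add_eq_sub, sub_eq_add_neg, add_comm] using h k hk)
    rwa [relLen_neg, ← block_neg'] at this

lemma Regular.block_clip (H : Regular N z lo hi g D w Λ τ) (u v : Fin d → ℝ) :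
    block N z (u ⊔ lo) (v ⊓ hi) = block N z u v := by
  ext i
  rw [mem_block, mem_block, sup_le_iff, le_inf_iff]
  exact ⟨fun h => ⟨h.1, h.2.1.1, h.2.2.1⟩, fun h =>
    ⟨h.1, ⟨h.2.1, (H.mem i h.1).1⟩, ⟨h.2.2, (H.mem i h.1).2⟩⟩⟩

lemma Regular.block_clip_left (H : Regular N z lo hi g D w Λ τ) (u v : Fin d → ℝ) :
    block N z (u ⊔ lo) v = block N z u v := by
  ext i
  rw [mem_block, mem_block, sup_le_iff]
  exact ⟨fun h => ⟨h.1, h.2.1.1, h.2.2⟩, fun h => ⟨h.1, ⟨h.2.1, (H.mem i h.1).1⟩, h.2.2⟩⟩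

lemma Regular.block_clip_right (H : Regular N z lo hi g D w Λ τ) (u v : Fin d → ℝ) :
    block N z u (v ⊓ hi) = block N z u v := by
  ext i
  rw [mem_block, mem_block, le_inf_iff]
  exact ⟨fun h => ⟨h.1, h.2.1, h.2.2.1⟩, fun h => ⟨h.1, h.2.1, ⟨h.2.2, (H.mem i h.1).2⟩⟩⟩

lemma SignalBounds.neg {F : (Fin d → ℝ) → ℝ} {K : ℝ} (H : SignalBounds F lo hi g D w K) :
    SignalBounds (fun x => -F (-x)) (-hi) (-lo) g D w K where
  mono := fun x hx y hy hxy => neg_le_neg (H.mono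
    ⟨le_neg_of_le_neg hy.2, neg_le.1 hy.1⟩ ⟨le_neg_of_le_neg hx.2, neg_le.1 hx.1⟩ (neg_le_neg hxy))
  upper := by simp only [neg_zero]; linarith [H.lower]
  lower := by simp only [neg_zero, neg_neg]; linarith [H.upper]

lemma relLen_pos {u v : Fin d → ℝ} (hg : ∀ k, 0 < g k) (hτ : 0 < τ) (hu : u ≤ 0) (hv : 0 ≤ v)
    (h : ∀ k ∈ D, τ * g k ≤ v k - u k) (k : Fin d) : 0 < relLen D g u v k := by
  simp only [relLen]
  split_ifs with hk
  · rw [zero_add]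
    exact div_pos (lt_of_lt_of_le (mul_pos hτ (hg k)) (h k hk)) (hg k)
  · have : 0 ≤ (v k - u k) / g k := div_nonneg (sub_nonneg.2 ((hu k).trans (hv k))) (hg k).le
    linarith

lemma Regular.card_pos (H : Regular N z lo hi g D w Λ τ) (hg : ∀ k, 0 < g k) (hτ : 0 < τ)
    {u v : Fin d → ℝ} (h1 : lo ≤ u) (hu : u ≤ 0) (hv : 0 ≤ v) (h2 : v ≤ hi)
    (h : ∀ k ∈ D, τ * g k ≤ v k - u k) : (block N z u v).Nonempty := by
  have h3 := H.lower u v h1 hu hv h2 h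
  have h4 : 0 < ∏ k, relLen D g u v k :=
    Finset.prod_pos fun k _ => relLen_pos hg hτ hu hv h k
  rw [← Finset.card_pos]
  by_contra h0
  have : (block N z u v).card = 0 := by omega
  rw [this] at h3
  simp at h3
  linarith

section Optimum

variable {F : (Fin d → ℝ) → ℝ} {e : ℕ → ℝ} {u : Fin d → ℝ} {m K₁ K₂ : ℝ}

/-- Lower bound for the max-min estimator. -/
lemma LowerOpt.lower_bound (hopt : LowerOpt N z (fun i => F (z i) + e i) u m)
    (hfr : Frame lo hi g D w) (hreg : Regular N z lo hi g D w Λ τ) (hτ : 0 < τ) (hτ1 : τ ≤ 1)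
    (hF : SignalBounds F lo hi g D w K₁) (hnoise : NoiseBound N z e hi g D w K₂) :
    F 0 - (K₁ + K₂) * w ≤ m := by
  have hc := corner_nonneg (D := D) hfr.g_pos
  have hne : (block N z (-corner D g) 0).Nonempty := by
    refine hreg.card_pos hfr.g_pos hτ hfr.lo_le (neg_nonpos.2 hc) le_rfl (hc.trans hfr.le_hi) ?_
    intro k hk
    simp only [corner, Pi.neg_apply, Pi.zero_apply, if_pos hk]
    nlinarith [hfr.g_pos k]
  obtain ⟨v, hv, hvne, hm⟩ := hopt.mean_le _ 0 (neg_nonpos.2 hc) le_rfl hne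
  rw [← hreg.block_clip_right] at hvne hm
  have h1 := hnoise (v ⊓ hi) (le_inf hv (hc.trans hfr.le_hi)) inf_le_right
  set B := block N z (-corner D g) (v ⊓ hi) with hB
  have h2 : (B.card : ℝ) * (F 0 - K₁ * w) ≤ ∑ i ∈ B, F (z i) := by
    rw [← nsmul_eq_mul]
    refine Finset.card_nsmul_le_sum _ _ _ fun i hi => hF.lower.trans ?_
    obtain ⟨hiN, h3, h4⟩ := mem_block.1 hi
    exact hF.mono ⟨hfr.lo_le, (neg_nonpos.2 hc).trans (hc.trans hfr.le_hi)⟩ (hreg.mem i hiN) h3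
  rw [Finset.sum_add_distrib] at hm
  have h3 := (abs_le.1 h1).1
  have h4 : (0 : ℝ) < B.card := by exact_mod_cast hvne.card_pos
  by_contra hlt
  push Not at hlt
  nlinarith

/-- Upper bound for the max-min estimator. -/
lemma LowerOpt.upper_bound (hopt : LowerOpt N z (fun i => F (z i) + e i) u m)
    (hfr : Frame lo hi g D w) (hreg : Regular N z lo hi g D w Λ τ) (hτ : 0 < τ) (hτ1 : τ ≤ 1)
    (hF : SignalBounds F lo hi g D w K₁)
    (hnoise : NoiseBound N (fun i => -z i) e (-lo) g D w K₂) :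
    m ≤ F 0 + (K₁ + K₂) * w := by
  have hc := corner_nonneg (D := D) hfr.g_pos
  have hne : (block N z u (corner D g)).Nonempty := by
    refine (hreg.card_pos hfr.g_pos hτ (u := 0) (hfr.lo_le.trans (neg_nonpos.2 hc)) le_rfl hc
      hfr.le_hi ?_).mono (block_mono hopt.nonpos le_rfl)
    intro k hk
    simp only [corner, Pi.zero_apply, if_pos hk]
    nlinarith [hfr.g_pos k]
  have hm := hopt.le_mean _ hc hne
  have h1 := hnoise (-(u ⊔ lo))
    (neg_nonneg.2 (sup_le hopt.nonpos (hfr.lo_le.trans (neg_nonpos.2 hc))))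
    (neg_le_neg le_sup_right)
  rw [block_neg, hreg.block_clip_left] at h1
  set B := block N z u (corner D g) with hB
  have h2 : ∑ i ∈ B, F (z i) ≤ (B.card : ℝ) * (F 0 + K₁ * w) := by
    rw [← nsmul_eq_mul]
    refine Finset.sum_le_card_nsmul _ _ _ fun i hi => le_trans ?_ hF.upper
    obtain ⟨hiN, h3, h4⟩ := mem_block.1 hi
    exact hF.mono (hreg.mem i hiN) ⟨hfr.lo_le.trans ((neg_nonpos.2 hc).trans hc), hfr.le_hi⟩ h4
  rw [Finset.sum_add_distrib] at hm
  have h3 := (abs_le.1 h1).2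
  have h4 : (0 : ℝ) < B.card := by exact_mod_cast hne.card_pos
  by_contra hlt
  push Not at hlt
  nlinarith

/-- The outer maximiser is within a multiple of `g` of the origin. -/
lemma LowerOpt.neg_le (hopt : LowerOpt N z (fun i => F (z i) + e i) u m)
    (hfr : Frame lo hi g D w) (hreg : Regular N z lo hi g D w Λ τ) (hτ : 0 < τ) (hτ1 : τ ≤ 1)
    (hF : SignalBounds F lo hi g D w K₁) (hK₁ : 0 ≤ K₁) (hK₂ : 0 ≤ K₂) (hΛ : 1 ≤ Λ)
    (hnoise : NoiseBound N z e hi g D w K₂)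
    (hnoise' : NoiseBound N (fun i => -z i) e (-lo) g D w K₂) {θ : ℝ} (hθ : 0 ≤ θ)
    (hdrop : SignalDrop F lo hi g D w (4 * (K₁ + K₂) + 1) θ) (k : Fin d) :
    -(2 * Λ ^ 2 * (1 + θ) * g k) ≤ (u ⊔ lo) k := by
  have hlow := hopt.lower_bound hfr hreg hτ hτ1 hF hnoise
  have hc := corner_nonneg (D := D) hfr.g_pos
  have hcu : ∀ l ∈ D, ∀ x : ℝ, x ≤ 0 → τ * g l ≤ corner D g l - x := fun l hl x hx => by
    simp only [corner, if_pos hl]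
    nlinarith [hfr.g_pos l]
  set U := u ⊔ lo with hU
  have hlo0 : lo ≤ 0 := hfr.lo_le.trans (neg_nonpos.2 hc)
  have hU0 : U ≤ 0 := sup_le hopt.nonpos hlo0
  have hne : (block N z U (corner D g)).Nonempty :=
    hreg.card_pos hfr.g_pos hτ le_sup_right hU0 hc hfr.le_hi fun l hl => hcu l hl _ (hU0 l)
  have hm : m * (block N z U (corner D g)).card
      ≤ ∑ i ∈ block N z U (corner D g), (F (z i) + e i) := by
    rw [hU, hreg.block_clip_left]
    exact hopt.le_mean _ hc (by rwa [hU, hreg.block_clip_left] at hne)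
  have h1 := hnoise' (-U) (neg_nonneg.2 hU0) (neg_le_neg le_sup_right)
  rw [block_neg] at h1
  set B := block N z U (corner D g) with hB
  have hBpos : (0 : ℝ) < B.card := by exact_mod_cast hne.card_pos
  by_contra hlt
  push Not at hlt
  have hgk := hfr.g_pos k
  have hΛ2 : 1 ≤ Λ ^ 2 := one_le_pow₀ hΛ
  have hUθ : U k ≤ -(θ * g k) := by
    refine hlt.le.trans (neg_le_neg (mul_le_mul_of_nonneg_right ?_ hgk.le))
    nlinarith
  set U' := Function.update U k (-(θ * g k)) with hU'
  have hU'0 : U' ≤ 0 := fun l => by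
    by_cases hl : l = k
    · subst hl; simp only [hU', Function.update_self, Pi.zero_apply]
      exact neg_nonpos.2 (by positivity)
    · simp only [hU', Function.update_of_ne hl]; exact hU0 l
  set near := B.filter fun i => -(θ * g k) ≤ z i k with hnear
  set far := B.filter fun i => ¬ -(θ * g k) ≤ z i k with hfar
  have hcard : (near.card : ℝ) + far.card = B.card := by
    exact_mod_cast Finset.card_filter_add_card_filter_not (s := B) (fun i => -(θ * g k) ≤ z i k)
  have hnear_le : near ⊆ block N z U' (corner D g) := fun i hi => by
    obtain ⟨hiB, hik⟩ := Finset.mem_filter.1 hi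
    obtain ⟨h2, h3, h4⟩ := mem_block.1 hiB
    refine mem_block.2 ⟨h2, fun l => ?_, h4⟩
    by_cases hl : l = k
    · subst hl; simpa only [hU', Function.update_self] using hik
    · simp only [hU', Function.update_of_ne hl]; exact h3 l
  have hup := hreg.upper U' (corner D g) hU'0 hc fun l hl => hcu l hl _ (hU'0 l)
  have hdown := hreg.lower U (corner D g) le_sup_right hU0 hc hfr.le_hi
    fun l hl => hcu l hl _ (hU0 l)
  rw [← Finset.mul_prod_erase _ _ (Finset.mem_univ k)] at hup hdown
  set Q := ∏ l ∈ Finset.univ.erase k, relLen D g U (corner D g) l with hQ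
  have hQ' : ∏ l ∈ Finset.univ.erase k, relLen D g U' (corner D g) l = Q :=
    Finset.prod_congr rfl fun l hl => by
      simp only [relLen, hU', Function.update_of_ne (Finset.ne_of_mem_erase hl)]
  have hQ0 : 0 < Q := Finset.prod_pos fun l _ =>
    relLen_pos hfr.g_pos hτ hU0 hc (fun l hl => hcu l hl _ (hU0 l)) l
  have hlenk : ∀ x : Fin d → ℝ, relLen D g x (corner D g) k = 1 + -x k / g k := fun x => by
    simp only [relLen, corner]
    split_ifs
    · field_simp; ring
    · rw [zero_sub]
  rw [hQ', hlenk] at hup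
  rw [hlenk] at hdown
  have e1 : -U' k / g k = θ := by simp only [hU', Function.update_self]; field_simp
  have e2 : 2 * Λ ^ 2 * (1 + θ) < -U k / g k := by
    rw [lt_div_iff₀ hgk]; linarith
  rw [e1] at hup
  have hnc : (near.card : ℝ) ≤ (block N z U' (corner D g)).card := by
    exact_mod_cast Finset.card_le_card hnear_le
  have hw2 : 0 < w ^ 2 := pow_pos hfr.w_pos 2
  have hhalf : (near.card : ℝ) ≤ B.card / 2 := by
    have h3 : w ^ 2 * near.card ≤ Λ * ((1 + θ) * Q) :=
      (mul_le_mul_of_nonneg_left hnc hw2.le).trans hup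
    have h4 : 2 * Λ ^ 2 * (1 + θ) * Q ≤ Λ * (w ^ 2 * B.card) := by
      refine le_trans (mul_le_mul_of_nonneg_right ?_ hQ0.le) hdown
      linarith
    have h5 : 2 * Λ * (w ^ 2 * near.card) ≤ Λ * (w ^ 2 * B.card) := by nlinarith
    have h6 : 0 < Λ * w ^ 2 := by positivity
    nlinarith
  have hfarF : ∑ i ∈ far, F (z i) ≤ (far.card : ℝ) * (F 0 - (4 * (K₁ + K₂) + 1) * w) := by
    rw [← nsmul_eq_mul]
    refine Finset.sum_le_card_nsmul _ _ _ fun i hi => ?_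
    obtain ⟨hiB, hik⟩ := Finset.mem_filter.1 hi
    obtain ⟨h2, h3, h4⟩ := mem_block.1 hiB
    exact hdrop k _ (hreg.mem i h2) h4 (not_le.1 hik)
  have hnearF : ∑ i ∈ near, F (z i) ≤ (near.card : ℝ) * (F 0 + K₁ * w) := by
    rw [← nsmul_eq_mul]
    refine Finset.sum_le_card_nsmul _ _ _ fun i hi => le_trans ?_ hF.upper
    obtain ⟨hiB, hik⟩ := Finset.mem_filter.1 hi
    obtain ⟨h2, h3, h4⟩ := mem_block.1 hiB
    exact hF.mono (hreg.mem i h2) ⟨hfr.lo_le.trans ((neg_nonpos.2 hc).trans hc), hfr.le_hi⟩ h4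
  have hsum : ∑ i ∈ B, F (z i) = ∑ i ∈ near, F (z i) + ∑ i ∈ far, F (z i) :=
    (Finset.sum_filter_add_sum_filter_not B _ _).symm
  rw [Finset.sum_add_distrib, hsum] at hm
  have h3 := (abs_le.1 h1).2
  have hw := hfr.w_pos
  have h6 : (F 0 - (K₁ + K₂) * w) * B.card ≤ m * B.card :=
    mul_le_mul_of_nonneg_right hlow hBpos.le
  have h7 : 0 ≤ K₁ * w := mul_nonneg hK₁ hw.le
  have h8 : 0 ≤ K₂ * w := mul_nonneg hK₂ hw.le
  have h9 : (far.card : ℝ) = B.card - near.card := by linarith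
  rw [h9] at hfarF
  have h10 : (near.card : ℝ) * (K₁ * w) ≤ B.card / 2 * (K₁ * w) :=
    mul_le_mul_of_nonneg_right hhalf h7
  have h11 : (near.card : ℝ) * ((4 * (K₁ + K₂) + 1) * w)
      ≤ B.card / 2 * ((4 * (K₁ + K₂) + 1) * w) :=
    mul_le_mul_of_nonneg_right hhalf (by nlinarith)
  have h12 : 0 < (B.card : ℝ) * w := mul_pos hBpos hw
  have h13 : 0 ≤ K₁ * w * B.card := mul_nonneg h7 hBpos.le
  linarith

/-- The outer maximiser is not close to the origin in a direction of `D` in which the errors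
near the origin have a very negative sum. -/
lemma LowerOpt.le_neg_of_sum_le (hopt : LowerOpt N z (fun i => F (z i) + e i) u m)
    (hfr : Frame lo hi g D w) (hreg : Regular N z lo hi g D w Λ τ) (hτ : 0 < τ) (hτ1 : τ ≤ 1)
    (hF : SignalBounds F lo hi g D w K₁) (hΛ : 1 ≤ Λ)
    (hnoise : NoiseBound N z e hi g D w K₂) {C : ℝ} (hC : 0 ≤ C)
    (hCu : ∀ k, -(C * g k) ≤ (u ⊔ lo) k) {k : Fin d} (hk : k ∈ D) {c S : ℝ} (hτc : τ ≤ c)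
    (hc1 : c ≤ 1) (hS : 2 * Λ * (C + 1) ^ d * (2 * K₁ + K₂ + 1) ≤ S) (hS0 : 0 ≤ S)
    (hsum : ∑ i ∈ block N z (u ⊔ lo) (Function.update (corner D g) k (c * g k)), e i
      ≤ -(S * √c / w)) :
    (u ⊔ lo) k < -(c * g k) := by
  have hlow := hopt.lower_bound hfr hreg hτ hτ1 hF hnoise
  have hq := corner_nonneg (D := D) hfr.g_pos
  by_contra hlt
  push Not at hlt
  set U := u ⊔ lo with hU
  have hU0 : U ≤ 0 := sup_le hopt.nonpos (hfr.lo_le.trans (neg_nonpos.2 hq))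
  have hc0 : 0 < c := hτ.trans_le hτc
  have hgk := hfr.g_pos k
  set v := Function.update (corner D g) k (c * g k) with hv
  have hvk : v k = c * g k := by simp [hv]
  have hv0 : 0 ≤ v := fun l => by
    by_cases hl : l = k
    · subst hl; rw [hvk]; exact (mul_pos hc0 hgk).le
    · simp only [hv, Function.update_of_ne hl]; exact hq l
  have hvq : v ≤ corner D g := fun l => by
    by_cases hl : l = k
    · subst hl; rw [hvk]; simp only [corner, if_pos hk]; nlinarith
    · simp only [hv, Function.update_of_ne hl]; exact le_rfl
  have hside : ∀ l ∈ D, τ * g l ≤ v l - U l := fun l hl => by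
    have h0 := hU0 l
    simp only [Pi.zero_apply] at h0
    have hgl := hfr.g_pos l
    by_cases hlk : l = k
    · subst hlk; rw [hvk]; nlinarith
    · simp only [hv, Function.update_of_ne hlk, corner, if_pos hl]; nlinarith
  have hne : (block N z U v).Nonempty :=
    hreg.card_pos hfr.g_pos hτ le_sup_right hU0 hv0 (hvq.trans hfr.le_hi) hside
  have hm : m * (block N z U v).card ≤ ∑ i ∈ block N z U v, (F (z i) + e i) := by
    rw [hU, hreg.block_clip_left]
    exact hopt.le_mean _ hv0 (by rwa [hU, hreg.block_clip_left] at hne)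
  have hup := hreg.upper U v hU0 hv0 hside
  set B := block N z U v with hB
  have hBpos : (0 : ℝ) < B.card := by exact_mod_cast hne.card_pos
  have hprod : ∏ l, relLen D g U v l ≤ 2 * c * (C + 1) ^ d := by
    rw [← Finset.mul_prod_erase _ _ (Finset.mem_univ k)]
    have h1 : relLen D g U v k ≤ 2 * c := by
      simp only [relLen, if_pos hk, zero_add, hvk]
      rw [div_le_iff₀ hgk]; linarith
    have h2 : ∏ l ∈ Finset.univ.erase k, relLen D g U v l ≤ (C + 1) ^ d := by
      calc _ ≤ ∏ l ∈ Finset.univ.erase k, (C + 1) := by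
            refine Finset.prod_le_prod (fun l _ => (relLen_pos hfr.g_pos hτ hU0 hv0 hside l).le)
              fun l hl => ?_
            have hl := Finset.ne_of_mem_erase hl
            have hgl := hfr.g_pos l
            have h3 : (v l - U l) / g l ≤ (if l ∈ D then 1 else 0) + C := by
              rw [div_le_iff₀ hgl, add_mul]
              simp only [hv, Function.update_of_ne hl, corner]
              split_ifs <;> linarith [hCu l]
            simp only [relLen]
            split_ifs at h3 ⊢ <;> linarith
        _ = (C + 1) ^ (d - 1) := by simp
        _ ≤ (C + 1) ^ d := pow_le_pow_right₀ (by linarith) (Nat.sub_le d 1)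
    exact mul_le_mul h1 h2 (Finset.prod_nonneg fun l _ =>
      (relLen_pos hfr.g_pos hτ hU0 hv0 hside l).le) (by linarith)
  have hFB : ∑ i ∈ B, F (z i) ≤ (B.card : ℝ) * (F 0 + K₁ * w) := by
    rw [← nsmul_eq_mul]
    refine Finset.sum_le_card_nsmul _ _ _ fun i hi => le_trans ?_ hF.upper
    obtain ⟨h2, h3, h4⟩ := mem_block.1 hi
    exact hF.mono (hreg.mem i h2) ⟨hfr.lo_le.trans ((neg_nonpos.2 hq).trans hq), hfr.le_hi⟩
      (h4.trans hvq)
  rw [Finset.sum_add_distrib] at hm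
  have hw := hfr.w_pos
  have hcc : c ≤ √c := by
    rw [Real.le_sqrt' hc0]; nlinarith
  have hkey : (2 * K₁ + K₂ + 1) * w * B.card ≤ S * √c / w := by
    rw [le_div_iff₀ hw]
    have hP : 0 < (C + 1) ^ d := by positivity
    have h1 : w ^ 2 * B.card ≤ 2 * Λ * (C + 1) ^ d * c := by
      refine hup.trans ((mul_le_mul_of_nonneg_left hprod (by linarith)).trans (le_of_eq (by ring)))
    rcases le_or_gt (2 * K₁ + K₂ + 1) 0 with hneg | hpos
    · have : 0 ≤ S * √c := by positivity
      have : (2 * K₁ + K₂ + 1) * (w * B.card * w) ≤ 0 :=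
        mul_nonpos_of_nonpos_of_nonneg hneg (by positivity)
      nlinarith
    · calc (2 * K₁ + K₂ + 1) * w * B.card * w = (2 * K₁ + K₂ + 1) * (w ^ 2 * B.card) := by ring
        _ ≤ (2 * K₁ + K₂ + 1) * (2 * Λ * (C + 1) ^ d * c) :=
          mul_le_mul_of_nonneg_left h1 hpos.le
        _ = 2 * Λ * (C + 1) ^ d * (2 * K₁ + K₂ + 1) * c := by ring
        _ ≤ S * c := mul_le_mul_of_nonneg_right hS hc0.le
        _ ≤ S * √c := mul_le_mul_of_nonneg_left hcc hS0
  have h6 : (F 0 - (K₁ + K₂) * w) * B.card ≤ m * B.card :=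
    mul_le_mul_of_nonneg_right hlow hBpos.le
  have h12 : 0 < (B.card : ℝ) * w := mul_pos hBpos hw
  nlinarith

end Optimum

/-- The local variance estimator is close to the average of the squared errors. -/
lemma abs_mean_sq_sub_le {B : Finset ℕ} (hB : B.Nonempty) {e b : ℕ → ℝ} {ε₁ ε₂ V : ℝ}
    (hε₁ : 0 ≤ ε₁) (hb : ∀ i ∈ B, |b i| ≤ ε₁) (hV : |(∑ i ∈ B, e i ^ 2) / B.card - V| ≤ ε₂) :
    |(∑ i ∈ B, (e i + b i) ^ 2) / B.card - V| ≤ ε₂ + ε₁ * (1 + V + ε₂) + ε₁ ^ 2 := by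
  have hpos : (0 : ℝ) < B.card := by exact_mod_cast hB.card_pos
  have h1 : |∑ i ∈ B, (e i + b i) ^ 2 - ∑ i ∈ B, e i ^ 2|
      ≤ ε₁ * (B.card + ∑ i ∈ B, e i ^ 2) + ε₁ ^ 2 * B.card := by
    rw [← Finset.sum_sub_distrib]
    refine (Finset.abs_sum_le_sum_abs _ _).trans ?_
    have : ε₁ * (B.card + ∑ i ∈ B, e i ^ 2) + ε₁ ^ 2 * B.card
        = ∑ i ∈ B, (ε₁ * (1 + e i ^ 2) + ε₁ ^ 2) := by
      rw [Finset.sum_add_distrib, ← Finset.mul_sum, Finset.sum_add_distrib]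
      simp; ring
    rw [this]
    refine Finset.sum_le_sum fun i hi => ?_
    have h2 : (e i + b i) ^ 2 - e i ^ 2 = b i * (2 * e i) + b i ^ 2 := by ring
    rw [h2]
    refine (abs_add_le _ _).trans (add_le_add ?_ ?_)
    · rw [abs_mul]
      refine mul_le_mul (hb i hi) ?_ (abs_nonneg _) hε₁
      rw [abs_le]; constructor <;> nlinarith [sq_nonneg (e i + 1), sq_nonneg (e i - 1)]
    · rw [abs_of_nonneg (sq_nonneg _)]
      exact sq_le_sq' (abs_le.1 (hb i hi)).1 (abs_le.1 (hb i hi)).2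
  have h2 : (∑ i ∈ B, e i ^ 2) / B.card ≤ V + ε₂ := by linarith [(abs_le.1 hV).2]
  have h3 : |(∑ i ∈ B, (e i + b i) ^ 2) / B.card - (∑ i ∈ B, e i ^ 2) / B.card|
      ≤ ε₁ * (1 + V + ε₂) + ε₁ ^ 2 := by
    rw [← sub_div, abs_div, abs_of_pos hpos, div_le_iff₀ hpos]
    rw [div_le_iff₀ hpos] at h2
    nlinarith
  calc _ ≤ _ := abs_sub_le _ ((∑ i ∈ B, e i ^ 2) / B.card) _
    _ ≤ _ := by linarith

end Deterministic

section Anticoncentration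

variable {Ω : Type*} [MeasurableSpace Ω] {P : Measure Ω} [IsProbabilityMeasure P]
  {e : ℕ → Ω → ℝ}

lemma map_sum_eq_of_card_eq (he : ∀ i, Measurable (e i)) (hind : iIndepFun e P)
    (hid : ∀ i, IdentDistrib (e i) (e 0) P P) {I J : Finset ℕ} (h : I.card = J.card) :
    P.map (fun ω => ∑ i ∈ I, e i ω) = P.map (fun ω => ∑ i ∈ J, e i ω) := by
  have hm : ∀ I : Finset ℕ, Measurable fun ω => ∑ i ∈ I, e i ω := fun I =>
    Finset.measurable_fun_sum I fun i _ => he i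
  have : ∀ I : Finset ℕ, IsProbabilityMeasure (P.map fun ω => ∑ i ∈ I, e i ω) := fun I =>
    Measure.isProbabilityMeasure_map (hm I).aemeasurable
  have hc : ∀ I : Finset ℕ, charFun (P.map fun ω => ∑ i ∈ I, e i ω)
      = charFun (P.map (e 0)) ^ I.card := fun I => by
    rw [(hind.restrict _).charFun_map_fun_finsetSum_eq_prod (fun i _ => (he i).aemeasurable)]
    simp [fun i => (hid i).map_eq]
  refine Measure.ext_of_charFun ?_
  rw [hc, hc, h]

/-- Sums of many i.i.d. centred errors are very negative with positive probability. -/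
lemma exists_prob_sum_le (he : ∀ i, Measurable (e i)) (hind : iIndepFun e P)
    (hid : ∀ i, IdentDistrib (e i) (e 0) P P) (hL : MemLp (e 0) 2 P) (h0 : ∫ ω, e 0 ω ∂P = 0)
    (hv : 0 < ∫ ω, e 0 ω ^ 2 ∂P) (ρ : ℝ) :
    ∃ p : ℝ, 0 < p ∧ p ≤ 1 ∧ ∃ n₀ : ℕ, ∀ I : Finset ℕ, n₀ ≤ I.card →
      p ≤ P.real {ω | ∑ i ∈ I, e i ω ≤ -(ρ * √I.card)} := by
  have hvar : Var[e 0; P] = ∫ ω, e 0 ω ^ 2 ∂P := by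
    rw [variance_of_integral_eq_zero (he 0).aemeasurable h0]
  have hvn : Var[e 0; P].toNNReal ≠ 0 := by
    rw [hvar]; exact (Real.toNNReal_pos.2 hv).ne'
  have hclt := (tendstoInDistribution_inv_sqrt_mul_sum_sub (P := P) (X := e)
    (Y := id) (P' := gaussianReal 0 Var[e 0; P].toNNReal) HasLaw.id hL hind hid).tendsto
  have hlim := ProbabilityMeasure.le_liminf_measure_open_of_tendsto hclt
    (isOpen_Iio (a := -ρ))
  simp only [ProbabilityMeasure.coe_mk, Measure.map_id, h0, mul_zero, sub_zero] at hlim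
  have hpos : 0 < gaussianReal 0 Var[e 0; P].toNNReal (Set.Iio (-ρ)) := by
    rw [pos_iff_ne_zero]
    intro hzero
    have := gaussianReal_absolutelyContinuous' 0 hvn hzero
    simp at this
  obtain ⟨q, hq0, hq⟩ := ENNReal.lt_iff_exists_nnreal_btwn.1 hpos
  have hev := eventually_lt_of_lt_liminf (hq.trans_le hlim)
  obtain ⟨n₀, hn₀⟩ := eventually_atTop.1 hev
  have hq0' : 0 < q := by exact_mod_cast hq0
  have hfin : ∀ I : Finset ℕ, max n₀ 1 ≤ I.card →
      (q : ℝ) ≤ P.real {ω | ∑ i ∈ I, e i ω ≤ -(ρ * √I.card)} := by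
    intro I hI
    have h1 := hn₀ I.card ((le_max_left _ _).trans hI)
    have hcard : (0 : ℝ) < √I.card :=
      Real.sqrt_pos.2 (by exact_mod_cast lt_of_lt_of_le one_pos ((le_max_right _ _).trans hI))
    have hm : ∀ I : Finset ℕ, Measurable fun ω => ∑ i ∈ I, e i ω := fun I =>
      Finset.measurable_fun_sum I fun i _ => he i
    rw [Measure.map_apply ((hm _).const_mul _) measurableSet_Iio] at h1
    have h2 : P {ω | ∑ i ∈ Finset.range I.card, e i ω ≤ -(ρ * √I.card)}
        = P {ω | ∑ i ∈ I, e i ω ≤ -(ρ * √I.card)} := by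
      have h3 := congrArg (fun μ => μ (Set.Iic (-(ρ * √I.card))))
        (map_sum_eq_of_card_eq he hind hid (I := Finset.range I.card) (J := I) (by simp))
      simp only [Measure.map_apply (hm _) measurableSet_Iic] at h3
      exact h3
    have h4 : (q : ENNReal) ≤ P {ω | ∑ i ∈ I, e i ω ≤ -(ρ * √I.card)} := by
      rw [← h2]
      refine h1.le.trans (measure_mono fun ω hω => ?_)
      have h5 : (√(I.card : ℝ))⁻¹ * ∑ i ∈ Finset.range I.card, e i ω < -ρ := hω
      rw [inv_mul_lt_iff₀ hcard] at h5
      show ∑ i ∈ Finset.range I.card, e i ω ≤ -(ρ * √I.card)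
      linarith
    rw [measureReal_def]
    have := ENNReal.toReal_mono (measure_ne_top P _) h4
    simpa using this
  refine ⟨min q 1, lt_min (by exact_mod_cast hq0') one_pos, min_le_right _ _, max n₀ 1,
    fun I hI => (min_le_left _ _).trans (hfin I hI)⟩

end Anticoncentration

section MaxDevMeasurable

variable {κ : Type*} [Fintype κ]

lemma maxDev_iff (I : Finset ℕ) (key : ℕ → κ → ℝ) (x : ℕ → ℝ) (lam : ℝ) :
    MaxDev I key x lam ↔
      ∃ q : κ → ℚ, lam < |∑ i ∈ I, if ∀ k, key i k ≤ (q k : ℝ) then x i else 0| := by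
  classical
  have hsum : ∀ t : κ → ℝ, ∑ i ∈ I with key i ≤ t, x i
      = ∑ i ∈ I, if ∀ k, key i k ≤ t k then x i else 0 := fun t => by
    rw [Finset.sum_filter]
    refine Finset.sum_congr rfl fun i _ => ?_
    simp only [Pi.le_def]
  constructor
  · rintro ⟨t, ht⟩
    have hq : ∀ k, ∃ q : ℚ, t k ≤ q ∧ ∀ i ∈ I, key i k ≤ (q : ℝ) → key i k ≤ t k := by
      intro k
      have hopen : ∀ᶠ r in 𝓝[>] (t k), ∀ i ∈ I, key i k ≤ r → key i k ≤ t k := by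
        rw [Filter.eventually_all_finset]
        intro i _
        by_cases h : key i k ≤ t k
        · exact Eventually.of_forall fun _ _ => h
        · filter_upwards [Ioo_mem_nhdsGT (not_le.1 h)] with r hr hle
          exact absurd hle (not_le.2 hr.2)
      obtain ⟨b, hb, hsub⟩ := (mem_nhdsGT_iff_exists_Ioo_subset).1 hopen
      obtain ⟨q, hq1, hq2⟩ := exists_rat_btwn (Set.mem_Ioi.1 hb)
      exact ⟨q, hq1.le, hsub ⟨hq1, hq2⟩⟩
    choose q hq1 hq2 using hq
    refine ⟨q, lt_of_lt_of_eq ht ?_⟩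
    rw [hsum]
    congr 1
    refine Finset.sum_congr rfl fun i hi => ?_
    have : (∀ k, key i k ≤ t k) ↔ ∀ k, key i k ≤ (q k : ℝ) :=
      ⟨fun h k => (h k).trans (hq1 k), fun h k => hq2 k i hi (h k)⟩
    simp only [this]
  · rintro ⟨q, hq⟩
    exact ⟨fun k => q k, by rw [hsum]; exact hq⟩

lemma measurableSet_maxDev {𝒳 : Type*} [MeasurableSpace 𝒳] {N : ℕ} {I : 𝒳 → Finset ℕ}
    (hIN : ∀ a, I a ⊆ Finset.range N) (hI : ∀ i, MeasurableSet {a | i ∈ I a})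
    {key : 𝒳 → ℕ → κ → ℝ} (hkey : ∀ i k, Measurable fun a => key a i k) {x : 𝒳 → ℕ → ℝ}
    (hx : ∀ i, Measurable fun a => x a i) (lam : ℝ) :
    MeasurableSet {a | MaxDev (I a) (key a) (x a) lam} := by
  classical
  simp only [maxDev_iff]
  have : ∀ a (q : κ → ℚ), ∑ i ∈ I a, (if ∀ k, key a i k ≤ (q k : ℝ) then x a i else 0)
      = ∑ i ∈ Finset.range N,
        if i ∈ I a then (if ∀ k, key a i k ≤ (q k : ℝ) then x a i else 0) else 0 := fun a q => by
    rw [← Finset.sum_filter (· ∈ I a), Finset.filter_mem_eq_inter, Finset.inter_eq_right.2 (hIN a)]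
  simp only [this]
  rw [Set.ofPred_exists]
  refine MeasurableSet.iUnion fun q => measurableSet_lt measurable_const
    (measurable_abs.comp ?_)
  refine Finset.measurable_fun_sum _ fun i _ => Measurable.ite (hI i)
    (Measurable.ite ?_ (hx i) measurable_const) measurable_const
  rw [Set.ofPred_forall]
  exact MeasurableSet.iInter fun k => measurableSet_le (hkey i k) measurable_const

lemma measurableSet_errorSigma_maxDev {Ω : Type*} {e : ℕ → Ω → ℝ}
    {I J : Finset ℕ} (hIJ : I ⊆ J) (key : ℕ → κ → ℝ) (lam : ℝ) :
    MeasurableSet[errorSigma e J] {ω | MaxDev I key (fun i => e i ω) lam} := by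
  classical
  simp only [maxDev_iff]
  rw [Set.ofPred_exists]
  refine MeasurableSet.iUnion fun q => ?_
  have h : Measurable[errorSigma e J]
      (fun ω => ∑ i ∈ I, if ∀ k, key i k ≤ (q k : ℝ) then e i ω else 0) := ?_
  · exact @measurableSet_lt _ _ _ _ _ (errorSigma e J) _ _ _ _ _ measurable_const
      (measurable_abs.comp h)
  refine @Finset.measurable_fun_sum _ _ _ _ _ _ (errorSigma e J) _ _ fun i hi => ?_
  split_ifs
  · exact measurable_errorSigma (hIJ hi)
  · exact measurable_const

end MaxDevMeasurable

section FixedDesign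

variable {d N : ℕ} {z : ℕ → Fin d → ℝ} {lo hi g : Fin d → ℝ} {D : Finset (Fin d)} {w Λ τ : ℝ}

/-! ### Uniform bounds for the errors over large blocks -/

/-- Upper corners of the dyadic shells. -/
def dyadicCorner (g : Fin d → ℝ) {m : ℕ} (a : Fin d → Fin m) : Fin d → ℝ :=
  fun k => (2 ^ ((a k : ℕ) + 1) - 1) * g k

/-- A large error sum occurs within one of the dyadic shells. -/
def NoiseFail (m N : ℕ) (z : ℕ → Fin d → ℝ) (e : ℕ → ℝ) (g : Fin d → ℝ) (D : Finset (Fin d))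
    (w Λ K : ℝ) : Prop :=
  ∃ a : Fin d → Fin m, MaxDev (block N z (-corner D g) (dyadicCorner g a)) z e
    (K / (Λ * w) * ∏ k, 2 ^ (a k : ℕ))

lemma relLen_neg_corner (hg : ∀ k, 0 < g k) (v : Fin d → ℝ) (k : Fin d) :
    relLen D g (-corner D g) v k = 1 + v k / g k := by
  have := hg k
  simp only [relLen, corner, Pi.neg_apply]
  split_ifs
  · field_simp; ring
  · simp

lemma dyadicCorner_nonneg (hg : ∀ k, 0 < g k) {m : ℕ} (a : Fin d → Fin m) :
    0 ≤ dyadicCorner g a := fun k =>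
  mul_nonneg (sub_nonneg.2 (one_le_pow₀ (by norm_num))) (hg k).le

lemma side_neg_corner (hg : ∀ k, 0 < g k) (hτ1 : τ ≤ 1) {v : Fin d → ℝ} (hv : 0 ≤ v) :
    ∀ k ∈ D, τ * g k ≤ v k - (-corner D g) k := fun k hk => by
  have h1 := hv k
  have h2 := hg k
  simp only [corner, Pi.neg_apply, if_pos hk, Pi.zero_apply] at h1 ⊢
  nlinarith

lemma noiseBound_of_not_noiseFail (hfr : Frame lo hi g D w) (hreg : Regular N z lo hi g D w Λ τ)
    (hτ1 : τ ≤ 1) (hΛ : 1 ≤ Λ) {m : ℕ} (hm : ∀ k, 1 + hi k / g k < 2 ^ m) {e : ℕ → ℝ} {K : ℝ}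
    (hK : 0 ≤ K) (h : ¬ NoiseFail m N z e g D w Λ K) : NoiseBound N z e hi g D w K := by
  classical
  intro v hv hvhi
  have hc := corner_nonneg (D := D) hfr.g_pos
  have hex : ∀ k, ∃ a : Fin m, (2 : ℝ) ^ (a : ℕ) ≤ 1 + v k / g k ∧
      1 + v k / g k < 2 ^ ((a : ℕ) + 1) := by
    intro k
    have hvk : 0 ≤ v k / g k := div_nonneg (hv k) (hfr.g_pos k).le
    obtain ⟨a, ha1, ha2⟩ := exists_nat_pow_near (by linarith : 1 ≤ 1 + v k / g k) one_lt_two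
    refine ⟨⟨a, ?_⟩, ha1, ha2⟩
    have h1 : (2 : ℝ) ^ a < 2 ^ m := ha1.trans_lt ((hm k).trans_le' (by
      have := div_le_div_of_nonneg_right (hvhi k) (hfr.g_pos k).le
      linarith))
    exact (pow_lt_pow_iff_right₀ one_lt_two).1 h1
  choose a ha1 ha2 using hex
  have hva : v ≤ dyadicCorner g a := fun k => by
    have h1 := ha2 k
    have h2 : v k / g k ≤ 2 ^ ((a k : ℕ) + 1) - 1 := by linarith
    rwa [div_le_iff₀ (hfr.g_pos k)] at h2
  have hmax : ¬ _ := fun hd => h ⟨a, hd⟩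
  simp only [MaxDev, not_exists, not_lt] at hmax
  have h1 := hmax v
  have h2 : (block N z (-corner D g) (dyadicCorner g a)).filter (fun i => z i ≤ v)
      = block N z (-corner D g) v := by
    ext i
    simp only [Finset.mem_filter, mem_block]
    exact ⟨fun h => ⟨h.1.1, h.1.2.1, h.2⟩, fun h => ⟨⟨h.1, h.2.1, h.2.2.trans hva⟩, h.2.2⟩⟩
  have h3 : ∑ i ∈ block N z (-corner D g) (dyadicCorner g a) with z i ≤ v, e i
      = ∑ i ∈ block N z (-corner D g) v, e i := by rw [← h2]
  have hw := hfr.w_pos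
  have hlow := hreg.lower (-corner D g) v hfr.lo_le (neg_nonpos.2 hc) hv hvhi
    (side_neg_corner hfr.g_pos hτ1 hv)
  have h4 : ∏ k, (2 : ℝ) ^ (a k : ℕ) ≤ ∏ k, relLen D g (-corner D g) v k := by
    refine Finset.prod_le_prod (fun _ _ => by positivity) fun k _ => ?_
    rw [relLen_neg_corner hfr.g_pos]; exact ha1 k
  refine (le_of_eq ?_).trans (h1.trans ?_)
  · rw [← h3]
  · calc K / (Λ * w) * ∏ k, (2 : ℝ) ^ (a k : ℕ)
        ≤ K / (Λ * w) * (Λ * (w ^ 2 * (block N z (-corner D g) v).card)) :=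
          mul_le_mul_of_nonneg_left (h4.trans hlow) (by positivity)
      _ = K * w * (block N z (-corner D g) v).card := by field_simp

variable {Ω : Type*} [MeasurableSpace Ω] {P : Measure Ω} [IsProbabilityMeasure P]
  {e : ℕ → Ω → ℝ} {V : ℝ}

lemma CentredErrors.variance_nonneg (H : CentredErrors P e V) : 0 ≤ V :=
  (integral_nonneg fun _ => sq_nonneg _).trans (H.var 0)

lemma sum_prod_inv_two_pow_le (d m : ℕ) :
    ∑ a : Fin d → Fin m, ∏ k, ((2 : ℝ) ^ (a k : ℕ))⁻¹ ≤ 2 ^ d := by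
  rw [← Fintype.sum_pow (fun j : Fin m => ((2 : ℝ) ^ (j : ℕ))⁻¹)]
  refine pow_le_pow_left₀ (Finset.sum_nonneg fun _ _ => by positivity) ?_ d
  rw [Fin.sum_univ_eq_sum_range (fun j => ((2 : ℝ) ^ j)⁻¹) m]
  simp_rw [← inv_pow]
  have := Summable.sum_le_tsum (f := fun j : ℕ => ((2 : ℝ)⁻¹) ^ j) (Finset.range m)
    (fun _ _ => by positivity) (summable_geometric_of_lt_one (by norm_num) (by norm_num))
  rw [tsum_geometric_of_lt_one (by norm_num) (by norm_num)] at this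
  norm_num at this ⊢
  exact this

lemma CentredErrors.prob_noiseFail_le (H : CentredErrors P e V) (hfr : Frame lo hi g D w)
    (hreg : Regular N z lo hi g D w Λ τ) (hτ1 : τ ≤ 1) (hΛ : 1 ≤ Λ) (m : ℕ) {K : ℝ}
    (hK : 0 < K) :
    P.real {ω | NoiseFail m N z (fun i => e i ω) g D w Λ K} ≤ 16 ^ d * V * Λ ^ 3 / K ^ 2 := by
  have hw := hfr.w_pos
  have hV := H.variance_nonneg
  have hset : {ω | NoiseFail m N z (fun i => e i ω) g D w Λ K} = ⋃ a : Fin d → Fin m,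
      {ω | MaxDev (block N z (-corner D g) (dyadicCorner g a)) z (fun i => e i ω)
        (K / (Λ * w) * ∏ k, 2 ^ (a k : ℕ))} := by
    ext ω; simp [NoiseFail]
  rw [hset]
  refine (measureReal_iUnion_fintype_le _).trans ?_
  have hterm : ∀ a : Fin d → Fin m, P.real {ω | MaxDev (block N z (-corner D g) (dyadicCorner g a))
      z (fun i => e i ω) (K / (Λ * w) * ∏ k, 2 ^ (a k : ℕ))}
      ≤ 8 ^ d * V * Λ ^ 3 / K ^ 2 * ∏ k, ((2 : ℝ) ^ (a k : ℕ))⁻¹ := by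
    intro a
    set A : ℝ := ∏ k, (2 : ℝ) ^ (a k : ℕ) with hA
    have hA0 : 0 < A := by positivity
    refine (H.prob_maxDev_le _ z (by positivity)).trans ?_
    have hup := hreg.upper (-corner D g) (dyadicCorner g a)
      (neg_nonpos.2 (corner_nonneg hfr.g_pos)) (dyadicCorner_nonneg hfr.g_pos a)
      (side_neg_corner hfr.g_pos hτ1 (dyadicCorner_nonneg hfr.g_pos a))
    have hlen : ∏ k, relLen D g (-corner D g) (dyadicCorner g a) k = 2 ^ d * A := by
      have : ∀ k, relLen D g (-corner D g) (dyadicCorner g a) k = 2 * 2 ^ (a k : ℕ) := fun k => by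
        rw [relLen_neg_corner hfr.g_pos, dyadicCorner, mul_div_cancel_right₀ _ (hfr.g_pos k).ne']
        ring
      simp_rw [this]
      rw [Finset.prod_mul_distrib]; simp [hA]
    rw [hlen] at hup
    rw [Finset.prod_inv_distrib, ← hA, Fintype.card_fin]
    have hcard : ((block N z (-corner D g) (dyadicCorner g a)).card : ℝ)
        ≤ Λ * (2 ^ d * A) / w ^ 2 := by
      rw [le_div_iff₀ (by positivity)]; linarith
    calc _ ≤ 4 ^ d * (V * (Λ * (2 ^ d * A) / w ^ 2)) / (K / (Λ * w) * A) ^ 2 := by gcongr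
      _ = (4 ^ d * 2 ^ d) * V * Λ ^ 3 / K ^ 2 * A⁻¹ := by field_simp
      _ = _ := by rw [← mul_pow]; norm_num
  refine (Finset.sum_le_sum fun a _ => hterm a).trans ?_
  rw [← Finset.mul_sum]
  refine (mul_le_mul_of_nonneg_left (sum_prod_inv_two_pow_le d m) (by positivity)).trans
    (le_of_eq ?_)
  have : (16 : ℝ) ^ d = 8 ^ d * 2 ^ d := by rw [← mul_pow]; norm_num
  rw [this]; ring

/-! ### Independence over disjoint index sets -/

lemma CentredErrors.indep_errorSigma (H : CentredErrors P e V) {I J : Finset ℕ}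
    (hIJ : Disjoint I J) : Indep (errorSigma e I) (errorSigma e J) P :=
  indep_iSup_of_disjoint (fun i => (H.meas i).comap_le) H.indep.iIndep
    (Finset.disjoint_coe.2 hIJ)

lemma CentredErrors.real_inter_eq (H : CentredErrors P e V) {I J : Finset ℕ} (hIJ : Disjoint I J)
    {A B : Set Ω} (hA : MeasurableSet[errorSigma e I] A) (hB : MeasurableSet[errorSigma e J] B) :
    P.real (A ∩ B) = P.real A * P.real B := by
  have := (Indep_iff _ _ P).1 (H.indep_errorSigma hIJ) A B hA hB
  simp only [measureReal_def, this, ENNReal.toReal_mul]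

/-- If events over disjoint index sets have probability at least `p`, then none of them happens
with probability at most `(1 - p) ^ J`. -/
lemma CentredErrors.prob_forall_notMem_le (H : CentredErrors P e V) {L : ℕ → Finset ℕ}
    (hL : Pairwise fun i j => Disjoint (L i) (L j)) {A : ℕ → Set Ω}
    (hA : ∀ j, MeasurableSet[errorSigma e (L j)] (A j)) {p : ℝ} (hp1 : p ≤ 1) (J : ℕ)
    (hp : ∀ j < J, p ≤ P.real (A j)) :
    P.real {ω | ∀ j < J, ω ∉ A j} ≤ (1 - p) ^ J := by
  classical
  have hS : ∀ J, MeasurableSet[errorSigma e ((Finset.range J).biUnion L)]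
      {ω | ∀ j < J, ω ∉ A j} := by
    intro J
    have : {ω | ∀ j < J, ω ∉ A j} = ⋂ j ∈ Finset.range J, (A j)ᶜ := by ext ω; simp
    rw [this]
    refine Finset.measurableSet_biInter _ fun j hj => ?_
    exact MeasurableSet.compl
      (errorSigma_mono (Finset.subset_biUnion_of_mem L hj) _ (hA j))
  induction J with
  | zero => simp
  | succ J ih =>
    have hdis : Disjoint ((Finset.range J).biUnion L) (L J) := by
      rw [Finset.disjoint_biUnion_left]
      exact fun j hj => hL (Finset.mem_range.1 hj).ne
    have hset : {ω | ∀ j < J + 1, ω ∉ A j} = {ω | ∀ j < J, ω ∉ A j} ∩ (A J)ᶜ := by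
      ext ω
      simp only [Nat.lt_succ_iff_lt_or_eq, Set.mem_inter_iff, Set.mem_compl_iff]
      exact ⟨fun h => ⟨fun j hj => h j (Or.inl hj), h J (Or.inr rfl)⟩,
        fun h j hj => hj.elim (h.1 j) fun hj => hj ▸ h.2⟩
    rw [hset, H.real_inter_eq hdis (hS J) (hA J).compl,
      probReal_compl_eq_one_sub (errorSigma_le H.meas _ _ (hA J)), pow_succ]
    refine mul_le_mul (ih fun j hj => hp j (hj.trans J.lt_succ_self)) ?_
      (sub_nonneg.2 measureReal_le_one) (pow_nonneg (sub_nonneg.2 hp1) J)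
    linarith [hp J J.lt_succ_self]

end FixedDesign

section Layers

variable {d N : ℕ} {z : ℕ → Fin d → ℝ} {lo hi g : Fin d → ℝ} {D : Finset (Fin d)} {w Λ τ : ℝ}

/-! ### Layers near the origin orthogonal to a direction -/

/-- The lower corner `-C g`, cut off at `lo`. -/
def lowCorner (lo g : Fin d → ℝ) (C : ℝ) : Fin d → ℝ := (fun k => -(C * g k)) ⊔ lo

/-- The upper corner `corner D g` with `k`-th coordinate `c g_k`. -/
def thinCorner (D : Finset (Fin d)) (g : Fin d → ℝ) (k : Fin d) (c : ℝ) : Fin d → ℝ :=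
  Function.update (corner D g) k (c * g k)

/-- The points between the heights `c' g_k` and `c g_k` in direction `k`. -/
noncomputable def layer (N : ℕ) (z : ℕ → Fin d → ℝ) (lo g : Fin d → ℝ) (D : Finset (Fin d))
    (C : ℝ) (k : Fin d) (c c' : ℝ) : Finset ℕ :=
  (block N z (lowCorner lo g C) (thinCorner D g k c)).filter fun i => c' * g k < z i k

open Classical in
/-- The points of the layer in the positive orthant. -/
noncomputable def mainPart (N : ℕ) (z : ℕ → Fin d → ℝ) (lo g : Fin d → ℝ) (D : Finset (Fin d))
    (C : ℝ) (k : Fin d) (c c' : ℝ) : Finset ℕ :=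
  (layer N z lo g D C k c c').filter fun i => 0 ≤ z i

open Classical in
/-- The points of the layer outside the positive orthant. -/
noncomputable def sidePart (N : ℕ) (z : ℕ → Fin d → ℝ) (lo g : Fin d → ℝ) (D : Finset (Fin d))
    (C : ℝ) (k : Fin d) (c c' : ℝ) : Finset ℕ :=
  (layer N z lo g D C k c c').filter fun i => ¬ 0 ≤ z i

/-- The points below the height `c' g_k` and above `-c₀ g_k` in direction `k`. -/
noncomputable def innerPart (N : ℕ) (z : ℕ → Fin d → ℝ) (lo g : Fin d → ℝ) (D : Finset (Fin d))
    (C : ℝ) (k : Fin d) (c' c₀ : ℝ) : Finset ℕ :=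
  block N z (Function.update (lowCorner lo g C) k (-(c₀ * g k))) (thinCorner D g k c')

/-- The errors in the main part of the layer have a very negative sum that dominates the sums over
its side part. -/
def LayerGood (N : ℕ) (z : ℕ → Fin d → ℝ) (e : ℕ → ℝ) (lo g : Fin d → ℝ) (D : Finset (Fin d))
    (w C R R' : ℝ) (k : Fin d) (c c' : ℝ) : Prop :=
  ∑ i ∈ mainPart N z lo g D C k c c', e i ≤ -(R' * √c / w) ∧
    ¬ MaxDev (sidePart N z lo g D C k c c') (fun i => -z i) e (R * √c / w)

/-- None of the first `J` layers is good, or some sum over an inner part is large. -/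
def LayerFail (J N : ℕ) (z : ℕ → Fin d → ℝ) (e : ℕ → ℝ) (lo g : Fin d → ℝ) (D : Finset (Fin d))
    (w C R R' η : ℝ) (k : Fin d) : Prop :=
  (∀ j < J, ¬ LayerGood N z e lo g D w C R R' k (η ^ j) (η ^ (j + 1))) ∨
    ∃ j < J, MaxDev (innerPart N z lo g D C k (η ^ (j + 1)) (η ^ J)) (fun i => -z i) e
      (√(η ^ j) / w)

lemma lowCorner_nonpos (hfr : Frame lo hi g D w) {C : ℝ} (hC : 0 ≤ C) : lowCorner lo g C ≤ 0 :=
  sup_le (fun k => neg_nonpos.2 (mul_nonneg hC (hfr.g_pos k).le))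
    (hfr.lo_le.trans (neg_nonpos.2 (corner_nonneg hfr.g_pos)))

lemma thinCorner_self (k : Fin d) (c : ℝ) : thinCorner D g k c k = c * g k := by
  simp [thinCorner]

lemma thinCorner_nonneg (hg : ∀ k, 0 < g k) (k : Fin d) {c : ℝ} (hc : 0 ≤ c) :
    0 ≤ thinCorner D g k c := fun l => by
  by_cases hl : l = k
  · subst hl; rw [thinCorner_self]; exact mul_nonneg hc (hg l).le
  · simp only [thinCorner, Function.update_of_ne hl]; exact corner_nonneg hg l

lemma thinCorner_mono (hg : ∀ k, 0 < g k) (k : Fin d) {c c' : ℝ} (hc : c' ≤ c) :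
    thinCorner D g k c' ≤ thinCorner D g k c := fun l => by
  by_cases hl : l = k
  · subst hl; rw [thinCorner_self, thinCorner_self]; exact mul_le_mul_of_nonneg_right hc (hg l).le
  · simp only [thinCorner, Function.update_of_ne hl]; exact le_rfl

lemma thinCorner_le (hg : ∀ k, 0 < g k) {k : Fin d} (hk : k ∈ D) {c : ℝ} (hc : c ≤ 1) :
    thinCorner D g k c ≤ corner D g := fun l => by
  by_cases hl : l = k
  · subst hl; rw [thinCorner_self]; simp only [corner, if_pos hk]
    exact mul_le_of_le_one_left (hg l).le hc
  · simp only [thinCorner, Function.update_of_ne hl]; exact le_rfl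

lemma mem_block_thinCorner_of_le {u : Fin d → ℝ} {k : Fin d} {c c' : ℝ} {i : ℕ}
    (hi : i ∈ block N z u (thinCorner D g k c)) (h : z i k ≤ c' * g k) :
    i ∈ block N z u (thinCorner D g k c') := by
  obtain ⟨h1, h2, h3⟩ := mem_block.1 hi
  refine mem_block.2 ⟨h1, h2, fun l => ?_⟩
  by_cases hl : l = k
  · subst hl; rwa [thinCorner_self]
  · simpa only [thinCorner, Function.update_of_ne hl] using h3 l

open Classical in
/-- A block with low corner close to the origin in direction `k` is the disjoint union of the main
part, a piece of the side part and a piece of the inner part. -/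
lemma sum_block_thinCorner (hg : ∀ k, 0 < g k) {C : ℝ} {U : Fin d → ℝ} (hU : lowCorner lo g C ≤ U)
    (hU0 : U ≤ 0) {k : Fin d} {c c' c₀ : ℝ} (hcc : c' ≤ c) (hUk : -(c₀ * g k) ≤ U k)
    (e : ℕ → ℝ) :
    ∃ t : Fin d → ℝ, ∑ i ∈ block N z U (thinCorner D g k c), e i
      = ∑ i ∈ mainPart N z lo g D C k c c', e i
        + ((∑ i ∈ (sidePart N z lo g D C k c c').filter (fun i => -z i ≤ t), e i)
        + ∑ i ∈ (innerPart N z lo g D C k c' c₀).filter (fun i => -z i ≤ t), e i) := by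
  refine ⟨-U, ?_⟩
  rw [← Finset.sum_filter_add_sum_filter_not _ (fun i => c' * g k < z i k),
    ← Finset.sum_filter_add_sum_filter_not ((block N z U (thinCorner D g k c)).filter
      fun i => c' * g k < z i k) (fun i => 0 ≤ z i), add_assoc]
  congr 1
  · refine Finset.sum_congr ?_ fun _ _ => rfl
    ext i
    simp only [mainPart, layer, Finset.mem_filter, mem_block]
    exact ⟨fun h => ⟨⟨⟨h.1.1.1, hU.trans h.1.1.2.1, h.1.1.2.2⟩, h.1.2⟩, h.2⟩,
      fun h => ⟨⟨⟨h.1.1.1, hU0.trans h.2, h.1.1.2.2⟩, h.1.2⟩, h.2⟩⟩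
  congr 1
  · refine Finset.sum_congr ?_ fun _ _ => rfl
    ext i
    simp only [sidePart, layer, Finset.mem_filter, mem_block, neg_le_neg_iff]
    exact ⟨fun h => ⟨⟨⟨⟨h.1.1.1, hU.trans h.1.1.2.1, h.1.1.2.2⟩, h.1.2⟩, h.2⟩, h.1.1.2.1⟩,
      fun h => ⟨⟨⟨h.1.1.1.1, h.2, h.1.1.1.2.2⟩, h.1.1.2⟩, h.1.2⟩⟩
  · refine Finset.sum_congr ?_ fun _ _ => rfl
    ext i
    simp only [Finset.mem_filter, not_lt, neg_le_neg_iff]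
    constructor
    · rintro ⟨h1, h2⟩
      have h3 := mem_block.1 h1
      refine ⟨block_mono ?_ le_rfl (mem_block_thinCorner_of_le h1 h2), h3.2.1⟩
      intro l
      by_cases hl : l = k
      · subst hl; rwa [Function.update_self]
      · rw [Function.update_of_ne hl]; exact hU l
    · rintro ⟨h1, h2⟩
      obtain ⟨h3, h4, h5⟩ := mem_block.1 h1
      refine ⟨mem_block.2 ⟨h3, h2, h5.trans (thinCorner_mono hg k hcc)⟩, ?_⟩
      have := h5 k
      rwa [thinCorner_self] at this

lemma exists_sum_le_of_not_layerFail (hfr : Frame lo hi g D w) {C R R' η : ℝ} (hη : 0 < η)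
    (hη1 : η ≤ 1) {J : ℕ} {e : ℕ → ℝ} {k : Fin d} (h : ¬ LayerFail J N z e lo g D w C R R' η k)
    {U : Fin d → ℝ} (hU : lowCorner lo g C ≤ U) (hU0 : U ≤ 0) (hUk : -(η ^ J * g k) ≤ U k) :
    ∃ j < J, ∑ i ∈ block N z U (thinCorner D g k (η ^ j)), e i
      ≤ -((R' - R - 1) * √(η ^ j) / w) := by
  simp only [LayerFail, not_or, not_forall, not_not, not_exists, not_and] at h
  obtain ⟨⟨j, hj, hmain, hside⟩, hinner⟩ := h
  refine ⟨j, hj, ?_⟩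
  have hinner := hinner j hj
  obtain ⟨t, ht⟩ := sum_block_thinCorner (D := D) (N := N) (z := z) hfr.g_pos hU hU0
    (pow_le_pow_of_le_one hη.le hη1 (Nat.le_succ j)) hUk e
  simp only [MaxDev, not_exists, not_lt] at hside hinner
  have h1 := (le_abs_self _).trans (hside t)
  have h2 := (le_abs_self _).trans (hinner t)
  rw [ht]
  have h3 : -((R' - R - 1) * √(η ^ j) / w) = -(R' * √(η ^ j) / w) + (R * √(η ^ j) / w + √(η ^ j) / w) := by
    ring
  rw [h3]
  exact add_le_add hmain (add_le_add h1 h2)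

lemma relLen_nonneg (hg : ∀ k, 0 < g k) {u v : Fin d → ℝ} (hu : u ≤ 0) (hv : 0 ≤ v) (k : Fin d) :
    0 ≤ relLen D g u v k := by
  have : 0 ≤ (v k - u k) / g k := div_nonneg (sub_nonneg.2 ((hu k).trans (hv k))) (hg k).le
  simp only [relLen]; split_ifs <;> linarith

lemma prod_relLen_le (hg : ∀ k, 0 < g k) {u v : Fin d → ℝ} (hu : u ≤ 0) (hv : 0 ≤ v) {C x : ℝ}
    (hC : 0 ≤ C) (k : Fin d) (hul : ∀ l, l ≠ k → -(C * g l) ≤ u l)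
    (hvl : ∀ l, l ≠ k → v l ≤ corner D g l) (hx : relLen D g u v k ≤ x) :
    ∏ l, relLen D g u v l ≤ x * (C + 1) ^ d := by
  rw [← Finset.mul_prod_erase _ _ (Finset.mem_univ k)]
  have h2 : ∏ l ∈ Finset.univ.erase k, relLen D g u v l ≤ (C + 1) ^ d := by
    calc _ ≤ ∏ l ∈ Finset.univ.erase k, (C + 1) := by
          refine Finset.prod_le_prod (fun l _ => relLen_nonneg hg hu hv l) fun l hl => ?_
          have hl := Finset.ne_of_mem_erase hl
          have h3 : (v l - u l) / g l ≤ (if l ∈ D then 1 else 0) + C := by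
            rw [div_le_iff₀ (hg l), add_mul]
            have h4 := hvl l hl
            have h5 := hul l hl
            simp only [corner] at h4
            split_ifs at h4 ⊢ <;> linarith
          simp only [relLen]
          split_ifs at h3 ⊢ <;> linarith
      _ = (C + 1) ^ (d - 1) := by simp
      _ ≤ (C + 1) ^ d := pow_le_pow_right₀ (by linarith) (Nat.sub_le d 1)
  exact mul_le_mul hx h2 (Finset.prod_nonneg fun l _ => relLen_nonneg hg hu hv l)
    ((relLen_nonneg hg hu hv k).trans hx)

/-- Number of points near the origin at heights between `-c₀ g_k` and `c g_k` in direction `k`. -/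
lemma card_innerPart_le (hfr : Frame lo hi g D w) (hreg : Regular N z lo hi g D w Λ τ)
    (hτ1 : τ ≤ 1) (hΛ : 1 ≤ Λ) {C : ℝ} (hC : 0 ≤ C) {k : Fin d} (hk : k ∈ D) {c c₀ : ℝ}
    (hc : 0 ≤ c) (hc₀ : 0 ≤ c₀) (hτc : τ ≤ c + c₀) :
    ((innerPart N z lo g D C k c c₀).card : ℝ) ≤ Λ * ((c + c₀) * (C + 1) ^ d) / w ^ 2 := by
  have hgk := hfr.g_pos k
  set u := Function.update (lowCorner lo g C) k (-(c₀ * g k)) with hu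
  have huk : u k = -(c₀ * g k) := by simp [hu]
  have hu0 : u ≤ 0 := fun l => by
    by_cases hl : l = k
    · subst hl; rw [huk]; exact neg_nonpos.2 (mul_nonneg hc₀ hgk.le)
    · simp only [hu, Function.update_of_ne hl]; exact lowCorner_nonpos hfr hC l
  have hv0 := thinCorner_nonneg (D := D) hfr.g_pos k hc
  have hup := hreg.upper u (thinCorner D g k c) hu0 hv0 fun l hl => by
    by_cases hlk : l = k
    · subst hlk; rw [huk, thinCorner_self]; nlinarith
    · have h0 := hu0 l
      simp only [Pi.zero_apply] at h0
      have := hfr.g_pos l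
      simp only [thinCorner, Function.update_of_ne hlk, corner, if_pos hl]
      nlinarith
  have hprod := prod_relLen_le (D := D) hfr.g_pos hu0 hv0 hC k (x := c + c₀)
    (fun l hl => by
      simp only [hu, Function.update_of_ne hl, lowCorner]; exact le_sup_left)
    (fun l hl => by simp only [thinCorner, Function.update_of_ne hl]; exact le_rfl)
    (by
      simp only [relLen, if_pos hk, zero_add, huk, thinCorner_self]
      rw [div_le_iff₀ hgk]; linarith)
  rw [le_div_iff₀ (pow_pos hfr.w_pos 2), mul_comm]
  exact hup.trans (mul_le_mul_of_nonneg_left hprod (by linarith))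

lemma sidePart_subset_innerPart {C : ℝ} {k : Fin d} {c c' : ℝ} (hc' : 0 ≤ c') (hg : 0 < g k) :
    sidePart N z lo g D C k c c' ⊆ innerPart N z lo g D C k c 0 := fun i hi => by
  simp only [sidePart, layer, Finset.mem_filter] at hi
  obtain ⟨⟨h1, h2⟩, -⟩ := hi
  obtain ⟨h3, h4, h5⟩ := mem_block.1 h1
  refine mem_block.2 ⟨h3, fun l => ?_, h5⟩
  by_cases hl : l = k
  · subst hl; rw [Function.update_self]
    have : 0 ≤ c' * g l := mul_nonneg hc' hg.le
    linarith
  · rw [Function.update_of_ne hl]; exact h4 l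

lemma le_card_mainPart (hfr : Frame lo hi g D w) (hreg : Regular N z lo hi g D w Λ τ)
    (hτ1 : τ ≤ 1) (hΛ : 1 ≤ Λ) {C : ℝ} (hC : 0 ≤ C) {k : Fin d} (hk : k ∈ D) {c c' : ℝ}
    (hc' : 0 < c') (hc : c ≤ 1) (hτc : τ ≤ c') (hcc : 2 * Λ ^ 2 * c' ≤ c) :
    c / (2 * Λ * w ^ 2) ≤ (mainPart N z lo g D C k c c').card := by
  classical
  have hgk := hfr.g_pos k
  have hw := hfr.w_pos
  have hΛ2 : 1 ≤ Λ ^ 2 := one_le_pow₀ hΛ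
  have hc'c : c' ≤ c := by nlinarith
  have hq := corner_nonneg (D := D) hfr.g_pos
  have hside : ∀ x, τ ≤ x → ∀ l ∈ D, τ * g l ≤ thinCorner D g k x l - (0 : Fin d → ℝ) l :=
    fun x hx l hl => by
      have := hfr.g_pos l
      by_cases hlk : l = k
      · subst hlk; rw [thinCorner_self, Pi.zero_apply]; nlinarith
      · simp only [thinCorner, Function.update_of_ne hlk, corner, if_pos hl, Pi.zero_apply]
        nlinarith
  have hlen : ∀ x, 0 ≤ x → ∏ l, relLen D g 0 (thinCorner D g k x) l = x := fun x hx => by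
    rw [Finset.prod_eq_single k]
    · simp only [relLen, if_pos hk, thinCorner_self]; field_simp; simp
    · intro l _ hl
      have := hfr.g_pos l
      simp only [relLen, thinCorner, Function.update_of_ne hl, corner]
      split_ifs <;> field_simp <;> simp
    · simp
  have hlow := hreg.lower 0 (thinCorner D g k c) (hfr.lo_le.trans (neg_nonpos.2 hq)) le_rfl
    (thinCorner_nonneg hfr.g_pos k (hc'.le.trans hc'c)) ((thinCorner_le hfr.g_pos hk hc).trans hfr.le_hi)
    (hside c (hτc.trans hc'c))
  have hup := hreg.upper 0 (thinCorner D g k c') le_rfl (thinCorner_nonneg hfr.g_pos k hc'.le)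
    (hside c' hτc)
  rw [hlen _ (hc'.le.trans hc'c)] at hlow
  rw [hlen _ hc'.le] at hup
  have hsub : block N z 0 (thinCorner D g k c) ⊆
      mainPart N z lo g D C k c c' ∪ block N z 0 (thinCorner D g k c') := fun i hi => by
    by_cases h : c' * g k < z i k
    · refine Finset.mem_union_left _ ?_
      obtain ⟨h1, h2, h3⟩ := mem_block.1 hi
      simp only [mainPart, layer, Finset.mem_filter]
      exact ⟨⟨mem_block.2 ⟨h1, (lowCorner_nonpos hfr hC).trans h2, h3⟩, h⟩, h2⟩
    · exact Finset.mem_union_right _ (mem_block_thinCorner_of_le hi (not_lt.1 h))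
  have hcard : ((block N z 0 (thinCorner D g k c)).card : ℝ) ≤
      (mainPart N z lo g D C k c c').card + (block N z 0 (thinCorner D g k c')).card := by
    exact_mod_cast (Finset.card_le_card hsub).trans (Finset.card_union_le _ _)
  rw [div_le_iff₀ (by positivity)]
  have h1 : Λ * (w ^ 2 * (block N z 0 (thinCorner D g k c)).card) ≤
      Λ * (w ^ 2 * ((mainPart N z lo g D C k c c').card
        + (block N z 0 (thinCorner D g k c')).card)) := by gcongr
  have h2 : Λ * (w ^ 2 * (block N z 0 (thinCorner D g k c')).card) ≤ Λ * (Λ * c') :=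
    mul_le_mul_of_nonneg_left hup (by linarith)
  nlinarith

lemma disjoint_layer (hg : ∀ k, 0 < g k) {C η : ℝ} (hη : 0 < η) (hη1 : η ≤ 1) (k : Fin d) :
    Pairwise fun i j => Disjoint (layer N z lo g D C k (η ^ i) (η ^ (i + 1)))
      (layer N z lo g D C k (η ^ j) (η ^ (j + 1))) := by
  have key : ∀ i j, i < j → Disjoint (layer N z lo g D C k (η ^ i) (η ^ (i + 1)))
      (layer N z lo g D C k (η ^ j) (η ^ (j + 1))) := by
    intro i j hij
    rw [Finset.disjoint_left]
    intro a ha hb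
    have h1 := (Finset.mem_filter.1 ha).2
    have h2 := (mem_block.1 (Finset.mem_filter.1 hb).1).2.2 k
    rw [thinCorner_self] at h2
    have h3 : η ^ j * g k ≤ η ^ (i + 1) * g k :=
      mul_le_mul_of_nonneg_right (pow_le_pow_of_le_one hη.le hη1 hij) (hg k).le
    linarith
  intro i j hij
  rcases lt_or_gt_of_ne hij with h | h
  · exact key i j h
  · exact (key j i h).symm

variable {Ω : Type*} [MeasurableSpace Ω] {P : Measure Ω} [IsProbabilityMeasure P]
  {e : ℕ → Ω → ℝ} {V : ℝ}

lemma CentredErrors.le_prob_layerGood (H : CentredErrors P e V) (hfr : Frame lo hi g D w)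
    (hreg : Regular N z lo hi g D w Λ τ) (hτ1 : τ ≤ 1) (hΛ : 1 ≤ Λ) {C R R' p : ℝ}
    (hC : 0 ≤ C) (hR : 0 < R) (hR' : 0 ≤ R') (hR2 : 2 * 4 ^ d * V * Λ * (C + 1) ^ d ≤ R ^ 2)
    {k : Fin d} (hk : k ∈ D) {c c' : ℝ} (hc' : 0 < c') (hc : c ≤ 1) (hτc : τ ≤ c')
    (hcc : 2 * Λ ^ 2 * c' ≤ c) {n₀ : ℕ} (hp0 : 0 ≤ p)
    (hp : ∀ I : Finset ℕ, n₀ ≤ I.card →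
      p ≤ P.real {ω | ∑ i ∈ I, e i ω ≤ -(R' * √(2 * Λ) * √I.card)})
    (hn₀ : n₀ ≤ c / (2 * Λ * w ^ 2)) :
    p / 2 ≤ P.real {ω | LayerGood N z (fun i => e i ω) lo g D w C R R' k c c'} := by
  classical
  have hw := hfr.w_pos
  have hΛ2 : 1 ≤ Λ ^ 2 := one_le_pow₀ hΛ
  have hc0 : 0 < c := by nlinarith
  have hcc' : c' ≤ c := by nlinarith
  set M := mainPart N z lo g D C k c c' with hM
  set S := sidePart N z lo g D C k c c' with hS
  have hMS : Disjoint M S := Finset.disjoint_filter_filter_not _ _ _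
  have hcM := le_card_mainPart (C := C) hfr hreg hτ1 hΛ hC hk hc' hc hτc hcc
  rw [← hM] at hcM
  have h1 : p ≤ P.real {ω | ∑ i ∈ M, e i ω ≤ -(R' * √c / w)} := by
    refine (hp M (by exact_mod_cast hn₀.trans hcM)).trans (measureReal_mono fun ω hω => ?_)
    have hω : ∑ i ∈ M, e i ω ≤ -(R' * √(2 * Λ) * √M.card) := hω
    refine hω.trans (neg_le_neg ?_)
    rw [mul_div_assoc, mul_assoc]
    refine mul_le_mul_of_nonneg_left ?_ hR'
    rw [← Real.sqrt_mul (by positivity), div_le_iff₀ hw]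
    refine Real.sqrt_le_iff.2 ⟨by positivity, ?_⟩
    rw [mul_pow, Real.sq_sqrt (by positivity)]
    rw [div_le_iff₀ (by positivity)] at hcM
    linarith
  have h2 : P.real {ω | MaxDev S (fun i => -z i) (fun i => e i ω) (R * √c / w)} ≤ 1 / 2 := by
    refine (H.prob_maxDev_le S _ (by positivity)).trans ?_
    have hle := Finset.card_le_card
      (sidePart_subset_innerPart (N := N) (z := z) (lo := lo) (D := D) (C := C) (c := c)
        hc'.le (hfr.g_pos k))
    have hcard : (S.card : ℝ) ≤ Λ * ((c + 0) * (C + 1) ^ d) / w ^ 2 :=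
      le_trans (Nat.cast_le.2 hle)
        (card_innerPart_le hfr hreg hτ1 hΛ hC hk hc0.le le_rfl (by linarith))
    rw [add_zero] at hcard
    rw [Fintype.card_fin, div_le_iff₀ (by positivity), div_pow, mul_pow, Real.sq_sqrt hc0.le]
    have hV := H.variance_nonneg
    calc 4 ^ d * (V * S.card) ≤ 4 ^ d * (V * (Λ * (c * (C + 1) ^ d) / w ^ 2)) := by gcongr
      _ = 1 / 2 * (2 * 4 ^ d * V * Λ * (C + 1) ^ d) * c / w ^ 2 := by ring
      _ ≤ 1 / 2 * R ^ 2 * c / w ^ 2 := by gcongr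
      _ = _ := by ring
  have hset : {ω | LayerGood N z (fun i => e i ω) lo g D w C R R' k c c'}
      = {ω | ∑ i ∈ M, e i ω ≤ -(R' * √c / w)} ∩
        {ω | MaxDev S (fun i => -z i) (fun i => e i ω) (R * √c / w)}ᶜ := by
    ext ω; simp [LayerGood, hM, hS]
  have hSm := measurableSet_errorSigma_maxDev (e := e) (subset_refl S) (fun i => -z i) (R * √c / w)
  rw [hset, H.real_inter_eq hMS
      (@measurableSet_le _ _ _ _ _ (errorSigma e M) _ _ _ _ _
        (measurable_sum_errorSigma subset_rfl) measurable_const) hSm.compl,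
    probReal_compl_eq_one_sub (errorSigma_le H.meas _ _ hSm)]
  nlinarith

/-- With high probability, the errors have a very negative sum over blocks near the origin with a
suitable side in direction `k`. -/
lemma CentredErrors.prob_layerFail_le (H : CentredErrors P e V) (hfr : Frame lo hi g D w)
    (hreg : Regular N z lo hi g D w Λ τ) (hτ1 : τ ≤ 1) (hΛ : 1 ≤ Λ) {C R R' p η : ℝ}
    (hC : 0 ≤ C) (hR : 0 < R) (hR' : 0 ≤ R') (hR2 : 2 * 4 ^ d * V * Λ * (C + 1) ^ d ≤ R ^ 2)
    {k : Fin d} (hk : k ∈ D) (hη : 0 < η) (hη1 : 2 * Λ ^ 2 * η ≤ 1) {J : ℕ} (hτ : τ ≤ η ^ J)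
    {n₀ : ℕ} (hp0 : 0 ≤ p) (hp1 : p ≤ 1)
    (hp : ∀ I : Finset ℕ, n₀ ≤ I.card →
      p ≤ P.real {ω | ∑ i ∈ I, e i ω ≤ -(R' * √(2 * Λ) * √I.card)})
    (hn₀ : n₀ ≤ η ^ J / (2 * Λ * w ^ 2)) :
    P.real {ω | LayerFail J N z (fun i => e i ω) lo g D w C R R' η k}
      ≤ (1 - p / 2) ^ J + J * (4 ^ d * V * Λ * (C + 1) ^ d * (2 * η)) := by
  classical
  have hw := hfr.w_pos
  have hΛ2 : 1 ≤ Λ ^ 2 := one_le_pow₀ hΛ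
  have hη1' : η ≤ 1 := by nlinarith
  have hV := H.variance_nonneg
  have hset : {ω | LayerFail J N z (fun i => e i ω) lo g D w C R R' η k}
      = {ω | ∀ j < J, ω ∉ {ω | LayerGood N z (fun i => e i ω) lo g D w C R R' k
          (η ^ j) (η ^ (j + 1))}} ∪ ⋃ j ∈ Finset.range J,
          {ω | MaxDev (innerPart N z lo g D C k (η ^ (j + 1)) (η ^ J)) (fun i => -z i)
            (fun i => e i ω) (√(η ^ j) / w)} := by
    ext ω; simp [LayerFail]
  rw [hset]
  refine (measureReal_union_le _ _).trans (add_le_add ?_ ?_)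
  · refine H.prob_forall_notMem_le (disjoint_layer (N := N) (z := z) (lo := lo)
      (D := D) (C := C) hfr.g_pos hη hη1' k) (fun j => ?_)
      (by linarith) J (fun j hj => ?_)
    · have hset' : {ω | LayerGood N z (fun i => e i ω) lo g D w C R R' k (η ^ j) (η ^ (j + 1))}
          = {ω | ∑ i ∈ mainPart N z lo g D C k (η ^ j) (η ^ (j + 1)), e i ω
              ≤ -(R' * √(η ^ j) / w)} ∩
            {ω | MaxDev (sidePart N z lo g D C k (η ^ j) (η ^ (j + 1))) (fun i => -z i)
              (fun i => e i ω) (R * √(η ^ j) / w)}ᶜ := by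
        ext ω; simp [LayerGood]
      rw [hset']
      exact MeasurableSet.inter (@measurableSet_le _ _ _ _ _
        (errorSigma e (layer N z lo g D C k (η ^ j) (η ^ (j + 1)))) _ _ _ _ _
        (measurable_sum_errorSigma (Finset.filter_subset _ _)) measurable_const)
        (measurableSet_errorSigma_maxDev (Finset.filter_subset _ _) _ _).compl
    · have hj1 : η ^ J ≤ η ^ (j + 1) := pow_le_pow_of_le_one hη.le hη1' hj
      have hj2 : η ^ J ≤ η ^ j := pow_le_pow_of_le_one hη.le hη1' hj.le
      refine H.le_prob_layerGood hfr hreg hτ1 hΛ hC hR hR' hR2 hk (pow_pos hη _)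
        (pow_le_one₀ hη.le hη1') (hτ.trans hj1) ?_ hp0 hp
        (hn₀.trans (div_le_div_of_nonneg_right hj2 (by positivity)))
      have := pow_pos hη j
      calc 2 * Λ ^ 2 * η ^ (j + 1) = 2 * Λ ^ 2 * η * η ^ j := by ring
        _ ≤ 1 * η ^ j := by gcongr
        _ = η ^ j := one_mul _
  · refine (measureReal_biUnion_finset_le _ _).trans ?_
    rw [← nsmul_eq_mul, ← Finset.card_range J, ← Finset.sum_const, Finset.card_range]
    refine Finset.sum_le_sum fun j hj => ?_
    have hj := Finset.mem_range.1 hj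
    have hj1 : η ^ J ≤ η ^ (j + 1) := pow_le_pow_of_le_one hη.le hη1' hj
    have hpj := pow_pos hη j
    refine (H.prob_maxDev_le _ _ (by positivity)).trans ?_
    have hcard := card_innerPart_le (N := N) (z := z) (c := η ^ (j + 1)) (c₀ := η ^ J) hfr hreg
      hτ1 hΛ hC hk (pow_pos hη _).le (pow_pos hη _).le (by have := pow_pos hη (j + 1); linarith)
    rw [Fintype.card_fin, div_le_iff₀ (by positivity), div_pow, Real.sq_sqrt hpj.le]
    calc _ ≤ 4 ^ d * (V * (Λ * ((η ^ (j + 1) + η ^ J) * (C + 1) ^ d) / w ^ 2)) := by gcongr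
      _ ≤ 4 ^ d * (V * (Λ * ((η ^ (j + 1) + η ^ (j + 1)) * (C + 1) ^ d) / w ^ 2)) := by gcongr
      _ = _ := by rw [pow_succ]; ring

end Layers

section Squares

variable {d N : ℕ} {z : ℕ → Fin d → ℝ} {lo hi g : Fin d → ℝ} {D : Finset (Fin d)} {w Λ τ : ℝ}

/-! ### A uniform law of large numbers for the squared errors -/

/-- The square, set to zero where it exceeds `M`. -/
noncomputable def sqTrunc (M x : ℝ) : ℝ := if x ^ 2 ≤ M then x ^ 2 else 0

lemma measurable_sqTrunc (M : ℝ) : Measurable (sqTrunc M) :=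
  Measurable.ite (measurableSet_le (by fun_prop) measurable_const) (by fun_prop) measurable_const

lemma sqTrunc_nonneg (M x : ℝ) : 0 ≤ sqTrunc M x := by
  unfold sqTrunc; split_ifs <;> positivity

lemma sqTrunc_le_sq (M x : ℝ) : sqTrunc M x ≤ x ^ 2 := by
  unfold sqTrunc; split_ifs
  · exact le_rfl
  · positivity

lemma sqTrunc_le {M : ℝ} (hM : 0 ≤ M) (x : ℝ) : sqTrunc M x ≤ M := by
  unfold sqTrunc; split_ifs with h
  · exact h
  · exact hM

/-- The blocks inside `[-C g, C g]`. -/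
noncomputable def centredBox (N : ℕ) (z : ℕ → Fin d → ℝ) (g : Fin d → ℝ) (C : ℝ) : Finset ℕ :=
  block N z (fun k => -(C * g k)) (fun k => C * g k)

/-- The key recording both corners of a block. -/
def doubleKey (z : ℕ → Fin d → ℝ) (i : ℕ) : Fin d ⊕ Fin d → ℝ := Sum.elim (-z i) (z i)

/-- Either the truncated squares deviate from their mean `E` over some block within the centred
box, or the squares beyond the truncation are large. -/
def SquareFail (N : ℕ) (z : ℕ → Fin d → ℝ) (e : ℕ → ℝ) (g : Fin d → ℝ) (C M E lam : ℝ) : Prop :=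
  MaxDev (centredBox N z g C) (doubleKey z) (fun i => sqTrunc M (e i) - E) lam ∨
    lam < ∑ i ∈ centredBox N z g C, (e i ^ 2 - sqTrunc M (e i))

lemma abs_mean_sq_sub_le_of_not_squareFail {e : ℕ → ℝ} {C M E ε κ : ℝ} (hε : 0 ≤ ε) (hw : 0 < w)
    (h : ¬ SquareFail N z e g C M E (ε * κ / w ^ 2)) {u v : Fin d → ℝ}
    (hu : ∀ k, -(C * g k) ≤ u k) (hv : ∀ k, v k ≤ C * g k) (hne : (block N z u v).Nonempty)
    (hκ : κ ≤ w ^ 2 * (block N z u v).card) {V : ℝ} (hEV : E ≤ V) :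
    |(∑ i ∈ block N z u v, e i ^ 2) / (block N z u v).card - V| ≤ 2 * ε + (V - E) := by
  classical
  simp only [SquareFail, MaxDev, not_or, not_exists, not_lt] at h
  obtain ⟨h1, h2⟩ := h
  have hsub : block N z u v ⊆ centredBox N z g C := block_mono hu hv
  have hpos : (0 : ℝ) < (block N z u v).card := by exact_mod_cast hne.card_pos
  have hlam : ε * κ / w ^ 2 ≤ ε * (block N z u v).card := by
    rw [div_le_iff₀ (by positivity), mul_assoc]
    exact mul_le_mul_of_nonneg_left (by linarith) hε
  have hB : (centredBox N z g C).filter (fun i => doubleKey z i ≤ Sum.elim (-u) v)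
      = block N z u v := by
    ext i
    simp only [Finset.mem_filter]
    constructor
    · rintro ⟨h3, h4⟩
      refine mem_block.2 ⟨(mem_block.1 h3).1, fun k => ?_, fun k => h4 (Sum.inr k)⟩
      have := h4 (Sum.inl k)
      simp only [doubleKey, Sum.elim_inl, Pi.neg_apply] at this
      linarith
    · intro h3
      refine ⟨hsub h3, ?_⟩
      rintro (k | k)
      · exact neg_le_neg ((mem_block.1 h3).2.1 k)
      · exact (mem_block.1 h3).2.2 k
  have h3 := h1 (Sum.elim (-u) v)
  have h3' : |∑ i ∈ block N z u v, (sqTrunc M (e i) - E)| ≤ ε * κ / w ^ 2 := by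
    rw [← hB]; convert h3
  have h4 : ∑ i ∈ block N z u v, (e i ^ 2 - sqTrunc M (e i)) ≤ ε * κ / w ^ 2 :=
    (Finset.sum_le_sum_of_subset_of_nonneg hsub fun i _ _ =>
      sub_nonneg.2 (sqTrunc_le_sq M (e i))).trans h2
  have h5 : 0 ≤ ∑ i ∈ block N z u v, (e i ^ 2 - sqTrunc M (e i)) :=
    Finset.sum_nonneg fun i _ => sub_nonneg.2 (sqTrunc_le_sq M (e i))
  rw [Finset.sum_sub_distrib] at h3' h4 h5
  rw [Finset.sum_const, nsmul_eq_mul, abs_le] at h3'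
  rw [abs_le, le_sub_iff_add_le, sub_le_iff_le_add, le_div_iff₀ hpos, div_le_iff₀ hpos]
  constructor <;> nlinarith

/-- Number of points in the centred box. -/
lemma card_centredBox_le (hfr : Frame lo hi g D w) (hreg : Regular N z lo hi g D w Λ τ)
    (hτ1 : τ ≤ 1) (hΛ : 1 ≤ Λ) {C : ℝ} (hC : 1 ≤ C) :
    ((centredBox N z g C).card : ℝ) ≤ Λ * (2 * C + 1) ^ d / w ^ 2 := by
  rw [le_div_iff₀ (pow_pos hfr.w_pos 2), mul_comm]
  have h0 : ∀ k, 0 ≤ C * g k := fun k => mul_nonneg (by linarith) (hfr.g_pos k).le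
  have hu : (fun k => -(C * g k)) ≤ (0 : Fin d → ℝ) := fun k => neg_nonpos.2 (h0 k)
  have hv : (0 : Fin d → ℝ) ≤ fun k => C * g k := h0
  refine (hreg.upper _ _ hu hv fun k hk => ?_).trans (mul_le_mul_of_nonneg_left ?_ (by linarith))
  · have := hfr.g_pos k
    nlinarith
  · calc _ ≤ ∏ k : Fin d, (2 * C + 1) := by
          refine Finset.prod_le_prod (fun k _ => relLen_nonneg hfr.g_pos hu hv k) fun k _ => ?_
          have hk := (hfr.g_pos k).ne'
          have : (C * g k - -(C * g k)) / g k = 2 * C := by field_simp; ring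
          simp only [relLen, this]
          split_ifs <;> linarith
      _ = _ := by simp

variable {Ω : Type*} [MeasurableSpace Ω] {P : Measure Ω} [IsProbabilityMeasure P]
  {e : ℕ → Ω → ℝ}

lemma integrable_sqTrunc {x : Ω → ℝ} (hx : MemLp x 2 P) (M : ℝ) :
    Integrable (fun ω => sqTrunc M (x ω)) P := by
  refine Integrable.mono' hx.integrable_sq
    ((measurable_sqTrunc M).comp_aemeasurable hx.aemeasurable).aestronglyMeasurable
    (Eventually.of_forall fun ω => ?_)
  rw [Real.norm_of_nonneg (sqTrunc_nonneg _ _)]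
  exact sqTrunc_le_sq _ _

lemma tendsto_integral_sqTrunc {x : Ω → ℝ} (hx : MemLp x 2 P) :
    Tendsto (fun M => ∫ ω, sqTrunc M (x ω) ∂P) atTop (𝓝 (∫ ω, x ω ^ 2 ∂P)) := by
  refine tendsto_integral_filter_of_dominated_convergence (fun ω => x ω ^ 2)
    (Eventually.of_forall fun M => (integrable_sqTrunc hx M).aestronglyMeasurable)
    (Eventually.of_forall fun M => Eventually.of_forall fun ω => ?_) hx.integrable_sq
    (Eventually.of_forall fun ω => tendsto_const_nhds.congr' ?_)
  · rw [Real.norm_of_nonneg (sqTrunc_nonneg _ _)]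
    exact sqTrunc_le_sq _ _
  · filter_upwards [eventually_ge_atTop (x ω ^ 2)] with M hM
    simp [sqTrunc, hM]

lemma centredErrors_sqTrunc (he : ∀ i, Measurable (e i)) (hind : iIndepFun e P)
    (hid : ∀ i, IdentDistrib (e i) (e 0) P P) {M : ℝ} (hM : 0 ≤ M) :
    CentredErrors P (fun i ω => sqTrunc M (e i ω) - ∫ ω, sqTrunc M (e 0 ω) ∂P) (M ^ 2) := by
  set E := ∫ ω, sqTrunc M (e 0 ω) ∂P with hE
  have hmeas : ∀ i, Measurable fun ω => sqTrunc M (e i ω) - E := fun i =>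
    ((measurable_sqTrunc M).comp (he i)).sub_const E
  have hint : ∀ i, Integrable (fun ω => sqTrunc M (e i ω)) P := fun i =>
    Integrable.of_bound ((measurable_sqTrunc M).comp (he i)).aestronglyMeasurable M
      (Eventually.of_forall fun ω => by
        rw [Real.norm_of_nonneg (sqTrunc_nonneg _ _)]; exact sqTrunc_le hM _)
  have hE0 : 0 ≤ E := integral_nonneg fun _ => sqTrunc_nonneg _ _
  have hEM : E ≤ M := by
    have := integral_mono (hint 0) (integrable_const M) fun ω => sqTrunc_le hM (e 0 ω)
    simpa using this
  have hb : ∀ i ω, |sqTrunc M (e i ω) - E| ≤ M := fun i ω => by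
    rw [abs_le]
    constructor <;> linarith [sqTrunc_nonneg M (e i ω), sqTrunc_le hM (e i ω)]
  refine ⟨hmeas, hind.comp (fun _ x => sqTrunc M x - E)
    fun _ => (measurable_sqTrunc M).sub_const E,
    fun i => MemLp.of_bound (hmeas i).aestronglyMeasurable M (Eventually.of_forall fun ω => hb i ω),
    fun i => ?_, fun i => ?_⟩
  · rw [integral_sub (hint i) (integrable_const _)]
    have := ((hid i).comp (measurable_sqTrunc M)).integral_eq
    simp only [Function.comp_def] at this
    simp [this, hE]
  · have : ∫ ω, (sqTrunc M (e i ω) - E) ^ 2 ∂P ≤ ∫ _, M ^ 2 ∂P := by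
      refine integral_mono_of_nonneg (Eventually.of_forall fun ω => sq_nonneg _)
        (integrable_const _) (Eventually.of_forall fun ω => ?_)
      exact sq_le_sq' (abs_le.1 (hb i ω)).1 (abs_le.1 (hb i ω)).2
    simpa using this

lemma prob_squareFail_le (he : ∀ i, Measurable (e i)) (hind : iIndepFun e P)
    (hid : ∀ i, IdentDistrib (e i) (e 0) P P) (hL : MemLp (e 0) 2 P)
    (hfr : Frame lo hi g D w) (hreg : Regular N z lo hi g D w Λ τ) (hτ1 : τ ≤ 1) (hΛ : 1 ≤ Λ)
    {C M κ : ℝ} (hC : 1 ≤ C) (hM : 0 ≤ M) (hκ : 0 < κ) :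
    P.real {ω | SquareFail N z (fun i => e i ω) g C M (∫ ω, sqTrunc M (e 0 ω) ∂P) (κ / w ^ 2)}
      ≤ 16 ^ d * M ^ 2 * (Λ * (2 * C + 1) ^ d) / κ ^ 2 * w ^ 2
        + Λ * (2 * C + 1) ^ d / κ * (∫ ω, e 0 ω ^ 2 ∂P - ∫ ω, sqTrunc M (e 0 ω) ∂P) := by
  have hw := hfr.w_pos
  have hcard := card_centredBox_le hfr hreg hτ1 hΛ hC
  set E := ∫ ω, sqTrunc M (e 0 ω) ∂P with hE
  set A := Λ * (2 * C + 1) ^ d with hA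
  have hid' : ∀ i, MemLp (e i) 2 P := fun i => (hid i).symm.memLp_iff.1 hL
  have hset : {ω | SquareFail N z (fun i => e i ω) g C M E (κ / w ^ 2)}
      = {ω | MaxDev (centredBox N z g C) (doubleKey z) (fun i => sqTrunc M (e i ω) - E) (κ / w ^ 2)}
        ∪ {ω | κ / w ^ 2 < ∑ i ∈ centredBox N z g C, (e i ω ^ 2 - sqTrunc M (e i ω))} := by
    ext ω; simp [SquareFail]
  rw [hset]
  refine (measureReal_union_le _ _).trans (add_le_add ?_ ?_)
  · refine ((centredErrors_sqTrunc he hind hid hM).prob_maxDev_le _ _ (by positivity)).trans ?_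
    have h1 : (4 : ℝ) ^ Fintype.card (Fin d ⊕ Fin d) = 16 ^ d := by
      rw [Fintype.card_sum, Fintype.card_fin, ← two_mul, pow_mul]; norm_num
    rw [h1]
    calc _ ≤ 16 ^ d * (M ^ 2 * (A / w ^ 2)) / (κ / w ^ 2) ^ 2 := by gcongr
      _ = _ := by field_simp
  · have hint : ∀ i, Integrable (fun ω => e i ω ^ 2 - sqTrunc M (e i ω)) P := fun i =>
      (hid' i).integrable_sq.sub (integrable_sqTrunc (hid' i) M)
    have hnn : ∀ i ω, 0 ≤ e i ω ^ 2 - sqTrunc M (e i ω) := fun i ω =>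
      sub_nonneg.2 (sqTrunc_le_sq M (e i ω))
    have hval : ∀ i, ∫ ω, (e i ω ^ 2 - sqTrunc M (e i ω)) ∂P = ∫ ω, e 0 ω ^ 2 ∂P - E := fun i => by
      rw [integral_sub (hid' i).integrable_sq (integrable_sqTrunc (hid' i) M)]
      have h1 := ((hid i).comp (measurable_sqTrunc M)).integral_eq
      have h2 := ((hid i).comp (u := fun x => x ^ 2) (by fun_prop)).integral_eq
      simp only [Function.comp_def] at h1 h2
      rw [h1, h2]
    have hEV : 0 ≤ ∫ ω, e 0 ω ^ 2 ∂P - E := by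
      rw [← hval 0]; exact integral_nonneg (hnn 0)
    have h1 := mul_meas_ge_le_integral_of_nonneg (μ := P)
      (f := fun ω => ∑ i ∈ centredBox N z g C, (e i ω ^ 2 - sqTrunc M (e i ω)))
      (Eventually.of_forall fun ω => Finset.sum_nonneg fun i _ => hnn i ω)
      (integrable_finsetSum _ fun i _ => hint i) (κ / w ^ 2)
    rw [integral_finsetSum _ fun i _ => hint i, Finset.sum_congr rfl fun i _ => hval i,
      Finset.sum_const, nsmul_eq_mul] at h1
    have h2 : κ / w ^ 2 * P.real {ω | κ / w ^ 2 <
        ∑ i ∈ centredBox N z g C, (e i ω ^ 2 - sqTrunc M (e i ω))}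
        ≤ A / w ^ 2 * (∫ ω, e 0 ω ^ 2 ∂P - E) := by
      refine le_trans ?_ (h1.trans (mul_le_mul_of_nonneg_right hcard hEV))
      refine mul_le_mul_of_nonneg_left (measureReal_mono ?_) (div_pos hκ (by positivity)).le
      intro ω hω
      rw [Set.mem_ofPred_eq] at hω ⊢
      exact hω.le
    rw [div_mul_eq_mul_div, div_mul_eq_mul_div, div_le_div_iff_of_pos_right (by positivity)] at h2
    rw [div_mul_eq_mul_div, le_div_iff₀ hκ, mul_comm]
    exact h2

end Squares

section Combination

variable {d N : ℕ} {z : ℕ → Fin d → ℝ} {lo hi g : Fin d → ℝ} {D : Finset (Fin d)} {w Λ τ : ℝ}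

/-! ### Consistency at a fixed stage -/

lemma NoiseBound.neg {e : ℕ → ℝ} {K : ℝ} (h : NoiseBound N z e hi g D w K) :
    NoiseBound N z (fun i => -e i) hi g D w K := fun v h1 h2 => by
  rw [Finset.sum_neg_distrib, abs_neg]; exact h v h1 h2

/-- The constants of the probabilistic bounds. -/
structure Tuning where
  (K₂ C R R' η M E lam : ℝ)
  J : ℕ

/-- The union of the unfavourable events for the errors. -/
def ErrorsFail (T : Tuning) (m N : ℕ) (lo g : Fin d → ℝ) (D : Finset (Fin d)) (w Λ : ℝ)
    (z : ℕ → Fin d → ℝ) (e : ℕ → ℝ) : Prop :=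
  (NoiseFail m N z e g D w Λ T.K₂ ∨ NoiseFail m N (fun i => -z i) e g D w Λ T.K₂) ∨
    (∃ k ∈ D, LayerFail T.J N z e lo g D w T.C T.R T.R' T.η k) ∨
      SquareFail N z e g T.C T.M T.E T.lam

/-- The deterministic consequence of favourable errors and a regular design. -/
lemma abs_mean_sq_sub_le_of_not_errorsFail {T : Tuning} {m : ℕ} {e : ℕ → ℝ} {F : (Fin d → ℝ) → ℝ}
    {u v : Fin d → ℝ} {mL mU K₁ θ θ' ε V : ℝ}
    (hoptL : LowerOpt N z (fun i => F (z i) + e i) u mL)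
    (hoptU : LowerOpt N (fun i => -z i) (fun i => -(F (z i) + e i)) (-v) (-mU))
    (hfr : Frame lo hi g D w) (hreg : Regular N z lo hi g D w Λ τ) (hτ : 0 < τ) (hτ1 : τ ≤ 1)
    (hΛ : 1 ≤ Λ) (hF : SignalBounds F lo hi g D w K₁) (hK₁ : 0 ≤ K₁) (hK₂ : 0 ≤ T.K₂)
    (hθ : 0 ≤ θ) (hθ' : 0 ≤ θ') (hdrop : SignalDrop F lo hi g D w (4 * (K₁ + T.K₂) + 1) θ)
    (hdrop' : SignalDrop (fun x => -F (-x)) (-hi) (-lo) g D w (4 * (K₁ + T.K₂) + 1) θ')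
    (hC : 2 * Λ ^ 2 * (1 + θ) ≤ T.C) (hC' : 2 * Λ ^ 2 * (1 + θ') ≤ T.C)
    (hm : ∀ k, 1 + hi k / g k < 2 ^ m) (hm' : ∀ k, 1 + -lo k / g k < 2 ^ m)
    (hS : 2 * Λ * (T.C + 1) ^ d * (2 * K₁ + T.K₂ + 1) ≤ T.R' - T.R - 1)
    (hη : 0 < T.η) (hη1 : T.η ≤ 1) (hτη : τ ≤ T.η ^ T.J) (hε : 0 ≤ ε)
    (hlam : T.lam = ε * ((T.η ^ T.J) ^ d / Λ) / w ^ 2) (hEV : T.E ≤ V)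
    (hcont : ∀ x ∈ Set.Icc lo hi, (∀ k, |x k| ≤ T.C * g k) → |F x - F 0| ≤ ε)
    (hgood : ¬ ErrorsFail T m N lo g D w Λ z e) :
    |(∑ i ∈ block N z u v, (F (z i) + e i - (mL + mU) / 2) ^ 2) / (block N z u v).card - V|
      ≤ (2 * ε + (V - T.E)) + (ε + (K₁ + T.K₂) * w) * (1 + V + (2 * ε + (V - T.E)))
        + (ε + (K₁ + T.K₂) * w) ^ 2 := by
  simp only [ErrorsFail, not_or, not_exists, not_and] at hgood
  obtain ⟨⟨hn1, hn2⟩, hlayer, hsq⟩ := hgood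
  have hw := hfr.w_pos
  have hq := corner_nonneg (D := D) hfr.g_pos
  have hΛ2 : 1 ≤ Λ ^ 2 := one_le_pow₀ hΛ
  have hlo0 : lo ≤ 0 := hfr.lo_le.trans (neg_nonpos.2 hq)
  have hhi0 : 0 ≤ hi := hq.trans hfr.le_hi
  have hN1 := noiseBound_of_not_noiseFail hfr hreg hτ1 hΛ hm hK₂ hn1
  have hN2 := noiseBound_of_not_noiseFail hfr.neg hreg.neg hτ1 hΛ (by simpa using hm') hK₂ hn2
  have hoptU' : LowerOpt N (fun i => -z i) (fun i => (fun x => -F (-x)) (-z i) + -e i) (-v) (-mU) := by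
    have : (fun i => -(F (z i) + e i)) = fun i => (fun x => -F (-x)) (-z i) + -e i := by
      ext i; simp only [neg_neg]; ring
    rwa [this] at hoptU
  have hN1' : NoiseBound N (fun i => -(fun i => -z i) i) (fun i => -e i) (- -hi) g D w T.K₂ := by
    simpa using hN1.neg
  have hC0 : 0 ≤ T.C := by nlinarith
  have hC1 : 1 ≤ T.C := by nlinarith
  have hlowL := hoptL.lower_bound hfr hreg hτ hτ1 hF hN1
  have huppL := hoptL.upper_bound hfr hreg hτ hτ1 hF hN2
  have hlowU := hoptU'.lower_bound hfr.neg hreg.neg hτ hτ1 hF.neg hN2.neg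
  have huppU := hoptU'.upper_bound hfr.neg hreg.neg hτ hτ1 hF.neg hN1'
  simp only [neg_zero] at hlowU huppU
  have hu : ∀ k, -(T.C * g k) ≤ (u ⊔ lo) k := fun k =>
    (neg_le_neg (mul_le_mul_of_nonneg_right hC (hfr.g_pos k).le)).trans
      (hoptL.neg_le hfr hreg hτ hτ1 hF hK₁ hK₂ hΛ hN1 hN2 hθ hdrop k)
  have hv : ∀ k, (v ⊓ hi) k ≤ T.C * g k := fun k => by
    have h1 := (neg_le_neg (mul_le_mul_of_nonneg_right hC' (hfr.g_pos k).le)).trans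
      (hoptU'.neg_le hfr.neg hreg.neg hτ hτ1 hF.neg hK₁ hK₂ hΛ hN2.neg hN1' hθ' hdrop' k)
    rw [← neg_inf, Pi.neg_apply] at h1
    linarith
  have hU0 : u ⊔ lo ≤ 0 := sup_le hoptL.nonpos hlo0
  have hV0 : 0 ≤ v ⊓ hi := le_inf (by simpa using hoptU.nonpos) hhi0
  have huD : ∀ k ∈ D, (u ⊔ lo) k ≤ -(T.η ^ T.J * g k) := fun k hk => by
    by_contra hcon
    push Not at hcon
    have hcorn : lowCorner lo g T.C ≤ u ⊔ lo :=
      sup_le hu le_sup_right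
    obtain ⟨j, hj, hsum⟩ := exists_sum_le_of_not_layerFail hfr hη hη1 (hlayer k hk) hcorn hU0
      hcon.le
    have hj1 : T.η ^ T.J ≤ T.η ^ j := pow_le_pow_of_le_one hη.le hη1 hj.le
    have hS0 : 0 ≤ 2 * Λ * (T.C + 1) ^ d * (2 * K₁ + T.K₂ + 1) := by positivity
    have := hoptL.le_neg_of_sum_le hfr hreg hτ hτ1 hF hΛ hN1 hC0 hu hk (hτη.trans hj1)
      (pow_le_one₀ hη.le hη1) hS (hS0.trans hS) hsum
    have h2 := mul_le_mul_of_nonneg_right hj1 (hfr.g_pos k).le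
    linarith
  have hcard : (T.η ^ T.J) ^ d / Λ ≤ w ^ 2 * (block N z (u ⊔ lo) (v ⊓ hi)).card ∧
      (block N z (u ⊔ lo) (v ⊓ hi)).Nonempty := by
    have hηJ : 0 < T.η ^ T.J := pow_pos hη _
    set c := T.η ^ T.J with hc
    have hc1 : c ≤ 1 := pow_le_one₀ hη.le hη1
    set u' : Fin d → ℝ := -corner D (fun k => c * g k) with hu'
    have hu'0 : u' ≤ 0 := neg_nonpos.2 (corner_nonneg fun k => mul_pos hηJ (hfr.g_pos k))
    have hu'le : ∀ k, u' k = if k ∈ D then -(c * g k) else 0 := fun k => by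
      simp only [hu', corner, Pi.neg_apply]; split_ifs <;> simp
    have hlou' : lo ≤ u' := hfr.lo_le.trans fun k => by
      rw [hu'le]
      simp only [corner, Pi.neg_apply]
      split_ifs
      · have := hfr.g_pos k; nlinarith
      · simp
    have hUu' : u ⊔ lo ≤ u' := fun k => by
      rw [hu'le]
      split_ifs with hk
      · exact huD k hk
      · exact hU0 k
    have hside : ∀ k ∈ D, τ * g k ≤ (0 : Fin d → ℝ) k - u' k := fun k hk => by
      rw [hu'le, if_pos hk, Pi.zero_apply, zero_sub, neg_neg]
      exact mul_le_mul_of_nonneg_right hτη (hfr.g_pos k).le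
    have hsub : block N z u' 0 ⊆ block N z (u ⊔ lo) (v ⊓ hi) := block_mono hUu' hV0
    refine ⟨?_, (hreg.card_pos hfr.g_pos hτ hlou' hu'0 le_rfl hhi0 hside).mono hsub⟩
    have h1 := hreg.lower u' 0 hlou' hu'0 le_rfl hhi0 hside
    have h2 : c ^ d ≤ ∏ k, relLen D g u' 0 k := by
      have : c ^ d = ∏ _k : Fin d, c := by simp
      rw [this]
      refine Finset.prod_le_prod (fun _ _ => hηJ.le) fun k _ => ?_
      have := (hfr.g_pos k).ne'
      simp only [relLen, hu'le]
      split_ifs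
      · rw [Pi.zero_apply, zero_sub, neg_neg, zero_add, mul_div_assoc, div_self this, mul_one]
      · simpa using hc1
    rw [div_le_iff₀ (by linarith)]
    have h3 : ((block N z u' 0).card : ℝ) ≤ (block N z (u ⊔ lo) (v ⊓ hi)).card := by
      exact_mod_cast Finset.card_le_card hsub
    have h4 : Λ * (w ^ 2 * (block N z u' 0).card)
        ≤ Λ * (w ^ 2 * (block N z (u ⊔ lo) (v ⊓ hi)).card) := by gcongr
    linarith
  have hfin := abs_mean_sq_sub_le_of_not_squareFail hε hw (by rwa [← hlam]) hu hv hcard.2 hcard.1 hEV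
  rw [← hreg.block_clip u v]
  set B := block N z (u ⊔ lo) (v ⊓ hi) with hB
  have hKw : 0 ≤ (K₁ + T.K₂) * w := by positivity
  have := abs_mean_sq_sub_le hcard.2 (e := e) (b := fun i => F (z i) - (mL + mU) / 2)
    (ε₁ := ε + (K₁ + T.K₂) * w) (by positivity) (fun i hi => ?_) hfin
  · refine le_of_eq_of_le ?_ this
    congr 3
    refine Finset.sum_congr rfl fun i _ => ?_
    ring
  · obtain ⟨h1, h2, h3⟩ := mem_block.1 hi
    have h4 := hcont _ (hreg.mem i h1) fun k => abs_le.2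
      ⟨(hu k).trans (h2 k), (h3 k).trans (hv k)⟩
    rw [abs_le] at h4 ⊢
    constructor <;> linarith [h4.1, h4.2]

end Combination

/-! ### Measurability of the unfavourable events -/

section Measurability

variable {𝒳 : Type*} [MeasurableSpace 𝒳] {d N : ℕ} {z : 𝒳 → ℕ → Fin d → ℝ} {e : 𝒳 → ℕ → ℝ}
  {lo g : Fin d → ℝ} {D : Finset (Fin d)} {w Λ : ℝ}

lemma measurableSet_mem_block (hz : ∀ i, Measurable fun a => z a i) (u v : Fin d → ℝ) (i : ℕ) :
    MeasurableSet {a | i ∈ block N (z a) u v} := by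
  simp only [mem_block]
  exact (MeasurableSet.const _).inter
    ((hz i measurableSet_Ici).inter (hz i measurableSet_Iic))

lemma block_subset_range {N : ℕ} {z : ℕ → Fin d → ℝ} {u v : Fin d → ℝ} :
    block N z u v ⊆ Finset.range N := fun _ hi =>
  Finset.mem_range.2 (mem_block.1 hi).1

lemma measurableSet_noiseFail (hz : ∀ i, Measurable fun a => z a i)
    (he : ∀ i, Measurable fun a => e a i) (m : ℕ) (K : ℝ) :
    MeasurableSet {a | NoiseFail m N (z a) (e a) g D w Λ K} := by
  simp only [NoiseFail]
  rw [Set.ofPred_exists]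
  exact MeasurableSet.iUnion fun a => measurableSet_maxDev (fun _ => block_subset_range)
    (measurableSet_mem_block hz _ _) (fun i k => (measurable_pi_apply k).comp (hz i)) he _

lemma measurable_sum_of_measurableSet_mem {I : 𝒳 → Finset ℕ} (hIN : ∀ a, I a ⊆ Finset.range N)
    (hI : ∀ i, MeasurableSet {a | i ∈ I a}) (he : ∀ i, Measurable fun a => e a i) :
    Measurable fun a => ∑ i ∈ I a, e a i := by
  classical
  have : (fun a => ∑ i ∈ I a, e a i)
      = fun a => ∑ i ∈ Finset.range N, if i ∈ I a then e a i else 0 := by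
    ext a
    rw [← Finset.sum_filter (· ∈ I a), Finset.filter_mem_eq_inter, Finset.inter_eq_right.2 (hIN a)]
  rw [this]
  exact Finset.measurable_fun_sum _ fun i _ => Measurable.ite (hI i) (he i) measurable_const

lemma measurableSet_mem_layer (hz : ∀ i, Measurable fun a => z a i) (C : ℝ) (k : Fin d)
    (c c' : ℝ) (i : ℕ) : MeasurableSet {a | i ∈ layer N (z a) lo g D C k c c'} := by
  simp only [layer, Finset.mem_filter]
  exact (measurableSet_mem_block hz _ _ i).inter
    (measurableSet_lt measurable_const ((measurable_pi_apply k).comp (hz i)))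

lemma measurableSet_layerFail (hz : ∀ i, Measurable fun a => z a i)
    (he : ∀ i, Measurable fun a => e a i) (J : ℕ) (C R R' η : ℝ) (k : Fin d) :
    MeasurableSet {a | LayerFail J N (z a) (e a) lo g D w C R R' η k} := by
  classical
  have hkey : ∀ i l, Measurable fun a => (-z a i) l := fun i l =>
    ((measurable_pi_apply l).comp (hz i)).neg
  have hsub : ∀ a c c', layer N (z a) lo g D C k c c' ⊆ Finset.range N := fun a c c' =>
    (Finset.filter_subset _ _).trans block_subset_range
  have hgood : ∀ c c', MeasurableSet {a | LayerGood N (z a) (e a) lo g D w C R R' k c c'} := by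
    intro c c'
    refine MeasurableSet.inter (s₁ := {a | ∑ i ∈ mainPart N (z a) lo g D C k c c', e a i
      ≤ -(R' * √c / w)}) (s₂ := {a | ¬ MaxDev (sidePart N (z a) lo g D C k c c')
        (fun i => -z a i) (e a) (R * √c / w)}) ?_ ?_
    · refine measurableSet_le (measurable_sum_of_measurableSet_mem (N := N)
        (fun a => (Finset.filter_subset _ _).trans (hsub a c c')) (fun i => ?_) he)
        measurable_const
      simp only [mainPart, Finset.mem_filter]
      exact (measurableSet_mem_layer hz C k c c' i).inter (hz i measurableSet_Ici)
    · refine (measurableSet_maxDev (N := N) (fun a => (Finset.filter_subset _ _).trans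
        (hsub a c c')) (fun i => ?_) hkey he _).compl
      simp only [Finset.mem_filter]
      exact (measurableSet_mem_layer hz C k c c' i).inter (hz i measurableSet_Ici).compl
  refine MeasurableSet.union (s₁ := {a | ∀ j < J, ¬ LayerGood N (z a) (e a) lo g D w C R R' k
      (η ^ j) (η ^ (j + 1))}) (s₂ := {a | ∃ j < J, MaxDev (innerPart N (z a) lo g D C k
        (η ^ (j + 1)) (η ^ J)) (fun i => -z a i) (e a) (√(η ^ j) / w)}) ?_ ?_
  · simp only [Set.ofPred_forall]
    exact MeasurableSet.iInter fun j => MeasurableSet.iInter fun _ => (hgood _ _).compl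
  · simp only [Set.ofPred_exists, Set.ofPred_and]
    exact MeasurableSet.iUnion fun j => (MeasurableSet.const _).inter
      (measurableSet_maxDev (fun _ => block_subset_range) (measurableSet_mem_block hz _ _)
        hkey he _)

lemma measurableSet_squareFail (hz : ∀ i, Measurable fun a => z a i)
    (he : ∀ i, Measurable fun a => e a i) (C M E lam : ℝ) :
    MeasurableSet {a | SquareFail N (z a) (e a) g C M E lam} := by
  have hs : ∀ i, Measurable fun a => sqTrunc M (e a i) := fun i =>
    (measurable_sqTrunc M).comp (he i)
  refine MeasurableSet.union (s₁ := {a | MaxDev (centredBox N (z a) g C) (doubleKey (z a))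
    (fun i => sqTrunc M (e a i) - E) lam}) (s₂ := {a | lam < ∑ i ∈ centredBox N (z a) g C,
      (e a i ^ 2 - sqTrunc M (e a i))}) ?_ ?_
  · refine measurableSet_maxDev (fun _ => block_subset_range) (measurableSet_mem_block hz _ _)
      (fun i k => ?_) (fun i => (hs i).sub_const E) _
    rcases k with k | k
    · exact ((measurable_pi_apply k).comp (hz i)).neg
    · exact (measurable_pi_apply k).comp (hz i)
  · exact measurableSet_lt measurable_const (measurable_sum_of_measurableSet_mem
      (fun _ => block_subset_range) (measurableSet_mem_block hz _ _)
      (fun i => ((he i).pow_const 2).sub (hs i)))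

lemma measurableSet_errorsFail (T : Tuning) (m : ℕ) (hz : ∀ i, Measurable fun a => z a i)
    (he : ∀ i, Measurable fun a => e a i) :
    MeasurableSet {a | ErrorsFail T m N lo g D w Λ (z a) (e a)} := by
  refine MeasurableSet.union (s₁ := {a | NoiseFail m N (z a) (e a) g D w Λ T.K₂ ∨
      NoiseFail m N (fun i => -z a i) (e a) g D w Λ T.K₂})
    (s₂ := {a | (∃ k ∈ D, LayerFail T.J N (z a) (e a) lo g D w T.C T.R T.R' T.η k) ∨
      SquareFail N (z a) (e a) g T.C T.M T.E T.lam}) ?_ ?_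
  · exact (measurableSet_noiseFail hz he m _).union
      (measurableSet_noiseFail (fun i => (hz i).neg) he m _)
  · refine MeasurableSet.union (s₁ := {a | ∃ k ∈ D, LayerFail T.J N (z a) (e a) lo g D w T.C T.R
      T.R' T.η k}) ?_ (measurableSet_squareFail hz he _ _ _ _)
    simp only [Set.ofPred_exists, Set.ofPred_and]
    exact MeasurableSet.iUnion fun k => (MeasurableSet.const _).inter
      (measurableSet_layerFail hz he _ _ _ _ _ _)

end Measurability

/-! ### Conditioning on the design -/

lemma measure_pair_mem_le {Ω 𝒳 ℰ : Type*} [MeasurableSpace Ω] [MeasurableSpace 𝒳]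
    [MeasurableSpace ℰ] {P : Measure Ω} [IsProbabilityMeasure P] {X : Ω → 𝒳} {ξ : Ω → ℰ}
    (hX : Measurable X) (hξ : Measurable ξ) (hind : IndepFun X ξ P) {G : Set (𝒳 × ℰ)}
    (hG : MeasurableSet G) {S : Set 𝒳} {δ : ℝ} (hδ : 0 ≤ δ)
    (hS : ∀ x ∈ S, P.real {ω | (x, ξ ω) ∈ G} ≤ δ) :
    P.real {ω | (X ω, ξ ω) ∈ G} ≤ P.real {ω | X ω ∉ S} + δ := by
  have := Measure.isProbabilityMeasure_map (μ := P) hX.aemeasurable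
  have := Measure.isProbabilityMeasure_map (μ := P) hξ.aemeasurable
  have hsec : ∀ x, P.map ξ (Prod.mk x ⁻¹' G) = P {ω | (x, ξ ω) ∈ G} := fun x =>
    Measure.map_apply hξ (measurable_prodMk_left hG)
  have hmeas : Measurable fun x => P.map ξ (Prod.mk x ⁻¹' G) := measurable_measure_prodMk_left hG
  set B : Set 𝒳 := {x | ENNReal.ofReal δ < P.map ξ (Prod.mk x ⁻¹' G)} with hB
  have hBm : MeasurableSet B := measurableSet_lt measurable_const hmeas
  have hBS : B ⊆ Sᶜ := fun x hx hxS => by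
    have h1 := hS x hxS
    rw [hB, Set.mem_ofPred_eq, hsec, ← ENNReal.ofReal_toReal (measure_ne_top P _)] at hx
    exact absurd (ENNReal.ofReal_le_ofReal h1) (not_le.2 hx)
  have hkey : P {ω | (X ω, ξ ω) ∈ G} ≤ P {ω | X ω ∉ S} + ENNReal.ofReal δ := by
    have h1 : P {ω | (X ω, ξ ω) ∈ G} = ((P.map X).prod (P.map ξ)) G := by
      rw [← (indepFun_iff_map_prod_eq_prod_map_map hX.aemeasurable hξ.aemeasurable).1 hind,
        Measure.map_apply (hX.prodMk hξ) hG]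
      rfl
    rw [h1, Measure.prod_apply hG]
    calc ∫⁻ x, P.map ξ (Prod.mk x ⁻¹' G) ∂P.map X
        ≤ ∫⁻ x, (B.indicator 1 x + ENNReal.ofReal δ) ∂P.map X := by
          refine lintegral_mono fun x => ?_
          by_cases hx : x ∈ B
          · rw [Set.indicator_of_mem hx, Pi.one_apply]
            exact prob_le_one.trans le_self_add
          · rw [Set.indicator_of_notMem hx, zero_add]
            exact not_lt.1 hx
      _ = P.map X B + ENNReal.ofReal δ := by
          rw [lintegral_add_right _ measurable_const, lintegral_indicator_one hBm]
          simp
      _ ≤ _ := by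
          rw [Measure.map_apply hX hBm]
          gcongr
          exact fun ω hω => hBS hω
  have h2 := ENNReal.toReal_mono (by finiteness) hkey
  rwa [ENNReal.toReal_add (by finiteness) (by finiteness), ENNReal.toReal_ofReal hδ] at h2

section Consistency

variable {Ω : Type*} [MeasurableSpace Ω] {P : Measure Ω} {d : ℕ}

/-! ### Consistency of the local variance estimator for regular designs -/

/-- The designs are regular at scales `g n` and `w n → 0`, with probability tending to one. -/
structure RegularDesigns (P : Measure Ω) (N : ℕ → ℕ) (z : ℕ → ℕ → Ω → Fin d → ℝ)
    (lo hi : Fin d → ℝ) (D : Finset (Fin d)) (g : ℕ → Fin d → ℝ) (w : ℕ → ℝ) (Λ : ℝ) : Prop where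
  one_le : 1 ≤ Λ
  tendsto : Tendsto w atTop (𝓝 0)
  frame : ∀ᶠ n in atTop, Frame lo hi (g n) D (w n)
  regular : ∀ τ, 0 < τ → τ ≤ 1 → Tendsto (fun n => P.real {ω |
    ¬ Regular (N n) (fun i => z n i ω) lo hi (g n) D (w n) Λ τ}) atTop (𝓝 0)

/-- The signal fits the scales `g n` and `w n`. -/
structure SignalScales (F : (Fin d → ℝ) → ℝ) (lo hi : Fin d → ℝ) (D : Finset (Fin d))
    (g : ℕ → Fin d → ℝ) (w : ℕ → ℝ) (K₁ : ℝ) : Prop where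
  nonneg : 0 ≤ K₁
  bounds : ∀ᶠ n in atTop, SignalBounds F lo hi (g n) D (w n) K₁
  drop : ∀ K, ∃ θ, 0 ≤ θ ∧ ∀ᶠ n in atTop, SignalDrop F lo hi (g n) D (w n) K θ
  drop_neg : ∀ K, ∃ θ, 0 ≤ θ ∧
    ∀ᶠ n in atTop, SignalDrop (fun x => -F (-x)) (-hi) (-lo) (g n) D (w n) K θ
  cont : ∀ C ε, 0 < ε → ∀ᶠ n in atTop, ∀ x ∈ Set.Icc lo hi, (∀ k, |x k| ≤ C * g n k) →
    |F x - F 0| ≤ ε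

lemma exists_two_pow_gt (hi g : Fin d → ℝ) : ∃ m : ℕ, ∀ k, 1 + hi k / g k < 2 ^ m := by
  have h : ∀ᶠ m : ℕ in atTop, ∀ k, 1 + hi k / g k < 2 ^ m :=
    eventually_all.2 fun k =>
      (tendsto_pow_atTop_atTop_of_one_lt (one_lt_two : (1 : ℝ) < 2)).eventually_gt_atTop _
  exact h.exists

variable [IsProbabilityMeasure P]

/-- Errors are favourable with high probability, for a suitable tuning. -/
lemma prob_errorsFail_le {N : ℕ} {z : ℕ → Fin d → ℝ} {lo hi g : Fin d → ℝ} {D : Finset (Fin d)}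
    {w Λ τ : ℝ} {ξ : ℕ → Ω → ℝ} (hmeas : ∀ i, Measurable (ξ i)) (hind : iIndepFun ξ P)
    (hid : ∀ i, IdentDistrib (ξ i) (ξ 0) P P) (hL : MemLp (ξ 0) 2 P) {V : ℝ}
    (hV : ∫ ω, ξ 0 ω ^ 2 ∂P = V) (hcent : CentredErrors P ξ V) (hfr : Frame lo hi g D w)
    (hreg : Regular N z lo hi g D w Λ τ) (hτ1 : τ ≤ 1) (hΛ : 1 ≤ Λ) {T : Tuning} (m : ℕ)
    (hK₂ : 0 < T.K₂) (hC : 1 ≤ T.C) (hR : 0 < T.R) (hR' : 0 ≤ T.R')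
    (hR2 : 2 * 4 ^ d * V * Λ * (T.C + 1) ^ d ≤ T.R ^ 2) (hη : 0 < T.η)
    (hη1 : 2 * Λ ^ 2 * T.η ≤ 1) (hτ : τ ≤ T.η ^ T.J) {p : ℝ} (hp0 : 0 ≤ p) (hp1 : p ≤ 1) {n₀ : ℕ}
    (hp : ∀ I : Finset ℕ, n₀ ≤ I.card →
      p ≤ P.real {ω | ∑ i ∈ I, ξ i ω ≤ -(T.R' * √(2 * Λ) * √I.card)})
    (hn₀ : n₀ ≤ T.η ^ T.J / (2 * Λ * w ^ 2)) (hM : 0 ≤ T.M)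
    (hE : T.E = ∫ ω, sqTrunc T.M (ξ 0 ω) ∂P) {κ : ℝ} (hκ : 0 < κ) (hlam : T.lam = κ / w ^ 2) :
    P.real {ω | ErrorsFail T m N lo g D w Λ z (fun i => ξ i ω)}
      ≤ 2 * (16 ^ d * V * Λ ^ 3 / T.K₂ ^ 2)
        + d * ((1 - p / 2) ^ T.J + T.J * (4 ^ d * V * Λ * (T.C + 1) ^ d * (2 * T.η)))
        + (16 ^ d * T.M ^ 2 * (Λ * (2 * T.C + 1) ^ d) / κ ^ 2 * w ^ 2
          + Λ * (2 * T.C + 1) ^ d / κ * (V - T.E)) := by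
  have hVn := hcent.variance_nonneg
  have hset : {ω | ErrorsFail T m N lo g D w Λ z (fun i => ξ i ω)}
      = (({ω | NoiseFail m N z (fun i => ξ i ω) g D w Λ T.K₂}
        ∪ {ω | NoiseFail m N (fun i => -z i) (fun i => ξ i ω) g D w Λ T.K₂})
        ∪ ⋃ k ∈ D, {ω | LayerFail T.J N z (fun i => ξ i ω) lo g D w T.C T.R T.R' T.η k})
        ∪ {ω | SquareFail N z (fun i => ξ i ω) g T.C T.M T.E T.lam} := by
    ext ω; simp [ErrorsFail, or_assoc]
  rw [hset]
  refine (measureReal_union_le _ _).trans (add_le_add ((measureReal_union_le _ _).trans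
    (add_le_add ((measureReal_union_le _ _).trans ?_) ?_)) ?_)
  · rw [two_mul]
    exact add_le_add (hcent.prob_noiseFail_le hfr hreg hτ1 hΛ m hK₂)
      (hcent.prob_noiseFail_le hfr.neg hreg.neg hτ1 hΛ m hK₂)
  · refine (measureReal_biUnion_finset_le _ _).trans ?_
    refine (Finset.sum_le_sum fun k hk => hcent.prob_layerFail_le hfr hreg hτ1 hΛ (by linarith)
      hR hR' hR2 hk hη hη1 hτ hp0 hp1 hp hn₀).trans ?_
    rw [Finset.sum_const, nsmul_eq_mul]
    refine mul_le_mul_of_nonneg_right ?_ ?_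
    · exact_mod_cast (Finset.card_le_univ D).trans_eq (Fintype.card_fin d)
    · have : 0 ≤ 1 - p / 2 := by linarith
      have : 0 ≤ T.C := by linarith
      positivity
  · have := prob_squareFail_le hmeas hind hid hL hfr hreg hτ1 hΛ hC hM hκ
    rwa [← hE, hV, ← hlam] at this

/-- Parameters making the bound of `prob_errorsFail_le` small. -/
lemma exists_tuning {ξ : ℕ → Ω → ℝ} (hmeas : ∀ i, Measurable (ξ i)) (hind : iIndepFun ξ P)
    (hid : ∀ i, IdentDistrib (ξ i) (ξ 0) P P) (hL : MemLp (ξ 0) 2 P) (h0 : ∫ ω, ξ 0 ω ∂P = 0)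
    {V : ℝ} (hV0 : 0 < V) (hV : ∫ ω, ξ 0 ω ^ 2 ∂P = V) {Λ K₁ K₂ C ε δ : ℝ} (hΛ : 1 ≤ Λ)
    (hK₁ : 0 ≤ K₁) (hK₂ : 0 ≤ K₂) (hC : 1 ≤ C) (hε : 0 < ε) (hδ : 0 < δ) :
    ∃ R R' p η M : ℝ, ∃ J n₀ : ℕ, 0 < R ∧ 0 ≤ R' ∧ 2 * 4 ^ d * V * Λ * (C + 1) ^ d ≤ R ^ 2 ∧
      2 * Λ * (C + 1) ^ d * (2 * K₁ + K₂ + 1) ≤ R' - R - 1 ∧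
      0 < η ∧ 2 * Λ ^ 2 * η ≤ 1 ∧ 0 ≤ p ∧ p ≤ 1 ∧
      (∀ I : Finset ℕ, n₀ ≤ I.card →
        p ≤ P.real {ω | ∑ i ∈ I, ξ i ω ≤ -(R' * √(2 * Λ) * √I.card)}) ∧ 0 ≤ M ∧
      (d * ((1 - p / 2) ^ J + J * (4 ^ d * V * Λ * (C + 1) ^ d * (2 * η))) ≤ 2 * δ) ∧
      Λ * (2 * C + 1) ^ d / (ε * ((η ^ J) ^ d / Λ)) * (V - ∫ ω, sqTrunc M (ξ 0 ω) ∂P) ≤ δ ∧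
      V - ∫ ω, sqTrunc M (ξ 0 ω) ∂P ≤ ε := by
  have hC0 : 0 ≤ C := by linarith
  set b := 2 * 4 ^ d * V * Λ * (C + 1) ^ d with hb
  have hb0 : 0 ≤ b := by positivity
  set S := 2 * Λ * (C + 1) ^ d * (2 * K₁ + K₂ + 1) with hS
  have hS0 : 0 ≤ S := by positivity
  obtain ⟨p, hp0, hp1, n₀, hp⟩ := exists_prob_sum_le hmeas hind hid hL h0 (by rwa [hV])
    ((b + 1 + 1 + S) * √(2 * Λ))
  have hJ : ∃ J : ℕ, d * (1 - p / 2) ^ J ≤ δ := by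
    have h1 : Tendsto (fun J : ℕ => (d : ℝ) * (1 - p / 2) ^ J) atTop (𝓝 (d * 0)) :=
      (tendsto_pow_atTop_nhds_zero_of_lt_one (by linarith) (by linarith)).const_mul _
    rw [mul_zero] at h1
    exact (h1.eventually_le_const hδ).exists
  obtain ⟨J, hJ⟩ := hJ
  have hη : ∃ η : ℝ, 0 < η ∧ 2 * Λ ^ 2 * η ≤ 1 ∧
      d * (J * (4 ^ d * V * Λ * (C + 1) ^ d * (2 * η))) ≤ δ := by
    have h1 : Tendsto (fun η : ℝ => 2 * Λ ^ 2 * η) (𝓝[>] 0) (𝓝 (2 * Λ ^ 2 * 0)) :=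
      (tendsto_id.mono_left nhdsWithin_le_nhds).const_mul _
    have h2 : Tendsto (fun η : ℝ => d * (J * (4 ^ d * V * Λ * (C + 1) ^ d * (2 * η)))) (𝓝[>] 0)
        (𝓝 (d * (J * (4 ^ d * V * Λ * (C + 1) ^ d * (2 * 0))))) :=
      ((((tendsto_id.mono_left nhdsWithin_le_nhds).const_mul _).const_mul _).const_mul _).const_mul _
    rw [mul_zero] at h1
    simp only [mul_zero] at h2
    obtain ⟨η, h3, h4, h5⟩ := (eventually_mem_nhdsWithin.and ((h1.eventually_le_const one_pos).and
      (h2.eventually_le_const hδ))).exists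
    exact ⟨η, h3, h4, h5⟩
  obtain ⟨η, hη0, hη1, hη2⟩ := hη
  have hM : ∃ M : ℝ, 0 ≤ M ∧
      Λ * (2 * C + 1) ^ d / (ε * ((η ^ J) ^ d / Λ)) * (V - ∫ ω, sqTrunc M (ξ 0 ω) ∂P) ≤ δ ∧
      V - ∫ ω, sqTrunc M (ξ 0 ω) ∂P ≤ ε := by
    have h1 := (tendsto_integral_sqTrunc hL).const_sub V
    rw [hV, sub_self] at h1
    have h2 := h1.const_mul (Λ * (2 * C + 1) ^ d / (ε * ((η ^ J) ^ d / Λ)))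
    rw [mul_zero] at h2
    exact ((eventually_ge_atTop 0).and ((h2.eventually_le_const hδ).and
      (h1.eventually_le_const hε))).exists
  obtain ⟨M, hM0, hM1, hM2⟩ := hM
  refine ⟨b + 1, b + 1 + 1 + S, p, η, M, J, n₀, by positivity, by positivity, by nlinarith,
    by linarith, hη0, hη1, hp0.le, hp1, hp, hM0, ?_, hM1, hM2⟩
  rw [mul_add]
  linarith

theorem tendstoInMeasure_of_regularDesigns {N : ℕ → ℕ} {z : ℕ → ℕ → Ω → Fin d → ℝ}
    {lo hi : Fin d → ℝ} {D : Finset (Fin d)} {g : ℕ → Fin d → ℝ} {w : ℕ → ℝ} {Λ K₁ : ℝ}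
    {F : (Fin d → ℝ) → ℝ} {ξ : ℕ → Ω → ℝ} (hmeas : ∀ i, Measurable (ξ i)) (hind : iIndepFun ξ P)
    (hid : ∀ i, IdentDistrib (ξ i) (ξ 0) P P) (hL : MemLp (ξ 0) 2 P) (h0 : ∫ ω, ξ 0 ω ∂P = 0)
    {V : ℝ} (hV0 : 0 < V) (hV : ∫ ω, ξ 0 ω ^ 2 ∂P = V)
    (hz : ∀ n i, Measurable (z n i))
    (hzξ : ∀ n, IndepFun (fun ω i => z n i ω) (fun ω i => ξ i ω) P)
    (hdes : RegularDesigns P N z lo hi D g w Λ) (hsig : SignalScales F lo hi D g w K₁)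
    {u v : ℕ → Ω → Fin d → ℝ} {mL mU : ℕ → Ω → ℝ}
    (hopt : ∀ n, 1 ≤ n → ∀ᵐ ω ∂P,
      LowerOpt (N n) (fun i => z n i ω) (fun i => F (z n i ω) + ξ i ω) (u n ω) (mL n ω) ∧
      LowerOpt (N n) (fun i => -z n i ω) (fun i => -(F (z n i ω) + ξ i ω)) (-v n ω) (-mU n ω)) :
    TendstoInMeasure P (fun n ω =>
      (∑ i ∈ block (N n) (fun i => z n i ω) (u n ω) (v n ω),
        (F (z n i ω) + ξ i ω - (mL n ω + mU n ω) / 2) ^ 2)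
          / ((block (N n) (fun i => z n i ω) (u n ω) (v n ω)).card : ℝ)) atTop (fun _ => V) := by
  have hid' : ∀ i, MemLp (ξ i) 2 P := fun i => (hid i).symm.memLp_iff.1 hL
  have hcent : CentredErrors P ξ V := ⟨hmeas, hind, hid', fun i => (hid i).integral_eq.trans h0,
    fun i => by
      have := ((hid i).comp (u := fun x => x ^ 2) (by fun_prop)).integral_eq
      simp only [Function.comp_def] at this
      rw [this, hV]⟩
  have hΛ := hdes.one_le
  have hK₁ := hsig.nonneg
  rw [tendstoInMeasure_iff_measureReal_dist]
  intro ε₀ hε₀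
  refine tendsto_order.2 ⟨fun a ha => Eventually.of_forall fun n => ha.trans_le measureReal_nonneg,
    fun a ha => ?_⟩
  obtain ⟨δ, hδ, hδa⟩ : ∃ δ : ℝ, 0 < δ ∧ 7 * δ < a := ⟨a / 8, by linarith, by linarith⟩
  obtain ⟨ε, hε, hεε₀⟩ : ∃ ε : ℝ, 0 < ε ∧
      (2 * ε + ε) + 2 * ε * (1 + V + (2 * ε + ε)) + (2 * ε) ^ 2 < ε₀ := by
    have h1 : ContinuousAt (fun ε : ℝ => (2 * ε + ε) + 2 * ε * (1 + V + (2 * ε + ε)) + (2 * ε) ^ 2)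
        0 := by fun_prop
    have h2 := h1.tendsto.mono_left (nhdsWithin_le_nhds (s := Set.Ioi 0))
    simp only [mul_zero, add_zero, zero_mul, ne_eq, OfNat.ofNat_ne_zero, not_false_eq_true,
      zero_pow] at h2
    obtain ⟨ε, h3, h4⟩ := (eventually_mem_nhdsWithin.and (h2.eventually_lt_const hε₀)).exists
    exact ⟨ε, h3, h4⟩
  obtain ⟨K₂, hK₂, hK₂δ⟩ : ∃ K₂ : ℝ, 0 < K₂ ∧ 2 * (16 ^ d * V * Λ ^ 3 / K₂ ^ 2) ≤ δ := by
    set a₀ := 16 ^ d * V * Λ ^ 3 with ha₀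
    have h1 : Tendsto (fun K : ℝ => 2 * (a₀ / K ^ 2)) atTop (𝓝 (2 * 0)) :=
      (tendsto_const_nhds.div_atTop (tendsto_pow_atTop two_ne_zero)).const_mul 2
    rw [mul_zero] at h1
    exact ((eventually_gt_atTop 0).and (h1.eventually_le_const hδ)).exists
  obtain ⟨θ, hθ, hdrop⟩ := hsig.drop (4 * (K₁ + K₂) + 1)
  obtain ⟨θ', hθ', hdrop'⟩ := hsig.drop_neg (4 * (K₁ + K₂) + 1)
  obtain ⟨C, hC, hC', hC1⟩ : ∃ C : ℝ, 2 * Λ ^ 2 * (1 + θ) ≤ C ∧ 2 * Λ ^ 2 * (1 + θ') ≤ C ∧ 1 ≤ C :=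
    ⟨max (max (2 * Λ ^ 2 * (1 + θ)) (2 * Λ ^ 2 * (1 + θ'))) 1,
      (le_max_left _ _).trans (le_max_left _ _), (le_max_right _ _).trans (le_max_left _ _),
      le_max_right _ _⟩
  obtain ⟨R, R', p, η, M, J, n₀, hR, hR', hR2, hS, hη, hη1, hp0, hp1, hp, hM, hb1, hb2, hVE⟩ :=
    exists_tuning (d := d) hmeas hind hid hL h0 hV0 hV hΛ hK₁ hK₂.le hC1 hε hδ
  have hη1' : η ≤ 1 := by
    have : 1 ≤ Λ ^ 2 := one_le_pow₀ hΛ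
    nlinarith
  have hτ : 0 < η ^ J := pow_pos hη J
  have hτ1 : η ^ J ≤ 1 := pow_le_one₀ hη.le hη1'
  set E := ∫ ω, sqTrunc M (ξ 0 ω) ∂P with hE
  have hEV : E ≤ V := by
    rw [← hV]
    exact integral_mono (integrable_sqTrunc hL M) hL.integrable_sq fun ω => sqTrunc_le_sq _ _
  set κ := ε * ((η ^ J) ^ d / Λ) with hκdef
  have hκ : 0 < κ := by have : 0 < Λ := by linarith
                        positivity
  have hwpos : ∀ᶠ n in atTop, 0 < w n := hdes.frame.mono fun n h => h.w_pos
  have hw1 : ∀ᶠ n in atTop, 16 ^ d * M ^ 2 * (Λ * (2 * C + 1) ^ d) / κ ^ 2 * w n ^ 2 ≤ δ := by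
    have := (hdes.tendsto.pow 2).const_mul (16 ^ d * M ^ 2 * (Λ * (2 * C + 1) ^ d) / κ ^ 2)
    simp only [ne_eq, OfNat.ofNat_ne_zero, not_false_eq_true, zero_pow, mul_zero] at this
    exact this.eventually_le_const hδ
  have hw2 : ∀ᶠ n in atTop, (K₁ + K₂) * w n ≤ ε := by
    have := hdes.tendsto.const_mul (K₁ + K₂)
    rw [mul_zero] at this
    exact this.eventually_le_const hε
  have hw3 : ∀ᶠ n in atTop, (n₀ : ℝ) * (2 * Λ * w n ^ 2) ≤ η ^ J := by
    have := ((hdes.tendsto.pow 2).const_mul (2 * Λ)).const_mul (n₀ : ℝ)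
    simp only [ne_eq, OfNat.ofNat_ne_zero, not_false_eq_true, zero_pow, mul_zero] at this
    exact this.eventually_le_const hτ
  filter_upwards [eventually_ge_atTop 1, hdes.frame, hsig.bounds, hdrop, hdrop',
    hsig.cont C ε hε, hw1, hw2, hw3, (hdes.regular _ hτ hτ1).eventually_le_const hδ]
    with n hn hfr hF hd hd' hcont hw1 hw2 hw3 hreg
  have hwn := hfr.w_pos
  obtain ⟨m₁, hm₁⟩ := exists_two_pow_gt hi (g n)
  obtain ⟨m₂, hm₂⟩ := exists_two_pow_gt (-lo) (g n)
  set m := max m₁ m₂ with hm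
  have hma : ∀ k, 1 + hi k / g n k < 2 ^ m := fun k =>
    (hm₁ k).trans_le (pow_le_pow_right₀ one_le_two (le_max_left _ _))
  have hmb : ∀ k, 1 + -lo k / g n k < 2 ^ m := fun k =>
    (hm₂ k).trans_le (pow_le_pow_right₀ one_le_two (le_max_right _ _))
  set T : Tuning := ⟨K₂, C, R, R', η, M, E, κ / w n ^ 2, J⟩ with hT
  set S : Set (ℕ → Fin d → ℝ) := {x | Regular (N n) x lo hi (g n) D (w n) Λ (η ^ J)} with hS'
  set G : Set ((ℕ → Fin d → ℝ) × (ℕ → ℝ)) :=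
    {q | ErrorsFail T m (N n) lo (g n) D (w n) Λ q.1 q.2} with hG
  have hGm : MeasurableSet G := measurableSet_errorsFail T m
    (fun i => (measurable_pi_apply i).comp measurable_fst)
    (fun i => (measurable_pi_apply i).comp measurable_snd)
  have hprob := measure_pair_mem_le (P := P) (X := fun ω i => z n i ω) (ξ := fun ω i => ξ i ω)
    (measurable_pi_lambda _ fun i => hz n i) (measurable_pi_lambda _ hmeas) (hzξ n) hGm (S := S)
    (δ := 5 * δ) (by linarith) (fun x hx => by
      have := prob_errorsFail_le hmeas hind hid hL hV hcent hfr (hx : Regular _ _ _ _ _ _ _ _ _)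
        hτ1 hΛ (T := T) m hK₂ hC1 hR hR' hR2 hη hη1 le_rfl hp0 hp1 hp
        (by rw [le_div_iff₀ (by have : 0 < Λ := by linarith
                                positivity)]; exact hw3) hM hE hκ rfl
      refine this.trans ?_
      simp only [hT]
      linarith)
  have hsub : P.real {ω | ε₀ ≤ dist ((∑ i ∈ block (N n) (fun i => z n i ω) (u n ω) (v n ω),
        (F (z n i ω) + ξ i ω - (mL n ω + mU n ω) / 2) ^ 2)
          / ((block (N n) (fun i => z n i ω) (u n ω) (v n ω)).card : ℝ)) V}
      ≤ P.real ({ω | (fun i => z n i ω) ∉ S} ∪ {ω | ((fun i => z n i ω), fun i => ξ i ω) ∈ G}) := by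
    refine ENNReal.toReal_mono (measure_ne_top _ _) (measure_mono_ae ?_)
    filter_upwards [hopt n hn] with ω hω hbad
    by_contra hcon
    have hcon' : (fun i => z n i ω) ∈ S ∧ ((fun i => z n i ω), fun i => ξ i ω) ∉ G := by
      constructor
      · by_contra h; exact hcon (Or.inl h)
      · intro h; exact hcon (Or.inr h)
    have hbad : ε₀ ≤ dist _ _ := hbad
    have hreg : Regular (N n) (fun i => z n i ω) lo hi (g n) D (w n) Λ (η ^ J) := hcon'.1
    have := abs_mean_sq_sub_le_of_not_errorsFail (T := T) (m := m) (ε := ε) (V := V) hω.1 hω.2 hfr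
      hreg hτ hτ1 hΛ hF hK₁ hK₂.le hθ hθ' hd hd' hC hC' hma hmb hS hη hη1' le_rfl hε.le rfl hEV
      hcont hcon'.2
    rw [Real.dist_eq] at hbad
    have h2 : V - T.E ≤ ε := hVE
    have h3 : 0 ≤ V - T.E := sub_nonneg.2 hEV
    have h4 : (K₁ + T.K₂) * w n ≤ ε := hw2
    have h5 : 0 ≤ (K₁ + T.K₂) * w n := mul_nonneg (add_nonneg hK₁ hK₂.le) hwn.le
    have h6 : (2 * ε + (V - T.E)) + (ε + (K₁ + T.K₂) * w n) * (1 + V + (2 * ε + (V - T.E)))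
        + (ε + (K₁ + T.K₂) * w n) ^ 2
        ≤ (2 * ε + ε) + (ε + ε) * (1 + V + (2 * ε + ε)) + (ε + ε) ^ 2 := by gcongr
    rw [← two_mul ε] at h6
    linarith
  have hU := measureReal_union_le (μ := P) {ω | (fun i => z n i ω) ∉ S}
    {ω | ((fun i => z n i ω), fun i => ξ i ω) ∈ G}
  have hreg' : P.real {ω | (fun i => z n i ω) ∉ S} ≤ δ := hreg
  linarith

end Consistency

section Estimators

/-! ### The block estimators -/

variable {d N : ℕ} {x₀ : Fin d → ℝ} {x : ℕ → Fin d → ℝ} {y : ℕ → ℝ} {u v : Fin d → ℝ}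

lemma block_sub (u v : Fin d → ℝ) :
    block N (fun i => x i - x₀) u v = block N x (u + x₀) (v + x₀) := by
  ext i; rw [mem_block, mem_block, le_sub_iff_add_le, sub_le_iff_le_add]

/-- The possible averages over sets of observations. -/
lemma finite_means (N : ℕ) (y : ℕ → ℝ) :
    {a | ∃ s ⊆ Finset.range N, a = (∑ i ∈ s, y i) / (s.card : ℝ)}.Finite := by
  refine ((Finset.range N).powerset.finite_toSet.image
    fun s => (∑ i ∈ s, y i) / (s.card : ℝ)).subset ?_
  rintro a ⟨s, hs, rfl⟩
  exact ⟨s, Finset.mem_coe.2 (Finset.mem_powerset.2 hs), rfl⟩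

lemma lowerValues_subset (u : Fin d → ℝ) :
    {a | ∃ v, x₀ ≤ v ∧ (block N x u v).Nonempty ∧ a = blockMean N x y u v} ⊆
      {a | ∃ s ⊆ Finset.range N, a = (∑ i ∈ s, y i) / (s.card : ℝ)} := by
  rintro a ⟨v, -, -, rfl⟩
  exact ⟨_, block_subset_range, rfl⟩

lemma lowerMin_le (hv : x₀ ≤ v) (hne : (block N x u v).Nonempty) :
    lowerMin x₀ N x y u ≤ blockMean N x y u v :=
  csInf_le ((finite_means N y).subset (lowerValues_subset u)).bddBelow ⟨v, hv, hne, rfl⟩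

lemma exists_lowerMin_eq (h : LowerAdmissible x₀ N x u) :
    ∃ v, x₀ ≤ v ∧ (block N x u v).Nonempty ∧ lowerMin x₀ N x y u = blockMean N x y u v := by
  obtain ⟨-, v, hv, hne⟩ := h
  have hS : {a | ∃ v, x₀ ≤ v ∧ (block N x u v).Nonempty ∧ a = blockMean N x y u v}.Nonempty :=
    ⟨_, v, hv, hne, rfl⟩
  exact hS.csInf_mem ((finite_means N y).subset (lowerValues_subset u))

lemma lowerMin_le_maxMinEst (h : LowerAdmissible x₀ N x u) :
    lowerMin x₀ N x y u ≤ maxMinEst x₀ N x y := by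
  refine le_csSup (Set.Finite.bddAbove ((finite_means N y).subset ?_)) ⟨u, h, rfl⟩
  rintro a ⟨u', hu', rfl⟩
  obtain ⟨v, hv, hne, heq⟩ := exists_lowerMin_eq (y := y) hu'
  exact ⟨_, block_subset_range, heq⟩

/-- The properties of an outer maximiser of the max-min formula, in centred coordinates. -/
lemma lowerOpt_of_lowerMin_eq (hu : LowerAdmissible x₀ N x u)
    (h : lowerMin x₀ N x y u = maxMinEst x₀ N x y) :
    LowerOpt N (fun i => x i - x₀) y (u - x₀) (maxMinEst x₀ N x y) where
  nonpos := sub_nonpos.2 hu.1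
  le_mean := fun v hv hne => by
    rw [block_sub, sub_add_cancel] at hne ⊢
    have hpos : (0 : ℝ) < (block N x u (v + x₀)).card := by exact_mod_cast hne.card_pos
    have := lowerMin_le (y := y) (le_add_of_nonneg_left hv) hne
    rwa [h, blockMean, le_div_iff₀ hpos] at this
  mean_le := fun u' v' hu' hv' hne => by
    rw [block_sub] at hne
    have hadm : LowerAdmissible x₀ N x (u' + x₀) :=
      ⟨add_le_of_nonpos_left hu', _, le_add_of_nonneg_left hv', hne⟩
    obtain ⟨v, hv, hne', heq⟩ := exists_lowerMin_eq (y := y) hadm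
    refine ⟨v - x₀, sub_nonneg.2 hv, ?_⟩
    rw [block_sub, sub_add_cancel]
    have hpos : (0 : ℝ) < (block N x (u' + x₀) v).card := by exact_mod_cast hne'.card_pos
    refine ⟨hne', ?_⟩
    rw [← div_le_iff₀ hpos]
    exact heq.symm.trans_le (lowerMin_le_maxMinEst hadm)

lemma lowerMin_neg (v : Fin d → ℝ) :
    lowerMin (-x₀) N (fun i => -x i) (fun i => -y i) (-v) = -upperMax x₀ N x y v := by
  rw [lowerMin, upperMax, Real.sInf_def]
  congr 2
  ext a
  simp only [Set.mem_neg, Set.mem_ofPred_eq]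
  have hmean : ∀ u, blockMean N (fun i => -x i) (fun i => -y i) (-v) (-u)
      = -blockMean N x y u v := fun u => by
    rw [blockMean, blockMean, block_neg, Finset.sum_neg_distrib, neg_div]
  constructor
  · rintro ⟨u, h1, h2, h3⟩
    refine ⟨-u, neg_le.1 h1, ?_, ?_⟩
    · rwa [← block_neg, neg_neg]
    · rw [← neg_neg u, hmean] at h3
      exact neg_injective h3
  · rintro ⟨u, h1, h2, h3⟩
    exact ⟨-u, neg_le_neg h1, by rwa [block_neg], by rw [hmean, h3]⟩

lemma lowerAdmissible_neg_iff :
    LowerAdmissible (-x₀) N (fun i => -x i) (-v) ↔ UpperAdmissible x₀ N x v := by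
  rw [LowerAdmissible, UpperAdmissible, neg_le_neg_iff]
  refine and_congr_right fun _ => ⟨?_, ?_⟩
  · rintro ⟨u, h1, h2⟩
    exact ⟨-u, neg_le.1 h1, by rwa [← block_neg, neg_neg]⟩
  · rintro ⟨u, h1, h2⟩
    exact ⟨-u, neg_le_neg h1, by rwa [block_neg]⟩

lemma maxMinEst_neg :
    maxMinEst (-x₀) N (fun i => -x i) (fun i => -y i) = -minMaxEst x₀ N x y := by
  rw [maxMinEst, minMaxEst, Real.sInf_def, neg_neg]
  congr 1
  ext a
  simp only [Set.mem_neg, Set.mem_ofPred_eq]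
  constructor
  · rintro ⟨u, h1, h2⟩
    rw [← neg_neg u] at h1 h2
    exact ⟨-u, lowerAdmissible_neg_iff.1 h1, by rw [h2, lowerMin_neg, neg_neg]⟩
  · rintro ⟨v, h1, h2⟩
    exact ⟨-v, lowerAdmissible_neg_iff.2 h1, by rw [lowerMin_neg, ← h2, neg_neg]⟩

lemma IsFeasiblePair.lowerOpt (h : IsFeasiblePair x₀ N x y u v) :
    LowerOpt N (fun i => x i - x₀) y (u - x₀) (maxMinEst x₀ N x y) ∧
      LowerOpt N (fun i => -(x i - x₀)) (fun i => -y i) (-(v - x₀)) (-minMaxEst x₀ N x y) := by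
  refine ⟨lowerOpt_of_lowerMin_eq h.1.1 h.1.2, ?_⟩
  have := lowerOpt_of_lowerMin_eq (x₀ := -x₀) (x := fun i => -x i) (y := fun i => -y i) (u := -v)
    (lowerAdmissible_neg_iff.2 h.2.1) (by rw [lowerMin_neg, maxMinEst_neg, h.2.2])
  rw [maxMinEst_neg] at this
  convert this using 2
  · abel
  · abel

lemma localVarEst_eq : localVarEst x₀ N x y u v =
    (∑ i ∈ block N (fun i => x i - x₀) (u - x₀) (v - x₀),
      (y i - (maxMinEst x₀ N x y + minMaxEst x₀ N x y) / 2) ^ 2)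
        / ((block N (fun i => x i - x₀) (u - x₀) (v - x₀)).card : ℝ) := by
  rw [block_sub, sub_add_cancel, sub_add_cancel]
  rfl

end Estimators

section Scales

variable {d : ℕ} {α : Fin d → ℕ∞} {lo hi : Fin d → ℝ} {D : Finset (Fin d)} {g : ℕ → Fin d → ℝ}
  {w : ℕ → ℝ} {ρ : ℝ}

/-! ### Scales adapted to the smoothness -/

/-- Scales `g n k`, of size `w n ^ (1/α_k)` in the directions of `D` of finite smoothness, constant
in the directions of infinite smoothness, and at least `w n ^ (1/α_k)` everywhere else. -/
structure AdaptedScales (α : Fin d → ℕ∞) (lo hi : Fin d → ℝ) (D : Finset (Fin d))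
    (g : ℕ → Fin d → ℝ) (w : ℕ → ℝ) (ρ : ℝ) : Prop where
  pos : 0 < ρ
  le_hi : ∀ k, ρ ≤ hi k
  le_neg_lo : ∀ k, ρ ≤ -lo k
  hi_le : ∀ k, hi k ≤ 1
  neg_lo_le : ∀ k, -lo k ≤ 1
  tendsto_rate : Tendsto w atTop (𝓝[>] 0)
  le_scale : ∀ᶠ n in atTop, ∀ k, α k ≠ ⊤ → w n ^ recip (α k) ≤ g n k
  scale_eq : ∀ᶠ n in atTop, ∀ k ∈ D, α k ≠ ⊤ → g n k = w n ^ recip (α k)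
  scale_top : ∀ᶠ n in atTop, ∀ k, α k = ⊤ → g n k = ρ
  tendsto_scale : ∀ k, α k ≠ ⊤ → Tendsto (fun n => g n k) atTop (𝓝 0)

namespace AdaptedScales

lemma neg (H : AdaptedScales α lo hi D g w ρ) : AdaptedScales α (-hi) (-lo) D g w ρ where
  pos := H.pos
  le_hi := H.le_neg_lo
  le_neg_lo := fun k => by simpa using H.le_hi k
  hi_le := H.neg_lo_le
  neg_lo_le := fun k => by simpa using H.hi_le k
  tendsto_rate := H.tendsto_rate
  le_scale := H.le_scale
  scale_eq := H.scale_eq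
  scale_top := H.scale_top
  tendsto_scale := H.tendsto_scale

lemma le_one (H : AdaptedScales α lo hi D g w ρ) (k : Fin d) : ρ ≤ 1 :=
  (H.le_hi k).trans (H.hi_le k)

lemma eventually_pos (H : AdaptedScales α lo hi D g w ρ) : ∀ᶠ n in atTop, 0 < w n :=
  H.tendsto_rate eventually_mem_nhdsWithin

lemma eventually_scale_pos (H : AdaptedScales α lo hi D g w ρ) :
    ∀ᶠ n in atTop, ∀ k, 0 < g n k := by
  filter_upwards [H.eventually_pos, H.le_scale, H.scale_top] with n h1 h2 h3 k
  by_cases hk : α k = ⊤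
  · rw [h3 k hk]; exact H.pos
  · exact (Real.rpow_pos_of_pos h1 _).trans_le (h2 k hk)

lemma eventually_scale_le (H : AdaptedScales α lo hi D g w ρ) :
    ∀ᶠ n in atTop, ∀ k, g n k ≤ ρ := by
  have h : ∀ k, ∀ᶠ n in atTop, α k ≠ ⊤ → g n k ≤ ρ := fun k => by
    by_cases hk : α k = ⊤
    · exact Eventually.of_forall fun n h => absurd hk h
    · exact ((H.tendsto_scale k hk).eventually_le_const H.pos).mono fun n h _ => h
  filter_upwards [eventually_all.2 h, H.scale_top] with n h1 h2 k
  by_cases hk : α k = ⊤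
  · exact (h2 k hk).le
  · exact h1 k hk

lemma eventually_frame (H : AdaptedScales α lo hi D g w ρ) :
    ∀ᶠ n in atTop, Frame lo hi (g n) D (w n) := by
  filter_upwards [H.eventually_pos, H.eventually_scale_pos, H.eventually_scale_le] with n h1 h2 h3
  refine ⟨h1, h2, fun k => ?_, fun k => ?_⟩
  · have := h3 k
    have h4 := H.le_neg_lo k
    have := H.pos
    simp only [corner, Pi.neg_apply]
    split_ifs <;> linarith
  · have := h3 k
    have h4 := H.le_hi k
    have := H.pos
    simp only [corner]
    split_ifs <;> linarith

lemma eventually_signalBounds (H : AdaptedScales α lo hi D g w ρ) {F : (Fin d → ℝ) → ℝ}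
    {a : (Fin d → ℕ) → ℝ} (hF : LocalExpansion F lo hi α a) :
    ∃ K, 0 ≤ K ∧ ∀ᶠ n in atTop, SignalBounds F lo hi (g n) D (w n) K := by
  obtain ⟨K, hK, hb⟩ := hF.exists_local_bound
  refine ⟨K, hK, ?_⟩
  filter_upwards [H.eventually_frame, H.tendsto_rate.eventually hb, H.scale_eq, H.scale_top,
    H.eventually_pos] with n hfr hb h1 h2 hw
  have hq := corner_nonneg (D := D) hfr.g_pos
  have hcorner : ∀ k, |corner D (g n) k| ≤ w n ^ recip (α k) := fun k => by
    have h0 := Real.rpow_nonneg hw.le (recip (α k))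
    rw [abs_of_nonneg (hq k)]
    simp only [corner]
    split_ifs with hk
    · by_cases hα : α k = ⊤
      · rw [h2 k hα, hα, recip_top, Real.rpow_zero]; exact H.le_one k
      · exact (h1 k hk hα).le
    · exact h0
  refine ⟨hF.mono, ?_, ?_⟩
  · have := hb _ ⟨hfr.lo_le.trans ((neg_nonpos.2 hq).trans hq), hfr.le_hi⟩ hcorner
    linarith [(abs_le.1 this).2]
  · have := hb _ ⟨hfr.lo_le, (neg_nonpos.2 hq).trans (hq.trans hfr.le_hi)⟩
      (fun k => by rw [Pi.neg_apply, abs_neg]; exact hcorner k)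
    linarith [(abs_le.1 this).1]

lemma exists_drop (H : AdaptedScales α lo hi D g w ρ) {F : (Fin d → ℝ) → ℝ}
    {a : (Fin d → ℕ) → ℝ} (hF : LocalExpansion F lo hi α a) (K : ℝ) : ∃ θ, 0 ≤ θ ∧
      ∀ᶠ n in atTop, SignalDrop (fun x => -F (-x)) (-hi) (-lo) (g n) D (w n) K θ := by
  obtain ⟨θ, hθ, hgr⟩ := hF.exists_growth K
  have hρ := H.pos
  refine ⟨max θ (1 / ρ), by positivity, ?_⟩
  filter_upwards [H.eventually_frame, H.tendsto_rate.eventually hgr, H.scale_eq, H.scale_top,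
    H.le_scale, H.eventually_pos] with n hfr hgr h1 h2 h3 hw k z hz hzc hzk
  have hgk := hfr.g_pos k
  by_cases hk : α k = ⊤
  · exfalso
    have h4 : 1 ≤ max θ (1 / ρ) * g n k := by
      rw [h2 k hk]
      calc 1 = 1 / ρ * ρ := by field_simp
        _ ≤ _ := mul_le_mul_of_nonneg_right (le_max_right _ _) hρ.le
    have h5 := hz.1 k
    have h6 := H.hi_le k
    simp only [Pi.neg_apply] at h5
    linarith
  · have := hgr k hk (-z) ⟨by simpa using neg_le_neg hz.2, by simpa using neg_le_neg hz.1⟩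
      (fun l hl => ?_) ?_
    · simp only [neg_zero]; linarith
    · rw [Pi.neg_apply]
      refine neg_le_neg ((hzc l).trans ?_)
      simp only [corner]
      split_ifs with hlD
      · exact (h1 l hlD hl).le
      · exact Real.rpow_nonneg hw.le _
    · rw [Pi.neg_apply]
      calc θ * w n ^ recip (α k) ≤ max θ (1 / ρ) * g n k :=
            mul_le_mul (le_max_left _ _) (h3 k hk) (Real.rpow_nonneg hw.le _)
              ((zero_le_one.trans hθ).trans (le_max_left _ _))
        _ ≤ -z k := by linarith

/-- A function with a local expansion fits adapted scales. -/
lemma exists_signalScales (H : AdaptedScales α lo hi D g w ρ) {F : (Fin d → ℝ) → ℝ}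
    {a : (Fin d → ℕ) → ℝ} (hF : LocalExpansion F lo hi α a) :
    ∃ K₁, SignalScales F lo hi D g w K₁ := by
  obtain ⟨K₁, hK₁, hb⟩ := H.eventually_signalBounds hF
  refine ⟨K₁, hK₁, hb, fun K => ?_, H.exists_drop hF, fun C ε hε => ?_⟩
  · simpa using H.neg.exists_drop hF.neg K
  · obtain ⟨K, hK, hloc⟩ := hF.exists_local_bound
    have h1 : ∀ᶠ w₀ : ℝ in 𝓝[>] 0, K * w₀ ≤ ε := by
      have : Tendsto (fun w₀ : ℝ => K * w₀) (𝓝[>] 0) (𝓝 (K * 0)) :=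
        (tendsto_id.mono_left nhdsWithin_le_nhds).const_mul K
      rw [mul_zero] at this
      exact this.eventually_le_const hε
    obtain ⟨w₀, hw₀, h1, hloc⟩ := (eventually_mem_nhdsWithin.and (h1.and hloc)).exists
    have hw₀ : 0 < w₀ := hw₀
    have h2 : ∀ k, ∀ᶠ n in atTop, α k ≠ ⊤ → C * g n k ≤ w₀ ^ recip (α k) := fun k => by
      by_cases hk : α k = ⊤
      · exact Eventually.of_forall fun n h => absurd hk h
      · have := (H.tendsto_scale k hk).const_mul C
        rw [mul_zero] at this
        exact (this.eventually_le_const (Real.rpow_pos_of_pos hw₀ _)).mono fun n h _ => h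
    filter_upwards [eventually_all.2 h2] with n h2 x hx hxC
    refine (hloc x hx fun k => ?_).trans h1
    by_cases hk : α k = ⊤
    · rw [hk, recip_top, Real.rpow_zero, abs_le]
      have h3 := H.neg_lo_le k
      have h4 := H.hi_le k
      exact ⟨by linarith [hx.1 k], (hx.2 k).trans h4⟩
    · exact (hxC k).trans (h2 k hk)

end AdaptedScales

end Scales

section Lattice

/-! ### Counting points of lattice designs -/

/-- Equally spaced points `G 0, …, G (m - 1)` of `[0, 1]`. -/
structure AxisGrid (m : ℕ) (G : ℕ → ℝ) : Prop where
  mem : ∀ j < m, G j ∈ Set.Icc (0 : ℝ) 1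
  step : ∀ j, j + 1 < m → G (j + 1) - G j = 1 / (m : ℝ)

namespace AxisGrid

variable {m : ℕ} {G : ℕ → ℝ}

lemma eq_add (H : AxisGrid m G) {j : ℕ} (hj : j < m) : G j = G 0 + j / m := by
  induction j with
  | zero => simp
  | succ j ih =>
    have h1 := H.step j hj
    have h2 := ih (by omega)
    push_cast
    rw [add_div]
    linarith

lemma injOn (H : AxisGrid m G) : Set.InjOn G (Set.Iio m) := fun i hi j hj hij => by
  have hi : i < m := hi
  have hj : j < m := hj
  have hm : (0 : ℝ) < m := by exact_mod_cast (by omega : 0 < m)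
  rw [H.eq_add hi, H.eq_add hj, add_right_inj, div_left_inj' hm.ne'] at hij
  exact_mod_cast hij

/-- The indices of the points of the axis in `[x + u, x + v]`. -/
noncomputable def window (m : ℕ) (G : ℕ → ℝ) (x u v : ℝ) : Finset ℕ :=
  (Finset.range m).filter fun j => u ≤ G j - x ∧ G j - x ≤ v

variable {j₀ : ℕ} {u v : ℝ}

lemma mem_window_iff (H : AxisGrid m G) (hj₀ : j₀ < m) (j : ℕ) :
    j ∈ window m G (G j₀) u v ↔ j < m ∧ j₀ + m * u ≤ j ∧ (j : ℝ) ≤ j₀ + m * v := by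
  simp only [window, Finset.mem_filter, Finset.mem_range]
  refine and_congr_right fun hj => ?_
  have hm : (0 : ℝ) < m := by exact_mod_cast (by omega : 0 < m)
  have : G j - G j₀ = ((j : ℝ) - j₀) / m := by
    rw [H.eq_add hj, H.eq_add hj₀, sub_div]; ring
  rw [this, le_div_iff₀ hm, div_le_iff₀ hm, le_sub_iff_add_le, sub_le_iff_le_add, mul_comm u,
    mul_comm v, add_comm, add_comm (m * v)]

lemma card_window_le (H : AxisGrid m G) (hj₀ : j₀ < m) (hu : u ≤ 0) (hv : 0 ≤ v) :
    ((window m G (G j₀) u v).card : ℝ) ≤ 1 + m * (v - u) := by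
  have hm : (0 : ℝ) ≤ m := Nat.cast_nonneg m
  have hmu : m * u ≤ 0 := mul_nonpos_of_nonneg_of_nonpos hm hu
  have hmv : 0 ≤ m * v := mul_nonneg hm hv
  have hj : (0 : ℝ) ≤ j₀ := Nat.cast_nonneg _
  have hsub : window m G (G j₀) u v ⊆ Finset.Icc ⌈j₀ + m * u⌉₊ ⌊j₀ + m * v⌋₊ := fun j h => by
    obtain ⟨-, h1, h2⟩ := (H.mem_window_iff hj₀ j).1 h
    exact Finset.mem_Icc.2 ⟨Nat.ceil_le.2 h1, Nat.le_floor h2⟩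
  have h1 : ⌈j₀ + m * u⌉₊ ≤ j₀ := Nat.ceil_le.2 (by linarith)
  have h2 : j₀ ≤ ⌊j₀ + m * v⌋₊ := Nat.le_floor (by linarith)
  have h3 := Finset.card_le_card hsub
  rw [Nat.card_Icc] at h3
  have h4 : ((window m G (G j₀) u v).card : ℝ) + ⌈j₀ + m * u⌉₊ ≤ ⌊j₀ + m * v⌋₊ + 1 := by
    exact_mod_cast (by omega)
  have h5 := Nat.le_ceil (j₀ + m * u)
  have h6 := Nat.floor_le (by linarith : 0 ≤ j₀ + m * v)
  linarith

lemma le_card_window (H : AxisGrid m G) (hj₀ : j₀ < m) (hu : u ≤ 0) (hv : 0 ≤ v)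
    (hlo : -G j₀ ≤ u) (hhi : v ≤ 1 - G j₀) :
    1 + m * (v - u) ≤ 3 * ((window m G (G j₀) u v).card : ℝ) := by
  have hm : (0 : ℝ) < m := by exact_mod_cast (by omega : 0 < m)
  have hmu : m * u ≤ 0 := mul_nonpos_of_nonneg_of_nonpos hm.le hu
  have hmv : 0 ≤ m * v := mul_nonneg hm.le hv
  have hj : (0 : ℝ) ≤ j₀ := Nat.cast_nonneg _
  have hG0 := (H.mem 0 (by omega)).1
  have hG1 : m * G 0 ≤ 1 := by
    have h1 := (H.mem (m - 1) (by omega)).2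
    rw [H.eq_add (by omega : m - 1 < m), Nat.cast_sub (by omega), Nat.cast_one, ← le_sub_iff_add_le] at h1
    have : 1 - ((m : ℝ) - 1) / m = 1 / m := by field_simp; ring
    rw [this, le_div_iff₀ hm] at h1
    linarith
  have hx : m * G j₀ = m * G 0 + j₀ := by
    rw [H.eq_add hj₀]; field_simp
  have hA : -1 ≤ j₀ + m * u := by nlinarith
  have hB : j₀ + m * v ≤ m := by nlinarith
  have hmem : j₀ ∈ window m G (G j₀) u v :=
    (H.mem_window_iff hj₀ j₀).2 ⟨hj₀, by linarith, by linarith⟩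
  have hpos : (1 : ℝ) ≤ (window m G (G j₀) u v).card := by
    exact_mod_cast Finset.card_pos.2 ⟨j₀, hmem⟩
  set b := min ⌊j₀ + m * v⌋₊ (m - 1) with hb
  have hsub : Finset.Icc ⌈j₀ + m * u⌉₊ b ⊆ window m G (G j₀) u v := fun j h => by
    obtain ⟨h1, h2⟩ := Finset.mem_Icc.1 h
    have h3 := le_min_iff.1 h2
    exact (H.mem_window_iff hj₀ j).2 ⟨by omega, Nat.ceil_le.1 h1,
      (Nat.le_floor_iff (by linarith)).1 h3.1⟩
  have h3 := Finset.card_le_card hsub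
  rw [Nat.card_Icc] at h3
  have hb1 : j₀ + m * v ≤ b + 1 := by
    rcases min_choice ⌊j₀ + m * v⌋₊ (m - 1) with h | h
    · rw [hb, h]; exact (Nat.lt_floor_add_one _).le
    · rw [hb, h, Nat.cast_sub (by omega), Nat.cast_one, sub_add_cancel]; exact hB
  have h4 : ((b : ℝ) + 1) ≤ (window m G (G j₀) u v).card + ⌈j₀ + m * u⌉₊ := by
    exact_mod_cast (by omega)
  have h5 : (⌈j₀ + m * u⌉₊ : ℝ) ≤ j₀ + m * u + 1 := by
    rcases le_or_gt (j₀ + m * u) 0 with h | h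
    · rw [Nat.ceil_eq_zero.2 h, Nat.cast_zero]; linarith
    · exact (Nat.ceil_lt_add_one h.le).le
  linarith

end AxisGrid

variable {d N : ℕ} {x₀ : Fin d → ℝ} {x : ℕ → Fin d → ℝ} {m : Fin d → ℕ} {G : Fin d → ℕ → ℝ}

lemma card_block_eq_prod (hG : ∀ k, AxisGrid (m k) (G k))
    (hx : Set.BijOn x (Set.Iio N) {z | ∀ k, ∃ j < m k, z k = G k j}) (u v : Fin d → ℝ) :
    (block N (fun i => x i - x₀) u v).card
      = ∏ k, (AxisGrid.window (m k) (G k) (x₀ k) (u k) (v k)).card := by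
  classical
  rw [← Fintype.card_piFinset]
  set φ : (Fin d → ℕ) → Fin d → ℝ := fun j k => G k (j k) with hφ
  set W := Fintype.piFinset fun k => AxisGrid.window (m k) (G k) (x₀ k) (u k) (v k) with hW
  have hmemW : ∀ j, j ∈ W ↔ ∀ k, j k < m k ∧ u k ≤ G k (j k) - x₀ k ∧ G k (j k) - x₀ k ≤ v k :=
    fun j => by simp [hW, AxisGrid.window]
  have h1 : ((block N (fun i => x i - x₀) u v).image x).card
      = (block N (fun i => x i - x₀) u v).card :=
    Finset.card_image_of_injOn (hx.injOn.mono fun i hi => (mem_block.1 hi).1)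
  have h2 : (W.image φ).card = W.card := by
    refine Finset.card_image_of_injOn fun i hi j hj hij => ?_
    have hi := (hmemW i).1 hi
    have hj := (hmemW j).1 hj
    exact funext fun k => (hG k).injOn (hi k).1 (hj k).1 (congrFun hij k)
  rw [← h1, ← h2]
  congr 1
  ext a
  simp only [Finset.mem_image, mem_block, hmemW]
  constructor
  · rintro ⟨i, ⟨hi, h3, h4⟩, rfl⟩
    choose j hj hij using hx.mapsTo (Set.mem_Iio.2 hi)
    refine ⟨j, fun k => ⟨hj k, ?_, ?_⟩, funext fun k => (hij k).symm⟩
    · rw [← hij k]; exact h3 k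
    · rw [← hij k]; exact h4 k
  · rintro ⟨j, hj, rfl⟩
    obtain ⟨i, hi, hij⟩ := hx.surjOn (show φ j ∈ {z | ∀ k, ∃ j < m k, z k = G k j} from
      fun k => ⟨j k, (hj k).1, rfl⟩)
    refine ⟨i, ⟨hi, fun k => ?_, fun k => ?_⟩, hij⟩
    · rw [hij]; exact (hj k).2.1
    · rw [hij]; exact (hj k).2.2

/-- Lattice designs are regular. -/
lemma regular_of_lattice {g b : Fin d → ℝ} {D : Finset (Fin d)} {w τ ρ : ℝ} (hρ : 0 < ρ)
    (hρ1 : ρ ≤ 1) (hG : ∀ k, AxisGrid (m k) (G k)) (hx₀ : ∀ k, ∃ j < m k, x₀ k = G k j)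
    (hx : Set.BijOn x (Set.Iio N) {z | ∀ k, ∃ j < m k, z k = G k j}) (hg : ∀ k, 0 < g k)
    (hw : w ^ 2 = ∏ k, b k) (hb0 : ∀ k, 0 ≤ b k)
    (hD : ∀ k ∈ D, ρ / 2 ≤ b k * (m k * g k) ∧ b k * (m k * g k) ≤ 1 ∧ 1 ≤ τ * (m k * g k))
    (hD' : ∀ k ∉ D, b k = 1 ∧ g k = 1 / m k) :
    Regular N (fun i => x i - x₀) (-x₀) (1 - x₀) g D w ((6 / ρ) ^ d) τ := by
  have h6 : 6 ≤ 6 / ρ := by rw [le_div_iff₀ hρ]; linarith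
  have hmpos : ∀ k, (0 : ℝ) < m k := fun k => by
    obtain ⟨j, hj, -⟩ := hx₀ k
    exact_mod_cast (by omega : 0 < m k)
  have hcard : ∀ u v, w ^ 2 * ((block N (fun i => x i - x₀) u v).card : ℝ)
      = ∏ k, b k * ((AxisGrid.window (m k) (G k) (x₀ k) (u k) (v k)).card : ℝ) := fun u v => by
    rw [card_block_eq_prod hG hx, hw, Nat.cast_prod, Finset.prod_mul_distrib]
  have hlen : ∀ u v : Fin d → ℝ, ∀ k ∈ D, m k * (v k - u k) = m k * g k * relLen D g u v k :=
    fun u v k hk => by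
      have := (hg k).ne'
      simp only [relLen, if_pos hk]; field_simp; ring
  have hlen' : ∀ u v : Fin d → ℝ, ∀ k ∉ D, relLen D g u v k = 1 + m k * (v k - u k) :=
    fun u v k hk => by
      simp only [relLen, if_neg hk, (hD' k hk).2]; field_simp
  have hone : ∀ u v : Fin d → ℝ, u ≤ 0 → 0 ≤ v → (∀ k ∈ D, τ * g k ≤ v k - u k) → ∀ k ∈ D,
      1 ≤ m k * (v k - u k) := fun u v hu hv h k hk => by
    calc 1 ≤ τ * (m k * g k) := (hD k hk).2.2
      _ = m k * (τ * g k) := by ring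
      _ ≤ _ := mul_le_mul_of_nonneg_left (h k hk) (hmpos k).le
  refine ⟨fun i hi => ?_, fun u v hu hv h => ?_, fun u v hlo hu hv hhi h => ?_⟩
  · have hmem := hx.mapsTo (Set.mem_Iio.2 hi)
    refine ⟨fun k => ?_, fun k => ?_⟩
    all_goals
      obtain ⟨j, hj, hij⟩ := hmem k
      have := (hG k).mem j hj
      simp only [Pi.neg_apply, Pi.sub_apply, Pi.one_apply, hij]
      linarith [this.1, this.2]
  · rw [hcard]
    have : (6 / ρ) ^ d * ∏ k, relLen D g u v k = ∏ k, 6 / ρ * relLen D g u v k := by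
      rw [Finset.prod_mul_distrib, Finset.prod_const, Finset.card_univ, Fintype.card_fin]
    rw [this]
    refine Finset.prod_le_prod (fun k _ => mul_nonneg (hb0 k) (Nat.cast_nonneg _)) fun k _ => ?_
    have hr := relLen_nonneg (D := D) hg hu hv k
    obtain ⟨j₀, hj₀, hx0⟩ := hx₀ k
    rw [hx0]
    have hc := (hG k).card_window_le hj₀ (hu k) (hv k)
    by_cases hk : k ∈ D
    · have h1 := hone u v hu hv h k hk
      have h2 := hlen u v k hk
      calc b k * ((AxisGrid.window (m k) (G k) (G k j₀) (u k) (v k)).card : ℝ)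
          ≤ b k * (2 * (m k * g k * relLen D g u v k)) :=
            mul_le_mul_of_nonneg_left (by linarith) (hb0 k)
        _ = 2 * (b k * (m k * g k) * relLen D g u v k) := by ring
        _ ≤ 2 * (1 * relLen D g u v k) := by gcongr; exact (hD k hk).2.1
        _ ≤ _ := by nlinarith
    · rw [(hD' k hk).1, one_mul]
      refine hc.trans ?_
      rw [← hlen' u v k hk]
      nlinarith
  · rw [hcard]
    have hρd : ∏ k, relLen D g u v k ≤ ∏ k, 6 / ρ *
        (b k * ((AxisGrid.window (m k) (G k) (x₀ k) (u k) (v k)).card : ℝ)) := by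
      refine Finset.prod_le_prod (fun k _ => relLen_nonneg hg hu hv k) fun k _ => ?_
      have hr := relLen_nonneg (D := D) hg hu hv k
      obtain ⟨j₀, hj₀, hx0⟩ := hx₀ k
      have hlok := hlo k
      have hhik := hhi k
      simp only [Pi.neg_apply, Pi.sub_apply, Pi.one_apply] at hlok hhik
      rw [hx0] at hlok hhik ⊢
      have hc := (hG k).le_card_window hj₀ (hu k) (hv k) hlok hhik
      by_cases hk : k ∈ D
      · have h2 := hlen u v k hk
        have h3 : m k * g k * relLen D g u v k
            ≤ 3 * ((AxisGrid.window (m k) (G k) (G k j₀) (u k) (v k)).card : ℝ) := by linarith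
        have h4 : ρ / 2 * relLen D g u v k ≤ b k * (m k * g k) * relLen D g u v k :=
          mul_le_mul_of_nonneg_right (hD k hk).1 hr
        have h5 := mul_le_mul_of_nonneg_left h3 (hb0 k)
        rw [div_mul_eq_mul_div, le_div_iff₀ hρ]
        linarith
      · rw [(hD' k hk).1, one_mul, hlen' u v k hk]
        refine hc.trans ?_
        gcongr
        linarith
    refine hρd.trans (le_of_eq ?_)
    rw [Finset.prod_mul_distrib, Finset.prod_const, Finset.card_univ, Fintype.card_fin]

end Lattice

section LatticeRates

variable {d : ℕ}

/-! ### Rates for lattice designs -/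

lemma sum_Ici_eq_add_sum_Ioi (f : Fin d → ℝ) (l : Fin d) :
    ∑ k ∈ Finset.Ici l, f k = f l + ∑ k ∈ Finset.Ioi l, f k := by
  rw [← Finset.Ioi_insert, Finset.sum_insert (by simp)]

/-- In the directions `k ≥ l`, where `l` maximises the rate exponent, the grid is finer than the
smoothness scale, and in the other directions it is coarser. -/
lemma rate_signs {α : Fin d → ℕ∞} {β : Fin d → ℝ} {s : ℕ} (hβ : ∀ k, 0 < β k)
    (hfin : ∀ k : Fin d, (k : ℕ) < s → 1 ≤ α k ∧ α k ≠ ⊤)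
    (hinf : ∀ k : Fin d, s ≤ (k : ℕ) → α k = ⊤)
    (hord : ∀ k l : Fin d, k ≤ l → (l : ℕ) < s →
      ((α k).toNat : ℝ) * β k ≤ ((α l).toNat : ℝ) * β l)
    {l : Fin d} (hmax : ∀ m, rateExponent α β m ≤ rateExponent α β l)
    (huniq : ∀ m, (∀ m', rateExponent α β m' ≤ rateExponent α β m) → m = l) :
    0 < rateExponent α β l ∧
      ∑ k ∈ Finset.Ici l, (β k - rateExponent α β l * recip (α k)) = 2 * rateExponent α β l ∧
      (∀ k ∈ Finset.Ici l, 0 < β k - rateExponent α β l * recip (α k)) ∧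
      ∀ k ∉ Finset.Ici l, α k ≠ ⊤ ∧ β k - rateExponent α β l * recip (α k) < 0 := by
  set κ := rateExponent α β l with hκ
  set δ : Fin d → ℝ := fun k => β k - κ * recip (α k) with hδ
  have hA : ∀ m : Fin d, 0 < 2 + ∑ k ∈ Finset.Ici m, recip (α k) := fun m => by
    have : 0 ≤ ∑ k ∈ Finset.Ici m, recip (α k) := Finset.sum_nonneg fun k _ => recip_nonneg _
    linarith
  have hκ0 : 0 < κ := by
    refine div_pos (Finset.sum_pos (fun k _ => hβ k) ⟨l, by simp⟩) (hA l)
  have hsum : ∀ S : Finset (Fin d), ∑ k ∈ S, δ k = ∑ k ∈ S, β k - κ * ∑ k ∈ S, recip (α k) :=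
    fun S => by rw [hδ, Finset.sum_sub_distrib, Finset.mul_sum]
  have hl : ∑ k ∈ Finset.Ici l, δ k = 2 * κ := by
    have : κ * (2 + ∑ k ∈ Finset.Ici l, recip (α k)) = ∑ k ∈ Finset.Ici l, β k :=
      div_mul_cancel₀ _ (hA l).ne'
    rw [hsum]; linarith
  have hne : ∀ m, m ≠ l → ∑ k ∈ Finset.Ici m, δ k < 2 * κ := fun m hm => by
    have h1 : rateExponent α β m < κ := lt_of_le_of_ne (hmax m) fun h =>
      hm (huniq m fun m' => (hmax m').trans_eq (hκ.symm.trans h.symm))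
    rw [rateExponent, div_lt_iff₀ (hA m)] at h1
    rw [hsum]; linarith
  have hδs : ∀ k : Fin d, s ≤ (k : ℕ) → 0 < δ k := fun k hk => by
    simp only [hδ, hinf k hk, recip_top, mul_zero, sub_zero]; exact hβ k
  have hδm : ∀ k : Fin d, (k : ℕ) < s → ∃ a : ℝ, 0 < a ∧ a = (α k).toNat ∧
      δ k * a = (α k).toNat * β k - κ := fun k hk => by
    have hpos : (0 : ℝ) < (α k).toNat := by
      exact_mod_cast toNat_pos_of_one_le (hfin k hk).2 (hfin k hk).1
    refine ⟨_, hpos, rfl, ?_⟩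
    simp only [hδ, recip]
    field_simp
  have hmono : ∀ k m : Fin d, k ≤ m → (m : ℕ) < s → 0 ≤ δ k → 0 ≤ δ m := fun k m hkm hm h => by
    obtain ⟨a, ha, -, ha2⟩ := hδm k (lt_of_le_of_lt hkm hm)
    obtain ⟨b, hb, -, hb2⟩ := hδm m hm
    have h1 := hord k m hkm hm
    have h2 := mul_nonneg h ha.le
    exact nonneg_of_mul_nonneg_left (by linarith) hb
  have hmono' : ∀ k m : Fin d, k ≤ m → (m : ℕ) < s → 0 < δ k → 0 < δ m := fun k m hkm hm h => by
    obtain ⟨a, ha, -, ha2⟩ := hδm k (lt_of_le_of_lt hkm hm)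
    obtain ⟨b, hb, -, hb2⟩ := hδm m hm
    have h1 := hord k m hkm hm
    have h2 := mul_pos h ha
    exact pos_of_mul_pos_left (by linarith) hb.le
  have hIoi : ∀ m m' : Fin d, (m' : ℕ) = m + 1 → Finset.Ioi m = Finset.Ici m' := fun m m' h => by
    ext k
    simp only [Finset.mem_Ioi, Finset.mem_Ici, Fin.lt_def, Fin.le_def]
    omega
  have hδl : 0 < δ l := by
    have h1 := sum_Ici_eq_add_sum_Ioi δ l
    have h2 : ∑ k ∈ Finset.Ioi l, δ k < 2 * κ := by
      by_cases h : (l : ℕ) + 1 < d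
      · rw [hIoi l ⟨l + 1, h⟩ rfl]
        exact hne _ fun h => by simpa using congrArg Fin.val h
      · have : Finset.Ioi l = ∅ := by
          ext k
          have := k.isLt
          simp only [Finset.mem_Ioi, Fin.lt_def, Finset.notMem_empty, iff_false]
          omega
        rw [this, Finset.sum_empty]; linarith
    linarith
  refine ⟨hκ0, hl, fun k hk => ?_, fun k hk => ?_⟩
  · rcases lt_or_ge (k : ℕ) s with h | h
    · exact hmono' l k (Finset.mem_Ici.1 hk) h hδl
    · exact hδs k h
  · have hkl : k < l := by simpa using hk
    have hkl' : (k : ℕ) < l := hkl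
    set m : Fin d := ⟨l - 1, by omega⟩ with hm
    have hm1 : (m : ℕ) = l - 1 := rfl
    have hml : m ≠ l := fun h => by have := congrArg Fin.val h; omega
    have h1 := sum_Ici_eq_add_sum_Ioi δ m
    rw [hIoi m l (by omega), hl] at h1
    have h2 := hne m hml
    have hδm0 : δ m < 0 := by linarith
    have hms : (m : ℕ) < s := by
      by_contra h
      have := hδs m (not_lt.1 h)
      linarith
    have hkm : k ≤ m := Fin.le_def.2 (by omega)
    refine ⟨(hfin k (lt_of_le_of_lt hkm hms)).2, ?_⟩
    by_contra h
    have := hmono k m hkm hms (not_lt.1 h)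
    linarith

lemma axisCount_le (b : ℝ) (n : ℕ) : (axisCount b n : ℝ) ≤ (n : ℝ) ^ b :=
  Nat.floor_le (by positivity)

lemma half_le_axisCount {b : ℝ} (hb : 0 ≤ b) {n : ℕ} (hn : 1 ≤ n) :
    (n : ℝ) ^ b / 2 ≤ axisCount b n := by
  have h1 : 1 ≤ (n : ℝ) ^ b := Real.one_le_rpow (by exact_mod_cast hn) hb
  have h2 := Nat.lt_floor_add_one ((n : ℝ) ^ b)
  have h3 : (1 : ℝ) ≤ ⌊(n : ℝ) ^ b⌋₊ := by
    exact_mod_cast (Nat.one_le_floor_iff _).2 h1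
  simp only [axisCount]
  linarith

lemma exists_margin {x₀ : Fin d → ℝ} (hx₀ : ∀ k, x₀ k ∈ Set.Ioo (0 : ℝ) 1) :
    ∃ ρ : ℝ, 0 < ρ ∧ ρ ≤ 1 ∧ ∀ k, ρ ≤ x₀ k ∧ ρ ≤ 1 - x₀ k := by
  have h : ∀ c : ℝ, 0 < c → ∀ᶠ ρ in 𝓝[>] (0 : ℝ), ρ ≤ c := fun c hc =>
    (tendsto_id.mono_left nhdsWithin_le_nhds).eventually_le_const hc
  exact (eventually_mem_nhdsWithin.and ((h 1 one_pos).and (eventually_all.2 fun k =>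
    (h _ (hx₀ k).1).and (h _ (sub_pos.2 (hx₀ k).2))))).exists

variable {Ω : Type*} [MeasurableSpace Ω] {P : Measure Ω}

/-- Lattice designs are regular at adapted scales. -/
theorem IsFixedDesign.exists_regularDesigns {x₀ : Fin d → ℝ} {α : Fin d → ℕ∞} {s : ℕ} {N : ℕ → ℕ}
    {X : ℕ → ℕ → Ω → Fin d → ℝ} (hX : IsFixedDesign x₀ α s N X)
    (hx₀ : ∀ k, x₀ k ∈ Set.Ioo (0 : ℝ) 1)
    (hfin : ∀ k : Fin d, (k : ℕ) < s → 1 ≤ α k ∧ α k ≠ ⊤)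
    (hinf : ∀ k : Fin d, s ≤ (k : ℕ) → α k = ⊤) :
    ∃ D g w ρ Λ, AdaptedScales α (-x₀) (1 - x₀) D g w ρ ∧
      RegularDesigns P N (fun n i ω => X n i ω - x₀) (-x₀) (1 - x₀) D g w Λ := by
  classical
  obtain ⟨β, x, hXx, ⟨hβ, -, hlat⟩, hord, l, hmax, huniq⟩ := hX
  obtain ⟨ρ, hρ, hρ1, hρx⟩ := exists_margin hx₀
  obtain ⟨hκ, hsum, hδD, hδD'⟩ := rate_signs hβ hfin hinf hord hmax huniq
  set κ := rateExponent α β l with hκdef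
  set δ : Fin d → ℝ := fun k => β k - κ * recip (α k) with hδ
  set D := Finset.Ici l with hD
  have h1α : ∀ k, α k ≠ ⊤ → 1 ≤ α k := fun k hk => by
    rcases lt_or_ge (k : ℕ) s with h | h
    · exact (hfin k h).1
    · exact absurd (hinf k h) hk
  set w : ℕ → ℝ := fun n => (n : ℝ) ^ (-κ) with hw
  set g : ℕ → Fin d → ℝ := fun n k =>
    if k ∈ D then (if α k = ⊤ then ρ else w n ^ recip (α k)) else 1 / (axisCount (β k) n : ℝ)
    with hg
  have hw0 : Tendsto w atTop (𝓝 0) :=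
    (tendsto_rpow_neg_atTop hκ).comp tendsto_natCast_atTop_atTop
  have hwpos : ∀ n : ℕ, 1 ≤ n → 0 < w n := fun n hn =>
    Real.rpow_pos_of_pos (by exact_mod_cast hn) _
  have hwt : Tendsto w atTop (𝓝[>] 0) :=
    tendsto_nhdsWithin_iff.2 ⟨hw0, (eventually_ge_atTop 1).mono hwpos⟩
  have hwr : ∀ n : ℕ, ∀ r : ℝ, w n ^ r = (n : ℝ) ^ (-(κ * r)) := fun n r => by
    rw [hw, ← Real.rpow_mul (Nat.cast_nonneg n), neg_mul]
  have hadapt : AdaptedScales α (-x₀) (1 - x₀) D g w ρ := by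
    refine ⟨hρ, fun k => (hρx k).2, fun k => by simpa using (hρx k).1, fun k => ?_, fun k => ?_,
      hwt, ?_, ?_, ?_, fun k hk => ?_⟩
    · simpa using (hx₀ k).1.le
    · simpa using (hx₀ k).2.le
    · filter_upwards [eventually_ge_atTop 1] with n hn k hk
      have hn1 : (1 : ℝ) ≤ n := by exact_mod_cast hn
      have hn0 : (0 : ℝ) < n := by linarith
      simp only [hg, if_neg hk]
      split_ifs with hkD
      · exact le_rfl
      · have h1 := (hδD' k hkD).2
        have h2 : 0 < (axisCount (β k) n : ℝ) :=
          (half_pos (Real.rpow_pos_of_pos hn0 _)).trans_le (half_le_axisCount (hβ k).le hn)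
        rw [hwr]
        calc (n : ℝ) ^ (-(κ * recip (α k))) ≤ (n : ℝ) ^ (-β k) :=
              Real.rpow_le_rpow_of_exponent_le hn1 (by linarith)
          _ = 1 / (n : ℝ) ^ β k := by rw [Real.rpow_neg hn0.le, one_div]
          _ ≤ _ := one_div_le_one_div_of_le h2 (axisCount_le _ _)
    · exact Eventually.of_forall fun n k hkD hk => by simp only [hg, if_pos hkD, if_neg hk]
    · refine Eventually.of_forall fun n k hk => ?_
      have hkD : k ∈ D := by
        by_contra h
        exact (hδD' k h).1 hk
      simp only [hg, if_pos hkD, if_pos hk]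
    · by_cases hkD : k ∈ D
      · simp only [hg, if_pos hkD, if_neg hk]
        exact (tendsto_rpow_recip (recip_pos hk (h1α k hk))).comp hwt
      · simp only [hg, if_neg hkD]
        refine tendsto_const_nhds.div_atTop (tendsto_atTop_mono' atTop
          ((eventually_ge_atTop 1).mono fun n hn => half_le_axisCount (hβ k).le hn)
          (Tendsto.atTop_div_const two_pos ((tendsto_rpow_atTop (hβ k)).comp
            tendsto_natCast_atTop_atTop)))
  refine ⟨D, g, w, ρ, (6 / ρ) ^ d, hadapt, one_le_pow₀ ?_, hw0, hadapt.eventually_frame,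
    fun τ hτ hτ1 => ?_⟩
  · rw [le_div_iff₀ hρ]; linarith
  have hbig : ∀ᶠ n : ℕ in atTop, ∀ k ∈ D, 1 ≤ τ * ((n : ℝ) ^ δ k * (ρ / 2)) := by
    refine (Finset.eventually_all D).2 fun k hk => ?_
    exact (((tendsto_rpow_atTop (hδD k hk)).comp tendsto_natCast_atTop_atTop).atTop_mul_const
      (half_pos hρ) |>.const_mul_atTop hτ).eventually_ge_atTop 1
  refine tendsto_const_nhds.congr' ?_
  filter_upwards [eventually_ge_atTop 1, hbig, hadapt.eventually_scale_pos] with n hn hbig hgpos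
  obtain ⟨G, hG1, hG2, hG3, -, hbij⟩ := hlat n hn
  have hn1 : (1 : ℝ) ≤ n := by exact_mod_cast hn
  have hn0 : (0 : ℝ) < n := by linarith
  have hreg : Regular (N n) (fun i => x n i - x₀) (-x₀) (1 - x₀) (g n) D (w n) ((6 / ρ) ^ d) τ := by
    refine regular_of_lattice (b := fun k => if k ∈ D then (n : ℝ) ^ (-δ k) else 1) hρ hρ1
      (fun k => ⟨hG1 k, hG2 k⟩) hG3 hbij hgpos ?_ (fun k => ?_) (fun k hk => ?_) fun k hk => ?_
    · rw [Finset.prod_ite_mem, Finset.univ_inter, ← Real.rpow_sum_of_pos hn0,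
        Finset.sum_neg_distrib, hsum, hw, ← Real.rpow_natCast, ← Real.rpow_mul hn0.le]
      congr 1; push_cast; ring
    · split_ifs <;> positivity
    · have hgk : (n : ℝ) ^ (-δ k) * (axisCount (β k) n * g n k) =
          (axisCount (β k) n / (n : ℝ) ^ β k) * (if α k = ⊤ then ρ else 1) := by
        simp only [hg, if_pos hk]
        split_ifs with hα
        · simp only [hδ, hα, recip_top, mul_zero, sub_zero, Real.rpow_neg hn0.le]
          ring
        · rw [hwr, div_eq_mul_inv, ← Real.rpow_neg hn0.le, mul_one, mul_left_comm,
            ← Real.rpow_add hn0]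
          congr 2; simp only [hδ]; ring
      have hb := Real.rpow_pos_of_pos hn0 (β k)
      have h1 : (axisCount (β k) n : ℝ) / (n : ℝ) ^ β k ≤ 1 :=
        (div_le_one hb).2 (axisCount_le _ _)
      have h2 : 1 / 2 ≤ (axisCount (β k) n : ℝ) / (n : ℝ) ^ β k := by
        rw [le_div_iff₀ hb]; linarith [half_le_axisCount (hβ k).le hn]
      have h3 : ρ / 2 ≤ (n : ℝ) ^ (-δ k) * (axisCount (β k) n * g n k) := by
        rw [hgk]; split_ifs <;> nlinarith
      simp only [if_pos hk]
      refine ⟨h3, ?_, (hbig k hk).trans ?_⟩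
      · rw [hgk]; split_ifs <;> nlinarith
      · refine mul_le_mul_of_nonneg_left ?_ hτ.le
        have h4 := mul_le_mul_of_nonneg_left h3 (Real.rpow_pos_of_pos hn0 (δ k)).le
        rwa [← mul_assoc, ← Real.rpow_add hn0, add_neg_cancel, Real.rpow_zero, one_mul] at h4
    · simp only [hg, if_neg hk, and_self]
  simp [hXx, hreg]

end LatticeRates

section Random

variable {d N : ℕ} {z : ℕ → Fin d → ℝ} {lo hi g : Fin d → ℝ} {w τ : ℝ}

/-! ### Regularity from the counts in dyadic boxes -/

/-- The half-sides `t (2 ^ j - 1)` of dyadic boxes. -/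
def dyadicSide (t : Fin d → ℝ) {m : ℕ} (j : Fin d → Fin m) : Fin d → ℝ :=
  fun k => t k * (2 ^ (j k : ℕ) - 1)

lemma dyadicSide_nonneg {t : Fin d → ℝ} (ht : ∀ k, 0 < t k) {m : ℕ} (j : Fin d → Fin m) :
    0 ≤ dyadicSide t j := fun k =>
  mul_nonneg (ht k).le (sub_nonneg.2 (one_le_pow₀ one_le_two))

/-- Approximation of a vector in `[0, 1]^d` by dyadic sides from below and above. -/
lemma exists_dyadicSide {t a : Fin d → ℝ} (ht : ∀ k, 0 < t k) {m : ℕ}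
    (hm : ∀ k, 1 + 1 / t k < 2 ^ m) (ha0 : 0 ≤ a) (ha1 : ∀ k, a k ≤ 1) :
    (∃ j : Fin d → Fin (m + 1), dyadicSide t j ≤ a ∧ ∀ k, (a k - t k) / 2 ≤ dyadicSide t j k) ∧
      ∃ j : Fin d → Fin (m + 1), a ≤ dyadicSide t j ∧ ∀ k, t k ≤ dyadicSide t j k ∧
        dyadicSide t j k ≤ 2 * a k + t k := by
  have hex : ∀ k, ∃ j : ℕ, j < m ∧ (2 : ℝ) ^ j * t k ≤ t k + a k ∧
      t k + a k < 2 ^ (j + 1) * t k := by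
    intro k
    have h0 : 0 ≤ a k / t k := div_nonneg (ha0 k) (ht k).le
    obtain ⟨j, hj1, hj2⟩ := exists_nat_pow_near (by linarith : 1 ≤ 1 + a k / t k) one_lt_two
    have h1 : (2 : ℝ) ^ j < 2 ^ m := hj1.trans_lt ((hm k).trans_le' (by
      have := div_le_div_of_nonneg_right (ha1 k) (ht k).le
      linarith))
    have h2 : t k + a k = (1 + a k / t k) * t k := by
      have := (ht k).ne'
      field_simp
    rw [h2]
    exact ⟨j, (pow_lt_pow_iff_right₀ one_lt_two).1 h1,
      mul_le_mul_of_nonneg_right hj1 (ht k).le, mul_lt_mul_of_pos_right hj2 (ht k)⟩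
  choose j hjm hj1 hj2 using hex
  refine ⟨⟨fun k => ⟨j k, by have := hjm k; omega⟩, fun k => ?_, fun k => ?_⟩,
    fun k => ⟨j k + 1, by have := hjm k; omega⟩, fun k => ?_, fun k => ⟨?_, ?_⟩⟩
  · simp only [dyadicSide]; linarith [hj1 k]
  · have := hj2 k
    rw [pow_succ] at this
    simp only [dyadicSide]; linarith
  · simp only [dyadicSide]; linarith [hj2 k]
  · have h1 : (1 : ℝ) ≤ 2 ^ j k := one_le_pow₀ one_le_two
    have := ht k
    simp only [dyadicSide, pow_succ]; nlinarith
  · have := hj1 k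
    simp only [dyadicSide, pow_succ]; linarith

lemma regular_of_counts {p : (Fin d → ℝ) → (Fin d → ℝ) → ℝ} {ρ : ℝ} (hρ : 0 < ρ) (hρ1 : ρ ≤ 1)
    (hτ : 0 < τ) (hw : 0 < w) (hg : ∀ k, 0 < g k) (hlo : ∀ k, -lo k ≤ 1) (hhi : ∀ k, hi k ≤ 1)
    (hlo0 : lo ≤ 0) (hhi0 : 0 ≤ hi) (hz : ∀ i < N, z i ∈ Set.Icc lo hi)
    (hp_le : ∀ u v, u ≤ 0 → 0 ≤ v → p u v ≤ ∏ k, (v k - u k))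
    (hp_eq : ∀ u v, u ≤ 0 → 0 ≤ v → lo ≤ u → v ≤ hi → p u v = ∏ k, (v k - u k))
    (hwg : w ^ 2 * (N * ∏ k, g k) ≤ 1) (hwg' : ρ ^ d ≤ w ^ 2 * (N * ∏ k, g k)) {m : ℕ}
    (hm : ∀ k, 1 + 1 / (τ / 4 * g k) < 2 ^ m)
    (hcount : ∀ i j : Fin d → Fin (m + 1),
      (∀ k, τ / 4 * g k ≤ dyadicSide (fun k => τ / 4 * g k) j k
        + dyadicSide (fun k => τ / 4 * g k) i k) →
      |((block N z (-dyadicSide (fun k => τ / 4 * g k) i)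
          (dyadicSide (fun k => τ / 4 * g k) j)).card : ℝ)
        - N * p (-dyadicSide (fun k => τ / 4 * g k) i) (dyadicSide (fun k => τ / 4 * g k) j)|
      ≤ (N * ∏ k, (dyadicSide (fun k => τ / 4 * g k) j k
        + dyadicSide (fun k => τ / 4 * g k) i k)) / 2) :
    Regular N z lo hi g Finset.univ w (2 * (4 / ρ) ^ d) τ := by
  set t : Fin d → ℝ := fun k => τ / 4 * g k with ht_def
  have ht : ∀ k, 0 < t k := fun k => mul_pos (by linarith) (hg k)
  have htg : ∀ k, t k = τ * g k / 4 := fun k => by simp only [ht_def]; ring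
  have hN : (0 : ℝ) ≤ N := Nat.cast_nonneg N
  have hrel : ∀ u v : Fin d → ℝ, ∏ k, (v k - u k) = (∏ k, g k) * ∏ k, relLen Finset.univ g u v k :=
    fun u v => by
      rw [← Finset.prod_mul_distrib]
      refine Finset.prod_congr rfl fun k _ => ?_
      have := (hg k).ne'
      simp only [relLen, Finset.mem_univ, if_true, zero_add]; field_simp
  have hrel0 : ∀ u v : Fin d → ℝ, u ≤ 0 → 0 ≤ v → 0 ≤ ∏ k, relLen Finset.univ g u v k :=
    fun u v hu hv => Finset.prod_nonneg fun k _ => relLen_nonneg hg hu hv k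
  have hprod_const : ∀ c : ℝ, ∀ u v : Fin d → ℝ, ∏ k, (c * (v k - u k))
      = c ^ d * ∏ k, (v k - u k) := fun c u v => by
    rw [Finset.prod_mul_distrib, Finset.prod_const, Finset.card_univ, Fintype.card_fin]
  refine ⟨hz, fun u v hu hv h => ?_, fun u v hlou hu hv hvhi h => ?_⟩
  · have hclip : block N z (u ⊔ lo) (v ⊓ hi) = block N z u v := by
      ext i
      rw [mem_block, mem_block, sup_le_iff, le_inf_iff]
      exact ⟨fun h => ⟨h.1, h.2.1.1, h.2.2.1⟩, fun h =>
        ⟨h.1, ⟨h.2.1, (hz i h.1).1⟩, ⟨h.2.2, (hz i h.1).2⟩⟩⟩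
    have hU0 : u ⊔ lo ≤ 0 := sup_le hu hlo0
    have hV0 : 0 ≤ v ⊓ hi := le_inf hv hhi0
    obtain ⟨-, i, hi1, hi2⟩ := exists_dyadicSide ht hm (a := -(u ⊔ lo)) (neg_nonneg.2 hU0)
      fun k => (neg_le_neg (le_sup_right (a := u k) (b := lo k))).trans (hlo k)
    obtain ⟨-, j, hj1, hj2⟩ := exists_dyadicSide ht hm (a := v ⊓ hi) hV0
      fun k => (inf_le_right (a := v k) (b := hi k)).trans (hhi k)
    have hi0 := dyadicSide_nonneg ht i
    have hj0 := dyadicSide_nonneg ht j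
    have hc := hcount i j fun k => by
      have h1 := (hi2 k).1
      have h2 := hj0 k
      simp only [Pi.zero_apply] at h2
      have h6 := htg k
      linarith
    have hple := hp_le (-dyadicSide t i) (dyadicSide t j) (neg_nonpos.2 hi0) hj0
    simp only [Pi.neg_apply, sub_neg_eq_add] at hple
    have hsides : ∏ k, (dyadicSide t j k + dyadicSide t i k) ≤ 3 ^ d * ∏ k, (v k - u k) := by
      rw [← hprod_const]
      refine Finset.prod_le_prod (fun k _ => add_nonneg (hj0 k) (hi0 k)) fun k _ => ?_
      have h1 := (hi2 k).2
      have h2 := (hj2 k).2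
      have h3 := h k (Finset.mem_univ k)
      have h4 : -(u ⊔ lo) k ≤ -u k := neg_le_neg (le_sup_left (a := u k) (b := lo k))
      have h5 : (v ⊓ hi) k ≤ v k := inf_le_left (a := v k) (b := hi k)
      have h6 := htg k
      have h7 := ht k
      simp only [Pi.neg_apply] at h1 h4
      linarith
    have hsub : block N z u v ⊆ block N z (-dyadicSide t i) (dyadicSide t j) := by
      rw [← hclip]; exact block_mono (neg_le.1 hi1) hj1
    have hcard : ((block N z u v).card : ℝ)
        ≤ (block N z (-dyadicSide t i) (dyadicSide t j)).card := by
      exact_mod_cast Finset.card_le_card hsub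
    have hcle : ((block N z u v).card : ℝ) ≤ 2 * (N * (3 ^ d * ∏ k, (v k - u k))) := by
      have h1 := (abs_le.1 hc).2
      have h2 := mul_le_mul_of_nonneg_left hple hN
      have h3 := mul_le_mul_of_nonneg_left hsides hN
      have h4 : 0 ≤ ∏ k, (dyadicSide t j k + dyadicSide t i k) :=
        Finset.prod_nonneg fun k _ => add_nonneg (hj0 k) (hi0 k)
      have h5 := mul_nonneg hN h4
      linarith
    have h34 : (3 : ℝ) ^ d ≤ (4 / ρ) ^ d := by
      refine pow_le_pow_left₀ (by norm_num) ?_ d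
      rw [le_div_iff₀ hρ]; linarith
    rw [hrel] at hcle
    calc w ^ 2 * ((block N z u v).card : ℝ)
        ≤ w ^ 2 * (2 * (N * (3 ^ d * ((∏ k, g k) * ∏ k, relLen Finset.univ g u v k)))) := by gcongr
      _ = 2 * 3 ^ d * (w ^ 2 * (N * ∏ k, g k)) * ∏ k, relLen Finset.univ g u v k := by ring
      _ ≤ 2 * 3 ^ d * 1 * ∏ k, relLen Finset.univ g u v k := by
        have := hrel0 u v hu hv
        gcongr
      _ ≤ 2 * (4 / ρ) ^ d * ∏ k, relLen Finset.univ g u v k := by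
        have := hrel0 u v hu hv
        rw [mul_one]
        gcongr
  · obtain ⟨⟨i, hi1, hi2⟩, -⟩ := exists_dyadicSide ht hm (a := -u) (neg_nonneg.2 hu)
      fun k => (neg_le_neg (hlou k)).trans (hlo k)
    obtain ⟨⟨j, hj1, hj2⟩, -⟩ := exists_dyadicSide ht hm (a := v) hv
      fun k => (hvhi k).trans (hhi k)
    have hi0 := dyadicSide_nonneg ht i
    have hj0 := dyadicSide_nonneg ht j
    have hquarter : ∀ k, 1 / 4 * (v k - u k) ≤ dyadicSide t j k + dyadicSide t i k := fun k => by
      have h1 := hi2 k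
      have h2 := hj2 k
      have h3 := h k (Finset.mem_univ k)
      have h6 := htg k
      simp only [Pi.neg_apply] at h1
      linarith
    have hc := hcount i j fun k => by
      have h3 := h k (Finset.mem_univ k)
      have h6 := htg k
      linarith [hquarter k]
    have hi1' : u ≤ -dyadicSide t i := le_neg_of_le_neg hi1
    rw [hp_eq (-dyadicSide t i) (dyadicSide t j) (neg_nonpos.2 hi0) hj0 (hlou.trans hi1')
      (hj1.trans hvhi)] at hc
    simp only [Pi.neg_apply, sub_neg_eq_add] at hc
    have hsides : (1 / 4) ^ d * ∏ k, (v k - u k) ≤ ∏ k, (dyadicSide t j k + dyadicSide t i k) := by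
      rw [← hprod_const]
      refine Finset.prod_le_prod (fun k _ => ?_) fun k _ => hquarter k
      have := (hu k).trans (hv k)
      linarith
    have hcard : ((block N z (-dyadicSide t i) (dyadicSide t j)).card : ℝ)
        ≤ (block N z u v).card := by
      exact_mod_cast Finset.card_le_card (block_mono hi1' hj1)
    have hcge : N * ((1 / 4) ^ d * ∏ k, (v k - u k)) ≤ 2 * ((block N z u v).card : ℝ) := by
      have h1 := (abs_le.1 hc).1
      have h3 := mul_le_mul_of_nonneg_left hsides hN
      linarith
    rw [hrel] at hcge
    have hr := hrel0 u v hu hv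
    have hρd : 0 < ρ ^ d := pow_pos hρ d
    have key : ρ ^ d * (1 / 4) ^ d * ∏ k, relLen Finset.univ g u v k
        ≤ 2 * (w ^ 2 * ((block N z u v).card : ℝ)) := by
      calc _ ≤ w ^ 2 * (N * ∏ k, g k) * (1 / 4) ^ d * ∏ k, relLen Finset.univ g u v k := by gcongr
        _ = w ^ 2 * (N * ((1 / 4) ^ d * ((∏ k, g k) * ∏ k, relLen Finset.univ g u v k))) := by ring
        _ ≤ w ^ 2 * (2 * ((block N z u v).card : ℝ)) := by gcongr
        _ = _ := by ring
    have h4 : (4 / ρ) ^ d * (ρ ^ d * (1 / 4) ^ d) = 1 := by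
      rw [← mul_pow, ← mul_pow]
      have : 4 / ρ * (ρ * (1 / 4)) = 1 := by field_simp
      rw [this, one_pow]
    calc ∏ k, relLen Finset.univ g u v k
        = (4 / ρ) ^ d * (ρ ^ d * (1 / 4) ^ d * ∏ k, relLen Finset.univ g u v k) := by
          rw [← mul_assoc, h4, one_mul]
      _ ≤ (4 / ρ) ^ d * (2 * (w ^ 2 * ((block N z u v).card : ℝ))) := by gcongr
      _ = _ := by ring

variable {Ω : Type*} [MeasurableSpace Ω] {P : Measure Ω} [IsProbabilityMeasure P]

/-- Deviations of the number of design points in a set. -/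
lemma prob_card_sub_gt_le {Z : ℕ → Ω → Fin d → ℝ} (hZ : ∀ i, Measurable (Z i))
    (hind : iIndepFun Z P) {Q : Set (Fin d → ℝ)} (hQ : MeasurableSet Q) {p : ℝ}
    (hp : ∀ i, P.real (Z i ⁻¹' Q) = p) (I : Ω → Finset ℕ) (n : ℕ)
    (hI : ∀ ω i, i ∈ I ω ↔ i < n ∧ Z i ω ∈ Q) {lam : ℝ} (hlam : 0 < lam) :
    P.real {ω | lam < |((I ω).card : ℝ) - n * p|} ≤ n * p / lam ^ 2 := by
  classical
  set φ : (Fin d → ℝ) → ℝ := fun x => Q.indicator 1 x - p with hφ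
  have hφm : Measurable φ := ((measurable_one.indicator hQ).sub_const p)
  have hp0 : 0 ≤ p := (hp 0) ▸ measureReal_nonneg
  have hp1 : p ≤ 1 := (hp 0) ▸ measureReal_le_one
  have hind01 : ∀ x, Q.indicator (1 : (Fin d → ℝ) → ℝ) x = 0 ∨ Q.indicator (1 : (Fin d → ℝ) → ℝ) x = 1 :=
    fun x => by
      by_cases h : x ∈ Q
      · right; simp [h]
      · left; simp [h]
  have hint : ∀ i, Integrable (fun ω => Q.indicator (1 : (Fin d → ℝ) → ℝ) (Z i ω)) P := fun i =>
    Integrable.of_bound ((measurable_one.indicator hQ).comp (hZ i)).aestronglyMeasurable 1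
      (Eventually.of_forall fun ω => by rcases hind01 (Z i ω) with h | h <;> simp [h])
  have hval : ∀ i, ∫ ω, Q.indicator (1 : (Fin d → ℝ) → ℝ) (Z i ω) ∂P = p := fun i => by
    have : (fun ω => Q.indicator (1 : (Fin d → ℝ) → ℝ) (Z i ω)) = (Z i ⁻¹' Q).indicator 1 := by
      ext ω; simp [Set.indicator]
    rw [this, integral_indicator_one (hZ i hQ), hp]
  have hE : CentredErrors P (fun i ω => φ (Z i ω)) p := by
    refine ⟨fun i => hφm.comp (hZ i), hind.comp (fun _ => φ) fun _ => hφm, fun i =>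
      MemLp.of_bound (hφm.comp (hZ i)).aestronglyMeasurable 1 (Eventually.of_forall fun ω => ?_),
      fun i => ?_, fun i => ?_⟩
    · rw [Real.norm_eq_abs, abs_le, hφ]
      rcases hind01 (Z i ω) with h | h <;> simp only [h] <;> constructor <;> linarith
    · simp only [hφ]
      rw [integral_sub (hint i) (integrable_const _), hval]; simp
    · calc ∫ ω, φ (Z i ω) ^ 2 ∂P
          = ∫ ω, ((1 - 2 * p) * Q.indicator (1 : (Fin d → ℝ) → ℝ) (Z i ω) + p ^ 2) ∂P := by
            refine integral_congr_ae (Eventually.of_forall fun ω => ?_)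
            simp only [hφ]
            rcases hind01 (Z i ω) with h | h <;> rw [h] <;> ring
        _ = (1 - 2 * p) * p + p ^ 2 := by
            rw [integral_add ((hint i).const_mul _) (integrable_const _), integral_const_mul, hval]
            simp
        _ ≤ p := by nlinarith
  have h1 := hE.prob_maxDev_le (κ := Fin 0) (Finset.range n) (fun _ k => k.elim0) hlam
  rw [Fintype.card_fin, pow_zero, one_mul, Finset.card_range, mul_comm p] at h1
  refine le_trans (measureReal_mono fun ω hω => ?_) h1
  refine ⟨fun k => k.elim0, ?_⟩
  have hω : lam < |((I ω).card : ℝ) - n * p| := hω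
  refine hω.trans_eq ?_
  congr 1
  rw [Finset.filter_true_of_mem fun i _ k => k.elim0]
  simp only [hφ]
  rw [Finset.sum_sub_distrib, Finset.sum_const, Finset.card_range, nsmul_eq_mul]
  congr 1
  have hIeq : I ω = (Finset.range n).filter fun i => Z i ω ∈ Q := by
    ext i; simp [hI]
  rw [hIeq, Finset.card_filter]
  push_cast
  refine Finset.sum_congr rfl fun i _ => ?_
  simp [Set.indicator]

end Random

section Uniform

variable {d : ℕ} {Ω : Type*} [MeasurableSpace Ω] {P : Measure Ω} [IsProbabilityMeasure P]

/-! ### Regularity of the uniform design -/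

lemma prob_not_regular_le {Z : ℕ → Ω → Fin d → ℝ} (hZ : ∀ i, Measurable (Z i))
    (hind : iIndepFun Z P)
    (hunif : ∀ i, P.map (Z i) = volume.restrict (Set.Icc (0 : Fin d → ℝ) 1))
    {x₀ g : Fin d → ℝ} (hx₀ : ∀ k, x₀ k ∈ Set.Ioo (0 : ℝ) 1) {ρ τ w : ℝ} (hρ : 0 < ρ) (hρ1 : ρ ≤ 1)
    (hτ : 0 < τ) (hw : 0 < w) (hg : ∀ k, 0 < g k) {n m : ℕ} (hn : 1 ≤ n)
    (hwg : w ^ 2 * (n * ∏ k, g k) ≤ 1) (hwg' : ρ ^ d ≤ w ^ 2 * (n * ∏ k, g k))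
    (hm : ∀ k, 1 + 1 / (τ / 4 * g k) < 2 ^ m) :
    P.real {ω | ¬ Regular n (fun i => Z i ω - x₀) (-x₀) (1 - x₀) g Finset.univ w
        (2 * (4 / ρ) ^ d) τ}
      ≤ ((m + 1 : ℕ) : ℝ) ^ (2 * d) * (4 / (n * ∏ k, (τ / 4 * g k))) := by
  classical
  set t : Fin d → ℝ := fun k => τ / 4 * g k with ht_def
  have ht : ∀ k, 0 < t k := fun k => mul_pos (by linarith) (hg k)
  have hn0 : (0 : ℝ) < n := by exact_mod_cast hn
  set Q : (Fin d → ℝ) → (Fin d → ℝ) → Set (Fin d → ℝ) := fun u v => Set.Icc (x₀ + u) (x₀ + v)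
    with hQ
  set p : (Fin d → ℝ) → (Fin d → ℝ) → ℝ := fun u v =>
    volume.real (Q u v ∩ Set.Icc (0 : Fin d → ℝ) 1) with hp
  have hvol : ∀ u v : Fin d → ℝ, u ≤ 0 → 0 ≤ v → volume.real (Q u v) = ∏ k, (v k - u k) :=
    fun u v hu hv => by
      rw [measureReal_def, Real.volume_Icc_pi_toReal (add_le_add_right (hu.trans hv) x₀)]
      exact Finset.prod_congr rfl fun k _ => by simp
  have hfin : ∀ u v : Fin d → ℝ, volume (Q u v) ≠ ⊤ := fun u v =>
    (isCompact_Icc.measure_lt_top).ne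
  have hp_le : ∀ u v, u ≤ 0 → 0 ≤ v → p u v ≤ ∏ k, (v k - u k) := fun u v hu hv => by
    rw [← hvol u v hu hv]
    exact measureReal_mono Set.inter_subset_left (hfin u v)
  have hp_eq : ∀ u v, u ≤ 0 → 0 ≤ v → -x₀ ≤ u → v ≤ 1 - x₀ → p u v = ∏ k, (v k - u k) :=
    fun u v hu hv h1 h2 => by
      rw [← hvol u v hu hv, hp]
      simp only
      rw [Set.inter_eq_left.2]
      refine Set.Icc_subset_Icc ?_ ?_
      · simpa using add_le_add_right h1 x₀
      · simpa using add_le_add_right h2 x₀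
  have hprob : ∀ u v i, P.real (Z i ⁻¹' Q u v) = p u v := fun u v i => by
    rw [← map_measureReal_apply (hZ i) measurableSet_Icc, hunif, measureReal_restrict_apply
      measurableSet_Icc]
  set Bad : (Fin d → Fin (m + 1)) × (Fin d → Fin (m + 1)) → Set Ω := fun ij =>
    {ω | (∀ k, t k ≤ dyadicSide t ij.2 k + dyadicSide t ij.1 k) ∧
      (n * ∏ k, (dyadicSide t ij.2 k + dyadicSide t ij.1 k)) / 2
        < |((block n (fun i => Z i ω - x₀) (-dyadicSide t ij.1) (dyadicSide t ij.2)).card : ℝ)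
          - n * p (-dyadicSide t ij.1) (dyadicSide t ij.2)|} with hBad
  have hcube : P.real {ω | ¬ ∀ i, Z i ω ∈ Set.Icc (0 : Fin d → ℝ) 1} = 0 := by
    have : ∀ᵐ ω ∂P, ∀ i, Z i ω ∈ Set.Icc (0 : Fin d → ℝ) 1 := by
      refine ae_all_iff.2 fun i => ?_
      have h1 : ∀ᵐ x ∂(P.map (Z i)), x ∈ Set.Icc (0 : Fin d → ℝ) 1 := by
        rw [hunif]; exact ae_restrict_mem measurableSet_Icc
      exact ae_of_ae_map (hZ i).aemeasurable h1
    rw [measureReal_def, ae_iff.1 this, ENNReal.toReal_zero]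
  have hsub : {ω | ¬ Regular n (fun i => Z i ω - x₀) (-x₀) (1 - x₀) g Finset.univ w
        (2 * (4 / ρ) ^ d) τ}
      ⊆ {ω | ¬ ∀ i, Z i ω ∈ Set.Icc (0 : Fin d → ℝ) 1} ∪ ⋃ ij, Bad ij := by
    intro ω hω
    by_contra hcon
    rw [Set.mem_union, not_or, Set.mem_iUnion, not_exists] at hcon
    obtain ⟨h1, h2⟩ := hcon
    have h1 : ∀ i, Z i ω ∈ Set.Icc (0 : Fin d → ℝ) 1 := not_not.1 h1
    refine hω (regular_of_counts (p := p) hρ hρ1 hτ hw hg (fun k => by simpa using (hx₀ k).2.le)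
      (fun k => by simpa using (hx₀ k).1.le) (fun k => by simpa using (hx₀ k).1.le)
      (fun k => by simpa using (hx₀ k).2.le) (fun i _ => ?_) hp_le hp_eq hwg hwg' hm
      fun i j hij => ?_)
    · refine ⟨?_, ?_⟩
      · simpa [sub_eq_add_neg, add_comm] using add_le_add_left (h1 i).1 (-x₀)
      · exact sub_le_sub_right (h1 i).2 x₀
    · by_contra h
      exact h2 (i, j) ⟨hij, not_le.1 h⟩
  have hμ : 0 < n * ∏ k, t k := mul_pos hn0 (Finset.prod_pos fun k _ => ht k)
  have hBadle : ∀ ij, P.real (Bad ij) ≤ 4 / (n * ∏ k, t k) := fun ij => by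
    by_cases hij : ∀ k, t k ≤ dyadicSide t ij.2 k + dyadicSide t ij.1 k
    · have h1 : n * ∏ k, t k ≤ n * ∏ k, (dyadicSide t ij.2 k + dyadicSide t ij.1 k) :=
        mul_le_mul_of_nonneg_left (Finset.prod_le_prod (fun k _ => (ht k).le) fun k _ => hij k)
          hn0.le
      set μ := n * ∏ k, (dyadicSide t ij.2 k + dyadicSide t ij.1 k) with hμdef
      have hμ0 : 0 < μ := hμ.trans_le h1
      have hi0 := dyadicSide_nonneg ht ij.1
      have hj0 := dyadicSide_nonneg ht ij.2
      have h2 := prob_card_sub_gt_le hZ hind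
        (measurableSet_Icc : MeasurableSet (Q (-dyadicSide t ij.1) (dyadicSide t ij.2)))
        (hprob (-dyadicSide t ij.1) (dyadicSide t ij.2))
        (fun ω => block n (fun i => Z i ω - x₀) (-dyadicSide t ij.1) (dyadicSide t ij.2)) n
        (fun ω i => by
          rw [mem_block, Set.mem_Icc, le_sub_iff_add_le', sub_le_iff_le_add'])
        (half_pos hμ0)
      have h3 : n * p (-dyadicSide t ij.1) (dyadicSide t ij.2) ≤ μ := by
        refine mul_le_mul_of_nonneg_left ((hp_le _ _ (neg_nonpos.2 hi0) hj0).trans_eq ?_) hn0.le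
        exact Finset.prod_congr rfl fun k _ => by rw [Pi.neg_apply, sub_neg_eq_add]
      calc P.real (Bad ij) ≤ _ := measureReal_mono fun ω hω => hω.2
        _ ≤ _ := h2
        _ ≤ μ / (μ / 2) ^ 2 := by gcongr
        _ = 4 / μ := by field_simp; norm_num
        _ ≤ _ := by gcongr
    · have : Bad ij = ∅ := by
        ext ω
        simp only [hBad, Set.mem_ofPred_eq, Set.mem_empty_iff_false, iff_false]
        exact fun h => hij h.1
      rw [this, measureReal_empty]
      positivity
  calc _ ≤ _ := measureReal_mono hsub
    _ ≤ 0 + ∑ ij, P.real (Bad ij) :=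
      (measureReal_union_le _ _).trans (add_le_add hcube.le (measureReal_iUnion_fintype_le _))
    _ ≤ ∑ _ij : (Fin d → Fin (m + 1)) × (Fin d → Fin (m + 1)), 4 / (n * ∏ k, t k) := by
      rw [zero_add]; exact Finset.sum_le_sum fun ij _ => hBadle ij
    _ = _ := by
      rw [Finset.sum_const, nsmul_eq_mul, Finset.card_univ, Fintype.card_prod, Fintype.card_fun,
        Fintype.card_fin, Fintype.card_fin, ← pow_add, ← two_mul, Nat.cast_pow]

lemma exists_pow_le_two_pow (q : ℕ) : ∃ C : ℝ, 0 ≤ C ∧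
    ∀ m : ℕ, ((m + 2 : ℕ) : ℝ) ^ q ≤ C * 2 ^ m := by
  obtain ⟨C, hC⟩ := (tendsto_pow_const_div_const_pow_of_one_lt q
    (one_lt_two : (1 : ℝ) < 2)).bddAbove_range
  have hC' : ∀ m : ℕ, (m : ℝ) ^ q / 2 ^ m ≤ C := fun m => hC ⟨m, rfl⟩
  refine ⟨C * 4, ?_, fun m => ?_⟩
  · have : 0 ≤ C := le_trans (by positivity) (hC' 0)
    linarith
  · have := hC' (m + 2)
    rw [div_le_iff₀ (by positivity), pow_add] at this
    linarith

lemma recip_le_one (b : ℕ∞) : recip b ≤ 1 := Nat.cast_inv_le_one _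

/-- The uniform design is regular at adapted scales. -/
theorem IsUniformDesign.exists_regularDesigns {ξ : ℕ → Ω → ℝ} {x₀ : Fin d → ℝ} {α : Fin d → ℕ∞}
    {N : ℕ → ℕ} {X : ℕ → ℕ → Ω → Fin d → ℝ} (hX : IsUniformDesign P ξ N X)
    (hx₀ : ∀ k, x₀ k ∈ Set.Ioo (0 : ℝ) 1) (hα : ∀ k, α k ≠ ⊤ → 1 ≤ α k) :
    ∃ D g w ρ Λ, AdaptedScales α (-x₀) (1 - x₀) D g w ρ ∧
      RegularDesigns P N (fun n i ω => X n i ω - x₀) (-x₀) (1 - x₀) D g w Λ := by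
  classical
  obtain ⟨hN, Z, hXZ, hZ, hind, hunif, -⟩ := hX
  obtain ⟨ρ, hρ, hρ1, hρx⟩ := exists_margin hx₀
  set A := 2 + ∑ k, recip (α k) with hA
  have hA0 : 0 < A := by
    have : 0 ≤ ∑ k, recip (α k) := Finset.sum_nonneg fun k _ => recip_nonneg _
    linarith
  set w : ℕ → ℝ := fun n => (n : ℝ) ^ (-(1 / A)) with hw
  set g : ℕ → Fin d → ℝ := fun n k => if α k = ⊤ then ρ else w n ^ recip (α k) with hg
  have hw0 : Tendsto w atTop (𝓝 0) :=
    (tendsto_rpow_neg_atTop (by positivity)).comp tendsto_natCast_atTop_atTop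
  have hwpos : ∀ n : ℕ, 1 ≤ n → 0 < w n := fun n hn =>
    Real.rpow_pos_of_pos (by exact_mod_cast hn) _
  have hwt : Tendsto w atTop (𝓝[>] 0) :=
    tendsto_nhdsWithin_iff.2 ⟨hw0, (eventually_ge_atTop 1).mono hwpos⟩
  have hadapt : AdaptedScales α (-x₀) (1 - x₀) Finset.univ g w ρ := by
    refine ⟨hρ, fun k => (hρx k).2, fun k => by simpa using (hρx k).1, fun k => ?_, fun k => ?_,
      hwt, ?_, ?_, ?_, fun k hk => ?_⟩
    · simpa using (hx₀ k).1.le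
    · simpa using (hx₀ k).2.le
    · exact Eventually.of_forall fun n k hk => by simp only [hg, if_neg hk]; exact le_rfl
    · exact Eventually.of_forall fun n k _ hk => by simp only [hg, if_neg hk]
    · exact Eventually.of_forall fun n k hk => by simp only [hg, if_pos hk]
    · simp only [hg, if_neg hk]
      exact (tendsto_rpow_recip (recip_pos hk (hα k hk))).comp hwt
  refine ⟨Finset.univ, g, w, ρ, 2 * (4 / ρ) ^ d, hadapt, ?_, hw0, hadapt.eventually_frame,
    fun τ hτ hτ1 => ?_⟩
  · have : 1 ≤ 4 / ρ := by rw [le_div_iff₀ hρ]; linarith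
    have := one_le_pow₀ (n := d) this
    linarith
  obtain ⟨C, hC0, hC⟩ := exists_pow_le_two_pow (2 * d)
  set c := 4 / (τ * ρ) with hc
  have hc0 : 0 < c := by positivity
  have hlim : Tendsto (fun n => C * 4 * c ^ d * (w n ^ 2 + w n * c)) atTop (𝓝 0) := by
    have : Tendsto (fun n => C * 4 * c ^ d * (w n ^ 2 + w n * c)) atTop
        (𝓝 (C * 4 * c ^ d * (0 ^ 2 + 0 * c))) :=
      ((hw0.pow 2).add (hw0.mul_const c)).const_mul _
    simpa using this
  refine squeeze_zero' (Eventually.of_forall fun n => measureReal_nonneg) ?_ hlim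
  filter_upwards [eventually_ge_atTop 1, hadapt.eventually_scale_pos,
    hw0.eventually_le_const one_pos] with n hn hgpos hw1
  have hwn := hwpos n hn
  have hn0 : (0 : ℝ) < n := by exact_mod_cast hn
  set r := ∏ k, (if α k = ⊤ then ρ else 1) with hr
  have hprod : w n ^ 2 * (n * ∏ k, g n k) = r := by
    have h1 : ∏ k, g n k = r * w n ^ (∑ k, recip (α k)) := by
      rw [Real.rpow_sum_of_pos hwn, hr, ← Finset.prod_mul_distrib]
      refine Finset.prod_congr rfl fun k _ => ?_
      simp only [hg]
      split_ifs with hk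
      · rw [hk, recip_top, Real.rpow_zero, mul_one]
      · rw [one_mul]
    have h2 : w n ^ 2 * w n ^ (∑ k, recip (α k)) = (n : ℝ)⁻¹ := by
      rw [← Real.rpow_natCast (w n) 2, ← Real.rpow_add hwn, hw, ← Real.rpow_mul hn0.le]
      push_cast
      rw [← hA, neg_mul, one_div, inv_mul_cancel₀ hA0.ne', Real.rpow_neg_one]
    calc w n ^ 2 * (n * ∏ k, g n k) = w n ^ 2 * w n ^ (∑ k, recip (α k)) * n * r := by
          rw [h1]; ring
      _ = r := by rw [h2, inv_mul_cancel₀ hn0.ne', one_mul]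
  have hr1 : r ≤ 1 := Finset.prod_le_one (fun k _ => by split_ifs <;> linarith)
    fun k _ => by split_ifs <;> linarith
  have hrρ : ρ ^ d ≤ r := by
    have : ρ ^ d = ∏ _k : Fin d, ρ := by simp
    rw [this]
    exact Finset.prod_le_prod (fun k _ => hρ.le) fun k _ => by split_ifs <;> linarith
  have hgw : ∀ k, ρ * w n ≤ g n k := fun k => by
    simp only [hg]
    split_ifs
    · nlinarith
    · have : w n ≤ w n ^ recip (α k) := by
        simpa using Real.rpow_le_rpow_of_exponent_ge hwn hw1 (recip_le_one (α k))
      nlinarith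
  have ht₀ : 1 ≤ 1 + c / w n := by
    have : 0 < c / w n := by positivity
    linarith
  obtain ⟨m, hm1, hm2⟩ := exists_nat_pow_near ht₀ one_lt_two
  have hm : ∀ k, 1 + 1 / (τ / 4 * g n k) < 2 ^ (m + 1) := fun k => by
    refine lt_of_le_of_lt (add_le_add_right ?_ 1) hm2
    rw [hc, div_div]
    rw [div_le_div_iff₀ (by have := hgpos k; positivity) (by positivity)]
    have := hgw k
    nlinarith
  have hmain := prob_not_regular_le hZ hind hunif hx₀ hρ hρ1 hτ hwn hgpos hn
    (by rw [hprod]; exact hr1) (by rw [hprod]; exact hrρ) hm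
  simp only [hN, hXZ]
  refine hmain.trans ?_
  have hw2 : 0 < w n ^ 2 := by positivity
  have h4 : 4 / (n * ∏ k, (τ / 4 * g n k)) ≤ 4 * c ^ d * w n ^ 2 := by
    have h5 : n * ∏ k, (τ / 4 * g n k) = (τ / 4) ^ d * (r / w n ^ 2) := by
      rw [Finset.prod_mul_distrib, Finset.prod_const, Finset.card_univ, Fintype.card_fin, ← hprod]
      field_simp
    have h6 : (c ^ d * w n ^ 2)⁻¹ ≤ (τ / 4) ^ d * (r / w n ^ 2) := by
      have : (c ^ d * w n ^ 2)⁻¹ = (τ / 4) ^ d * (ρ ^ d / w n ^ 2) := by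
        rw [hc, mul_inv, ← inv_pow, inv_div, mul_div_right_comm, mul_pow]; ring
      rw [this]; gcongr
    rw [h5]
    calc 4 / ((τ / 4) ^ d * (r / w n ^ 2)) ≤ 4 / (c ^ d * w n ^ 2)⁻¹ := by gcongr
      _ = _ := by rw [div_inv_eq_mul, mul_assoc]
  calc _ ≤ C * 2 ^ m * (4 * c ^ d * w n ^ 2) := by
        refine mul_le_mul (hC m) h4 ?_ (by positivity)
        have : 0 < ∏ k, (τ / 4 * g n k) := Finset.prod_pos fun k _ => mul_pos (by linarith) (hgpos k)
        positivity
    _ ≤ C * (1 + c / w n) * (4 * c ^ d * w n ^ 2) := by gcongr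
    _ = _ := by field_simp

end Uniform

end BlockIsotonic

theorem mainTheorem12 {Ω : Type*} [MeasurableSpace Ω] (P : Measure Ω) [IsProbabilityMeasure P]
    (d : ℕ) (hd : 1 ≤ d)
    (x₀ : Fin d → ℝ) (hx₀ : ∀ k, x₀ k ∈ Set.Ioo (0 : ℝ) 1)
    (f₀ : (Fin d → ℝ) → ℝ) (α : Fin d → ℕ∞) (s : ℕ)
    (hf₀ : BlockIsotonic.IsMonotoneSmooth f₀ x₀ α s)
    (ξ : ℕ → Ω → ℝ) (hξ_meas : ∀ i, Measurable (ξ i)) (hξ_indep : iIndepFun ξ P)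
    (hξ_ident : ∀ i, IdentDistrib (ξ i) (ξ 0) P P) (hξ_L2 : MemLp (ξ 0) 2 P)
    (hξ_mean : ∫ ω, ξ 0 ω ∂P = 0)
    (σ : ℝ) (hσ : 0 < σ) (hξ_var : ∫ ω, ξ 0 ω ^ 2 ∂P = σ ^ 2)
    (N : ℕ → ℕ) (X : ℕ → ℕ → Ω → Fin d → ℝ)
    (hX : BlockIsotonic.IsFixedDesign x₀ α s N X ∨ BlockIsotonic.IsUniformDesign P ξ N X)
    (Y : ℕ → ℕ → Ω → ℝ) (hY : ∀ n i ω, Y n i ω = f₀ (X n i ω) + ξ i ω)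
    (uhat vhat : ℕ → Ω → Fin d → ℝ)
    (huv : ∀ n : ℕ, 1 ≤ n → ∀ᵐ ω ∂P,
      BlockIsotonic.IsFeasiblePair x₀ (N n) (fun i => X n i ω) (fun i => Y n i ω)
        (uhat n ω) (vhat n ω)) :
    TendstoInMeasure P
      (fun (n : ℕ) (ω : Ω) => BlockIsotonic.localVarEst x₀ (N n) (fun i => X n i ω)
        (fun i => Y n i ω) (uhat n ω) (vhat n ω))
      atTop (fun _ => σ ^ 2) := by
  obtain ⟨D, g, w, ρ, Λ, hadapt, hreg⟩ : ∃ D g w ρ Λ,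
      BlockIsotonic.AdaptedScales α (-x₀) (1 - x₀) D g w ρ ∧
      BlockIsotonic.RegularDesigns P N (fun n i ω => X n i ω - x₀) (-x₀) (1 - x₀) D g w Λ := by
    rcases hX with hX | hX
    · exact hX.exists_regularDesigns hx₀ hf₀.finite_exponent hf₀.infinite_exponent
    · refine hX.exists_regularDesigns hx₀ fun k hk => ?_
      rcases lt_or_ge (k : ℕ) s with h | h
      · exact (hf₀.finite_exponent k h).1
      · exact absurd (hf₀.infinite_exponent k h) hk
  obtain ⟨K₁, hsig⟩ := hadapt.exists_signalScales (hf₀.localExpansion hx₀)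
  have hmeas : ∀ n i, Measurable fun ω => X n i ω - x₀ := fun n i => by
    rcases hX with ⟨β, x, hx, -⟩ | ⟨-, Z, hZ, hm, -⟩
    · simp only [hx]; exact measurable_const
    · rw [hZ]; exact (hm i).sub_const x₀
  have hindep : ∀ n, IndepFun (fun ω i => X n i ω - x₀) (fun ω i => ξ i ω) P := fun n => by
    rcases hX with ⟨β, x, hx, -⟩ | ⟨-, Z, hZ, hm, -, -, hind⟩
    · simp only [hx]; exact indepFun_const_left _ _
    · simp only [hZ]
      exact hind.comp (φ := fun (a : ℕ → Fin d → ℝ) i => a i - x₀) (ψ := id)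
        (measurable_pi_lambda _ fun i => Measurable.sub_const
          (f := fun a : ℕ → Fin d → ℝ => a i) (measurable_pi_apply i) x₀) measurable_id
  have hfY : ∀ n i ω, f₀ (x₀ + (X n i ω - x₀)) + ξ i ω = Y n i ω := fun n i ω => by
    rw [hY, add_sub_cancel]
  have := BlockIsotonic.tendstoInMeasure_of_regularDesigns hξ_meas hξ_indep hξ_ident hξ_L2 hξ_mean
    (pow_pos hσ 2) hξ_var hmeas hindep hreg hsig
    (u := fun n ω => uhat n ω - x₀) (v := fun n ω => vhat n ω - x₀)
    (mL := fun n ω => BlockIsotonic.maxMinEst x₀ (N n) (fun i => X n i ω) (fun i => Y n i ω))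
    (mU := fun n ω => BlockIsotonic.minMaxEst x₀ (N n) (fun i => X n i ω) (fun i => Y n i ω))
    (fun n hn => by
      simp only [hfY]
      filter_upwards [huv n hn] with ω hω using hω.lowerOpt)
  simp only [hfY] at this
  simpa only [BlockIsotonic.localVarEst_eq] using this
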